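/- **Setting.** A structured matrix $\bar M\in\{0,*\}^{a\times b}$ has entries that are fixed zeros or free real parameters (the $*$'s), all independent; a realization assigns real values to the $*$'s. The generic rank $\operatorname{grank}$ of a structured matrix, or of a product of structured matrices, is the maximum rank attained as a function of the free parameters. $\bar A\in\{0,*\}^{n\times n}$ is generically diagonalizable if all its realizations outside some proper real algebraic variety of the parameter space are diagonalizable (over $\mathbb C$). Real matrices $(A,B,C)$ are output controllable if, for the system $\dot x=Ax+Bu$, $y=Cx$, from every initial state $x(0)$ (with initial output $y_0=Cx(0)$) every final output $y_f$ is reached, $y(T)=y_f$, at some finite time $T>0$ by some input $u$ on $[0,T]$. A triple $(\bar A,\bar B,\bar C)$ with $\bar A\in\{0,*\}^{n\times n}$, $\bar B\in\{0,*\}^{n\times m}$, $\bar C\in\{0,*\}^{p\times n}$ is structurally output controllable (SOC) if some realization is output controllable. $\mathcal G(\bar A)$ is the digraph on the states $x_1,\dots,x_n$ with an edge $x_i\to x_j$ whenever $\bar A_{ji}=*$. **Algorithm.** Input: $(\bar A,\bar C)$. 1. Take the layered digraph with vertices $u_1,\dots,u_n$, $x_1^2,\dots,x_n^2$, $x_1^1,\dots,x_n^1$,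 $y_1,\dots,y_p$ and edges $x_i^2\to x_j^1$ if $\bar A_{ji}=*$, $u_i\to x_i^1$ for all $i$, and $x_i^1\to y_j$ if $\bar C_{ji}=*$. Build a flow network: split each vertex $v$ into $v^{\mathrm i},v^{\mathrm o}$ with an edge $(v^{\mathrm i},v^{\mathrm o})$; replace each edge $(v,w)$ by $(v^{\mathrm o},w^{\mathrm i})$; add a source $s$ and a sink $t$ with the edges $(s,u_i^{\mathrm i})$, $(s,x_i^{2\mathrm i})$ for all $i$ and $(y_j^{\mathrm o},t)$ for all $j$. All capacities are $1$; the edges $(u_j^{\mathrm o},x_j^{1\mathrm i})$ have cost $1$, and all others have cost $0$. 2. Find a minimum-cost maximum flow $f$ that is integral. Let $X_1=\{x_i: f(u_i^{\mathrm o},x_i^{1\mathrm i})\ne0\}$, $X_2=\{x_i: f(x_i^{2\mathrm i},x_i^{2\mathrm o})\ne 0\}$ and $m=\max\{1,|X_1|\}$. 3. Let $\bar B^*\in\{0,*\}^{n\times m}$ have $\bar B^*_{jk}=*$ when $x_j$ is the $k$th element of $X_1$ (in some enumeration), $1\le k\le|X_1|$; in addition, for each strongly connected component of $\mathcal G(\bar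 A)$ that meets $X_2$, choose one state $x_j$ in the component and one $k\in\{1,\dots,m\}$ and put $\bar B^*_{jk}=*$. All other entries are $0$. Return $\bar B^*$. **Theorem.** Let $p\ge1$, let $\bar A\in\{0,*\}^{n\times n}$ be generically diagonalizable, and let $\bar C\in\{0,*\}^{p\times n}$ satisfy $\operatorname{grank}\bar C=p$. Then the minimum number $m$ of columns over all $\bar B\in\{0,*\}^{n\times m}$, $m\ge 0$, for which $(\bar A,\bar B,\bar C)$ is SOC is $$m^*=\max\{1,\;p-\operatorname{grank}\bar C\bar A\}.$$ Every output $\bar B^*$ of the algorithm, whatever flow, enumeration and choices are used in it, has $m^*$ columns and makes $(\bar A,\bar B^*,\bar C)$ SOC, so it is optimal. Moreover, there are a single random access machine program and a constant $K$ such that, on every such input $(\bar A,\bar C)$, the program halts within $K n^3$ steps with an output $\bar B^*$ of the algorithm. (The machine has natural-number registers and random-access two-dimensional arrays; each read, write, comparison, increment and decrement costs one step.) -/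

import Mathlib

open MeasureTheory

namespace StructuredSystem

/-! ## Structured matrices, realizations, generic rank -/

/-- A structured matrix in `{0,*}^{a × b}`: `true` is a free entry `*`, `false` is a fixed zero. -/
abbrev StructMatrix (a b : ℕ) : Type := Matrix (Fin a) (Fin b) Bool

/-- The positions of the free entries of `M`. -/
abbrev FreeEntry {a b : ℕ} (M : StructMatrix a b) : Type :=
  {ij : Fin a × Fin b // M ij.1 ij.2 = true}

/-- The parameter space of `M`, one real number for each free entry. -/
abbrev Params {a b : ℕ} (M : StructMatrix a b) : Type := FreeEntry M → ℝ

/-- The realization of `M` given by the parameter values `θ`. -/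
def realize {a b : ℕ} (M : StructMatrix a b) (θ : Params M) : Matrix (Fin a) (Fin b) ℝ :=
  Matrix.of fun i j => if h : M i j = true then θ ⟨(i, j), h⟩ else 0

/-- The generic rank of a matrix `P θ` depending on free parameters `θ`: the maximum rank that it
achieves as a function of the parameters. -/
noncomputable def grank {Θ : Type} {a b : ℕ} (P : Θ → Matrix (Fin a) (Fin b) ℝ) : ℕ :=
  sSup (Set.range fun θ => (P θ).rank)

/-- The supremum in the definition of the generic rank is a maximum. -/
theorem grank_isGreatest {Θ : Type} [Nonempty Θ] {a b : ℕ}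
    (P : Θ → Matrix (Fin a) (Fin b) ℝ) :
    IsGreatest (Set.range fun θ => (P θ).rank) (grank P) := by
  have hb : BddAbove (Set.range fun θ => (P θ).rank) := by
    refine ⟨a, ?_⟩
    rintro _ ⟨θ, rfl⟩
    exact Matrix.rank_le_height (P θ)
  exact ⟨Nat.sSup_mem (Set.range_nonempty _) hb, fun r hr => le_csSup hb hr⟩

/-- The generic rank of a structured matrix. -/
noncomputable def structRank {a b : ℕ} (M : StructMatrix a b) : ℕ :=
  grank fun θ : Params M => realize M θ

/-- The generic rank of the product of two structured matrices whose free entries are all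
independent of each other. -/
noncomputable def structRankMul {a b c : ℕ} (M : StructMatrix a b) (N : StructMatrix b c) : ℕ :=
  grank fun θ : Params M × Params N => realize M θ.1 * realize N θ.2

/-! ## Generic diagonalizability -/

/-- A proper algebraic variety in `ℝ^σ`: the common real zeros of a system of polynomials,
different from the whole space. -/
def IsProperVariety {σ : Type} (V : Set (σ → ℝ)) : Prop :=
  (∃ S : Set (MvPolynomial σ ℝ), V = {θ | ∀ q ∈ S, MvPolynomial.eval θ q = 0}) ∧ V ≠ Set.univ

/-- A real square matrix is diagonalizable (over the complex numbers). -/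
def IsDiagonalizable {n : ℕ} (A : Matrix (Fin n) (Fin n) ℝ) : Prop :=
  ∃ (P : GL (Fin n) ℂ) (d : Fin n → ℂ),
    A.map Complex.ofReal = P.val * Matrix.diagonal d * (P⁻¹).val

/-- Almost all realizations (all outside a proper variety) are diagonalizable. -/
def GenericallyDiagonalizable {n : ℕ} (A : StructMatrix n n) : Prop :=
  ∃ V : Set (Params A), IsProperVariety V ∧ ∀ θ, θ ∉ V → IsDiagonalizable (realize A θ)

/-! ## Output controllability -/

/-- `x` is the state trajectory on `[0,T]` of `x' = A x + B u`, `x(0) = x₀`, for the (integrable)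
input `u`. Inputs may be discontinuous, so the differential equation is in integrated form. -/
structure IsTrajectory {n m : ℕ} (A : Matrix (Fin n) (Fin n) ℝ) (B : Matrix (Fin n) (Fin m) ℝ)
    (T : ℝ) (x₀ : Fin n → ℝ) (u : ℝ → Fin m → ℝ) (x : ℝ → Fin n → ℝ) : Prop where
  input_integrable : IntervalIntegrable u volume 0 T
  state_continuous : ContinuousOn x (Set.Icc 0 T)
  state_eq : ∀ t ∈ Set.Icc 0 T,
    x t = x₀ + ∫ s in (0 : ℝ)..t, (A.mulVec (x s) + B.mulVec (u s))

/-- Output controllability of `x' = A x + B u`, `y = C x`: from every initial output `y₀` (whatever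
initial state produces it) every final output `y₁` is reached in finite time by some input. -/
def OutputControllable {n m p : ℕ} (A : Matrix (Fin n) (Fin n) ℝ) (B : Matrix (Fin n) (Fin m) ℝ)
    (C : Matrix (Fin p) (Fin n) ℝ) : Prop :=
  ∀ (y₀ y₁ : Fin p → ℝ) (x₀ : Fin n → ℝ), C.mulVec x₀ = y₀ →
    ∃ T : ℝ, 0 < T ∧ ∃ (u : ℝ → Fin m → ℝ) (x : ℝ → Fin n → ℝ),
      IsTrajectory A B T x₀ u x ∧ C.mulVec (x T) = y₁

/-- Structural output controllability: some realization is output controllable. -/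
def StructurallyOutputControllable {n m p : ℕ} (A : StructMatrix n n) (B : StructMatrix n m)
    (C : StructMatrix p n) : Prop :=
  ∃ (α : Params A) (β : Params B) (γ : Params C),
    OutputControllable (realize A α) (realize B β) (realize C γ)

/-! ## Flows in networks -/

/-- A directed network with a source, a sink, edge capacities and edge costs. -/
structure FlowNetwork (V : Type) where
  Adj : V → V → Prop
  source : V
  sink : V
  cap : V → V → ℝ
  cost : V → V → ℝ

namespace FlowNetwork

variable {V : Type} [Fintype V]

/-- A flow, extended by `0` to the pairs of vertices that are not edges. -/
structure IsFlow (N : FlowNetwork V) (f : V → V → ℝ) : Prop where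
  nonneg : ∀ v w, 0 ≤ f v w
  off_edge : ∀ v w, ¬ N.Adj v w → f v w = 0
  le_cap : ∀ v w, N.Adj v w → f v w ≤ N.cap v w
  conserve : ∀ v, v ≠ N.source → v ≠ N.sink → ∑ w, f w v = ∑ w, f v w

/-- The value of a flow: the net amount that leaves the source. -/
def flowValue (N : FlowNetwork V) (f : V → V → ℝ) : ℝ :=
  ∑ v, f N.source v - ∑ v, f v N.source

def flowCost (N : FlowNetwork V) (f : V → V → ℝ) : ℝ :=
  ∑ v, ∑ w, f v w * N.cost v w

def IsMaxFlow (N : FlowNetwork V) (f : V → V → ℝ) : Prop :=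
  N.IsFlow f ∧ ∀ g, N.IsFlow g → N.flowValue g ≤ N.flowValue f

def IsMinCostMaxFlow (N : FlowNetwork V) (f : V → V → ℝ) : Prop :=
  N.IsMaxFlow f ∧ ∀ g, N.IsMaxFlow g → N.flowCost f ≤ N.flowCost g

def IsIntegral (f : V → V → ℝ) : Prop := ∀ v w, ∃ k : ℤ, f v w = k

end FlowNetwork

/-! ## The flow-based algorithm -/

/-- Vertices of the layered digraph `D(A, B, C)`. -/
inductive LayerVertex (n m p : ℕ) : Type
  | u (i : Fin m)
  | x2 (i : Fin n)
  | x1 (i : Fin n)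
  | y (i : Fin p)
  deriving DecidableEq, Fintype

/-- Edges of the layered digraph `D(A, B, C)`. -/
inductive LayerEdge {n m p : ℕ} (A : StructMatrix n n) (B : StructMatrix n m)
    (C : StructMatrix p n) : LayerVertex n m p → LayerVertex n m p → Prop
  | x2x1 (i j : Fin n) (h : A j i = true) : LayerEdge A B C (.x2 i) (.x1 j)
  | ux1 (i : Fin m) (j : Fin n) (h : B j i = true) : LayerEdge A B C (.u i) (.x1 j)
  | x1y (i : Fin n) (j : Fin p) (h : C j i = true) : LayerEdge A B C (.x1 i) (.y j)

/-- The structured identity matrix. -/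
def structId (n : ℕ) : StructMatrix n n := Matrix.of fun i j => decide (i = j)

/-- Vertices of the flow network: a source, a sink, and two copies `vⁱ`, `vᵒ` of every vertex `v`
of the layered digraph `D(A, I, C)`. -/
inductive NetVertex (n p : ℕ) : Type
  | source
  | sink
  | inn (v : LayerVertex n n p)
  | out (v : LayerVertex n n p)
  deriving DecidableEq, Fintype

/-- Edges of the flow network. -/
inductive NetEdge {n p : ℕ} (A : StructMatrix n n) (C : StructMatrix p n) :
    NetVertex n p → NetVertex n p → Prop
  | split (v : LayerVertex n n p) : NetEdge A C (.inn v) (.out v)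
  | layer (v w : LayerVertex n n p) (h : LayerEdge A (structId n) C v w) :
      NetEdge A C (.out v) (.inn w)
  | source_u (i : Fin n) : NetEdge A C .source (.inn (.u i))
  | source_x2 (i : Fin n) : NetEdge A C .source (.inn (.x2 i))
  | y_sink (i : Fin p) : NetEdge A C (.out (.y i)) .sink

/-- The edge costs: `1` on the edges `(uⱼᵒ, xⱼ¹ⁱ)`, and `0` on all others. -/
def netCost {n p : ℕ} : NetVertex n p → NetVertex n p → ℝ
  | .out (.u i), .inn (.x1 j) => if i = j then 1 else 0
  | _, _ => 0

/-- The flow network `F(A, C)`. -/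
def flowNetwork {n p : ℕ} (A : StructMatrix n n) (C : StructMatrix p n) :
    FlowNetwork (NetVertex n p) where
  Adj := NetEdge A C
  source := .source
  sink := .sink
  cap := fun _ _ => 1
  cost := netCost

open Classical in
/-- The states `xᵢ` whose edge `(uᵢᵒ, xᵢ¹ⁱ)` carries flow. -/
noncomputable def inputStates {n p : ℕ} (f : NetVertex n p → NetVertex n p → ℝ) :
    Finset (Fin n) :=
  Finset.univ.filter fun i => f (.out (.u i)) (.inn (.x1 i)) ≠ 0

/-- The states `xᵢ` whose edge `(xᵢ²ⁱ, xᵢ²ᵒ)` carries flow. -/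
def linkedStates {n p : ℕ} (f : NetVertex n p → NetVertex n p → ℝ) : Set (Fin n) :=
  {i | f (.inn (.x2 i)) (.out (.x2 i)) ≠ 0}

/-- Reachability in the digraph `G(A)` with edges `xᵢ → xⱼ` for the free entries `(j, i)` of `A`. -/
def Reachable {n : ℕ} (A : StructMatrix n n) : Fin n → Fin n → Prop :=
  Relation.ReflTransGen fun i j => A j i = true

/-- `S` is the vertex set of a strongly connected component of `G(A)`. -/
def IsSCC {n : ℕ} (A : StructMatrix n n) (S : Set (Fin n)) : Prop :=
  ∃ i, S = {j | Reachable A i j ∧ Reachable A j i}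

/-- `B` (with `m` columns) is a possible output of the algorithm on input `(A, C)`: for some
minimum cost integral maximum flow `f`, some enumeration `e` of the input states of `f`, and some
choice `g`, for each strongly connected component `S` that contains linked states of `f`, of
a state `(g S).1` in `S` and of a column `(g S).2`, the free entries of `B` are the positions
`(e k, k)` and the positions `g S`. -/
def IsAlgorithmOutput {n p : ℕ} (A : StructMatrix n n) (C : StructMatrix p n)
    (m : ℕ) (B : StructMatrix n m) : Prop :=
  ∃ f : NetVertex n p → NetVertex n p → ℝ,
    (flowNetwork A C).IsMinCostMaxFlow f ∧ FlowNetwork.IsIntegral f ∧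
    m = max 1 (inputStates f).card ∧
    ∃ (e : Fin (inputStates f).card ≃ inputStates f) (g : Set (Fin n) → Fin n × Fin m),
      (∀ S, IsSCC A S → (S ∩ linkedStates f).Nonempty → (g S).1 ∈ S) ∧
      ∀ j k, B j k = true ↔
        (∃ h : (k : ℕ) < (inputStates f).card, (e ⟨k, h⟩ : Fin n) = j) ∨
        (∃ S, IsSCC A S ∧ (S ∩ linkedStates f).Nonempty ∧ g S = (j, k))

/-! ## A random access machine with step count

Programs work on natural-number registers and two-dimensional arrays with random access. The only
arithmetic operations are `+ 1` and `- 1`, so the numbers in memory grow by at most a constant in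
each step and fit into words of logarithmic length; every operation costs one step. -/

structure Mem where
  reg : ℕ → ℕ
  arr : ℕ → ℕ → ℕ → ℕ

inductive Expr : Type
  | const (c : ℕ)
  | reg (r : ℕ)
  | succ (e : Expr)
  | pred (e : Expr)
  | read (a : ℕ) (i j : Expr)

namespace Expr

def eval (s : Mem) : Expr → ℕ
  | const c => c
  | reg r => s.reg r
  | succ e => e.eval s + 1
  | pred e => e.eval s - 1
  | read a i j => s.arr a (i.eval s) (j.eval s)

/-- The number of operations in the evaluation of an expression. -/
def steps : Expr → ℕ
  | const _ => 1
  | reg _ => 1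
  | succ e => e.steps + 1
  | pred e => e.steps + 1
  | read _ i j => i.steps + j.steps + 1

end Expr

inductive Cond : Type
  | eq (e e' : Expr)
  | lt (e e' : Expr)
  | not (c : Cond)
  | and (c c' : Cond)

namespace Cond

def eval (s : Mem) : Cond → Bool
  | eq e e' => decide (e.eval s = e'.eval s)
  | lt e e' => decide (e.eval s < e'.eval s)
  | not c => !c.eval s
  | and c c' => c.eval s && c'.eval s

def steps : Cond → ℕ
  | eq e e' => e.steps + e'.steps + 1
  | lt e e' => e.steps + e'.steps + 1
  | not c => c.steps + 1
  | and c c' => c.steps + c'.steps + 1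

end Cond

inductive Prog : Type
  | skip
  | assign (r : ℕ) (e : Expr)
  | write (a : ℕ) (i j e : Expr)
  | seq (P Q : Prog)
  | ite (c : Cond) (P Q : Prog)
  | loop (c : Cond) (P : Prog)

def Mem.setReg (s : Mem) (r v : ℕ) : Mem :=
  { s with reg := Function.update s.reg r v }

def Mem.setArr (s : Mem) (a i j v : ℕ) : Mem :=
  { s with arr := fun a' i' j' => if a' = a ∧ i' = i ∧ j' = j then v else s.arr a' i' j' }

/-- `Exec P s s' t`: started in memory `s`, the program `P` halts in memory `s'` after `t` steps.
The program `loop c P` repeats `P` while the condition `c` holds. -/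
inductive Exec : Prog → Mem → Mem → ℕ → Prop
  | skip (s : Mem) : Exec .skip s s 1
  | assign (s : Mem) (r : ℕ) (e : Expr) :
      Exec (.assign r e) s (s.setReg r (e.eval s)) (e.steps + 1)
  | write (s : Mem) (a : ℕ) (i j e : Expr) :
      Exec (.write a i j e) s (s.setArr a (i.eval s) (j.eval s) (e.eval s))
        (i.steps + j.steps + e.steps + 1)
  | seq {P Q : Prog} {s s₁ s₂ : Mem} {t₁ t₂ : ℕ} (h₁ : Exec P s s₁ t₁) (h₂ : Exec Q s₁ s₂ t₂) :
      Exec (.seq P Q) s s₂ (t₁ + t₂)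
  | ite_true {c : Cond} {P Q : Prog} {s s' : Mem} {t : ℕ} (hc : c.eval s = true)
      (h : Exec P s s' t) : Exec (.ite c P Q) s s' (c.steps + 1 + t)
  | ite_false {c : Cond} {P Q : Prog} {s s' : Mem} {t : ℕ} (hc : c.eval s = false)
      (h : Exec Q s s' t) : Exec (.ite c P Q) s s' (c.steps + 1 + t)
  | loop_false {c : Cond} {P : Prog} {s : Mem} (hc : c.eval s = false) :
      Exec (.loop c P) s s (c.steps + 1)
  | loop_true {c : Cond} {P : Prog} {s s₁ s₂ : Mem} {t₁ t₂ : ℕ} (hc : c.eval s = true)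
      (h₁ : Exec P s s₁ t₁) (h₂ : Exec (.loop c P) s₁ s₂ t₂) :
      Exec (.loop c P) s s₂ (c.steps + 1 + t₁ + t₂)

/-- A structured matrix as a `0`-`1` array, extended by `0`. -/
def encodeMatrix {a b : ℕ} (M : StructMatrix a b) (i j : ℕ) : ℕ :=
  if h : i < a ∧ j < b then (if M ⟨i, h.1⟩ ⟨j, h.2⟩ = true then 1 else 0) else 0

/-- The initial memory: `n` and `p` in registers `0` and `1`, the structured matrices `A` and `C`
in arrays `0` and `1`, and `0` everywhere else. -/
def inputMem {n p : ℕ} (A : StructMatrix n n) (C : StructMatrix p n) : Mem where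
  reg := fun r => if r = 0 then n else if r = 1 then p else 0
  arr := fun a i j =>
    if a = 0 then encodeMatrix A i j else if a = 1 then encodeMatrix C i j else 0

/-- The number of columns of the output matrix, in register `2`. -/
def outputCols (s : Mem) : ℕ := s.reg 2

/-- The output matrix, in array `2`. -/
def outputMatrix (n : ℕ) (s : Mem) : StructMatrix n (outputCols s) :=
  Matrix.of fun i j => decide (s.arr 2 i j ≠ 0)

end StructuredSystem

/-! Lower bound. If `w` annihilates both `CA` and `CB`, then `w · y` is constant along every
trajectory. Output controllability therefore makes the common left kernel of `CA` and `CB` trivial,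
so `p ≤ m + rank CA`. With no input at all, the zero state never moves, so `m ≥ 1`.

From ranks to paths. Surviving terms of determinant expansions turn generic ranks into
vertex-disjoint paths in the layered digraph: `grank C = p` gives `p` paths `u → x¹ → y`, and `grank
CA` is the largest number of disjoint paths `x² → x¹ → y`. A maximum flow has value `p` and pays one
for each unit that starts in a `u`, so its minimum cost is `p` minus the largest flow through the
`x²`. That difference is `p - grank CA`.

From paths to controllability. Let `P` project onto the states reachable from the inputs. Two
properties are shown to be generic: `C [B, A P]` has full row rank, witnessed by the 0-1 realization
along the paths, and the vectors `A^k b`, `k ≥ 1`, with `b = B 1`, span the range of `A P`. If `w C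
A^k B = 0` for all `k`, then `w C` annihilates `A P` and `B`, so `w = 0`, and a Gramian argument
gives output controllability (`Linking.structurallyOutputControllable`).

For the second property, generic diagonalizability gives `ker (A P)² = ker (A P)`. Hence the
coefficient of `X^(n-r)` in the characteristic polynomial does not vanish, where `r` is the generic
rank of `A P`. A term of its expansion covers `r` reachable states by disjoint cycles
(`exists_cycles`). The cycles are then attached one after another, each driven by an input or by an
earlier state, with rapidly growing weights (`ControllableOn.extend`). This yields `r` distinct
nonzero eigenvalues whose left eigenvectors are not orthogonal to `b`, so `M b, …, M^r b` are
independent.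

The program. The flow problem becomes a bipartite matching in which a state `xᵢ¹` off the paths is
matched with itself. Left vertices are processed in the order `x¹`, `x²`, `u`. Augmentation never
unmatches a left vertex, so the `x²` take priority over the costly `u`. A left vertex that cannot be
matched leaves a closed set as a certificate, later augmenting paths avoid it, and these
certificates bound every fractional matching (`IsGreedyMatching.sum_le_card`). There are `3 n`
searches of quadratic cost, followed by a cubic transitive closure. -/

namespace StructuredSystem

/-! ### Polynomial functions and generic parameters -/

open Polynomial in
/-- The functions that are polynomial along every line. -/
def linePoly (E : Type*) [AddCommGroup E] [Module ℝ E] : Subalgebra ℝ (E → ℝ) where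
  carrier := {f | ∀ x y, ∃ q : ℝ[X], ∀ t : ℝ, f (x + t • y) = q.eval t}
  mul_mem' := by
    intro f g hf hg x y
    obtain ⟨q, hq⟩ := hf x y
    obtain ⟨r, hr⟩ := hg x y
    exact ⟨q * r, fun t => by simp [hq, hr]⟩
  add_mem' := by
    intro f g hf hg x y
    obtain ⟨q, hq⟩ := hf x y
    obtain ⟨r, hr⟩ := hg x y
    exact ⟨q + r, fun t => by simp [hq, hr]⟩
  algebraMap_mem' := fun c x y => ⟨Polynomial.C c, fun t => by simp⟩

section linePoly

variable {E F : Type*} [AddCommGroup E] [Module ℝ E] [AddCommGroup F] [Module ℝ F]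

theorem linePoly_const (c : ℝ) : (fun _ : E => c) ∈ linePoly E := (linePoly E).algebraMap_mem c

theorem linePoly_linear (L : E →ₗ[ℝ] ℝ) : (fun θ => L θ) ∈ linePoly E := fun x y =>
  ⟨Polynomial.C (L x) + Polynomial.X * Polynomial.C (L y), fun t => by simp; ring⟩

theorem linePoly_comp {f : F → ℝ} (hf : f ∈ linePoly F) (L : E →ₗ[ℝ] F) :
    (fun θ => f (L θ)) ∈ linePoly E := fun x y => by
  obtain ⟨q, hq⟩ := hf (L x) (L y)
  exact ⟨q, fun t => by simp [hq]⟩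

theorem linePoly_sum {ι : Type*} {s : Finset ι} {f : ι → E → ℝ}
    (h : ∀ i ∈ s, f i ∈ linePoly E) : (fun θ => ∑ i ∈ s, f i θ) ∈ linePoly E := by
  have := (linePoly E).sum_mem h
  rwa [show ∑ i ∈ s, f i = fun θ => ∑ i ∈ s, f i θ by ext; simp] at this

theorem linePoly_prod {ι : Type*} {s : Finset ι} {f : ι → E → ℝ}
    (h : ∀ i ∈ s, f i ∈ linePoly E) : (fun θ => ∏ i ∈ s, f i θ) ∈ linePoly E := by
  have := (linePoly E).prod_mem h
  rwa [show ∏ i ∈ s, f i = fun θ => ∏ i ∈ s, f i θ by ext; simp] at this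

theorem linePoly_matrix_mul {α β γ : Type*} [Fintype β] {M : E → Matrix α β ℝ}
    {N : E → Matrix β γ ℝ} (hM : ∀ i j, (fun θ => M θ i j) ∈ linePoly E)
    (hN : ∀ i j, (fun θ => N θ i j) ∈ linePoly E) (i : α) (j : γ) :
    (fun θ => (M θ * N θ) i j) ∈ linePoly E := by
  simp only [Matrix.mul_apply]
  exact linePoly_sum fun k _ => (linePoly E).mul_mem (hM i k) (hN k j)

theorem linePoly_matrix_add {α β : Type*} {M N : E → Matrix α β ℝ}
    (hM : ∀ i j, (fun θ => M θ i j) ∈ linePoly E)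
    (hN : ∀ i j, (fun θ => N θ i j) ∈ linePoly E) (i : α) (j : β) :
    (fun θ => (M θ + N θ) i j) ∈ linePoly E :=
  (linePoly E).add_mem (hM i j) (hN i j)

theorem linePoly_matrix_pow {α : Type*} [Fintype α] [DecidableEq α] {M : E → Matrix α α ℝ}
    (hM : ∀ i j, (fun θ => M θ i j) ∈ linePoly E) (k : ℕ) :
    ∀ i j, (fun θ => (M θ ^ k) i j) ∈ linePoly E := by
  induction k with
  | zero => intro i j; simpa using linePoly_const _
  | succ k ih => simpa only [pow_succ] using linePoly_matrix_mul ih hM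

theorem linePoly_det {α : Type*} [Fintype α] [DecidableEq α] {M : E → Matrix α α ℝ}
    (hM : ∀ i j, (fun θ => M θ i j) ∈ linePoly E) : (fun θ => (M θ).det) ∈ linePoly E := by
  simp only [Matrix.det_apply']
  exact linePoly_sum fun σ _ =>
    (linePoly E).mul_mem (linePoly_const _) (linePoly_prod fun i _ => hM (σ i) i)

theorem linePoly_eval {σ : Type} (q : MvPolynomial σ ℝ) :
    (fun θ : σ → ℝ => MvPolynomial.eval θ q) ∈ linePoly (σ → ℝ) := by
  induction q using MvPolynomial.induction_on with
  | C a => simpa using linePoly_const a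
  | add p q hp hq =>
    simp only [map_add]
    exact (linePoly _).add_mem hp hq
  | mul_X p i hp =>
    simp only [map_mul, MvPolynomial.eval_X]
    exact (linePoly _).mul_mem hp (linePoly_linear (LinearMap.proj i : (σ → ℝ) →ₗ[ℝ] ℝ))

theorem linePoly_realize {a b : ℕ} (M : StructMatrix a b) (i : Fin a) (j : Fin b) :
    (fun θ : Params M => realize M θ i j) ∈ linePoly (Params M) := by
  by_cases h : M i j = true
  · simpa [realize, h] using
      linePoly_linear (LinearMap.proj ⟨(i, j), h⟩ : Params M →ₗ[ℝ] ℝ)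
  · simpa [realize, h] using linePoly_const 0

/-- On the line through `x` and `y` both functions become nonzero univariate polynomials, and their
product has a non-root in the infinite field `ℝ`. Generic properties witnessed at different
parameter values are combined in this way, and it only needs polynomiality along lines. -/
theorem linePoly_exists_ne_zero {f g : E → ℝ} (hf : f ∈ linePoly E) (hg : g ∈ linePoly E)
    {x y : E} (hx : f x ≠ 0) (hy : g y ≠ 0) : ∃ z, f z ≠ 0 ∧ g z ≠ 0 := by
  obtain ⟨q, hq⟩ := hf x (y - x)
  obtain ⟨r, hr⟩ := hg x (y - x)
  have hq0 : q ≠ 0 := by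
    rintro rfl
    exact hx (by simpa using hq 0)
  have hr0 : r ≠ 0 := by
    rintro rfl
    exact hy (by simpa using hr 1)
  obtain ⟨t, ht⟩ := Polynomial.exists_eval_ne_zero_of_natDegree_lt_card (q * r)
    (mul_ne_zero hq0 hr0) (by
      rw [Cardinal.mk_real]; exact (Cardinal.natCast_lt_aleph0).trans_le Cardinal.aleph0_le_continuum)
  rw [Polynomial.eval_mul] at ht
  exact ⟨x + t • (y - x), by rw [hq]; exact left_ne_zero_of_mul ht,
    by rw [hr]; exact right_ne_zero_of_mul ht⟩

end linePoly

/-! ## Rank and determinants -/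

/-- Records a rank bound at one parameter value in constant matrices `U` and `V`. For varying `M`
the condition `det (U * M * V) ≠ 0` is polynomial in the entries, and by `le_rank_of_det_ne_zero` it
implies the same bound. -/
theorem exists_mul_mul_eq_one_of_le_rank {a b r : ℕ} (M : Matrix (Fin a) (Fin b) ℝ)
    (h : r ≤ M.rank) : ∃ (U : Matrix (Fin r) (Fin a) ℝ) (V : Matrix (Fin b) (Fin r) ℝ),
      U * M * V = 1 := by
  let bs := Module.finBasis ℝ (LinearMap.range M.mulVecLin)
  let v : Fin r → LinearMap.range M.mulVecLin := fun i => bs (Fin.castLE h i)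
  have hv : LinearIndependent ℝ v := bs.linearIndependent.comp _ (Fin.castLE_injective h)
  have hv' : LinearIndependent ℝ fun i => (v i : Fin a → ℝ) :=
    hv.map' (Submodule.subtype _) (Submodule.ker_subtype _)
  choose x hx using fun i => (v i).2
  let V : Matrix (Fin b) (Fin r) ℝ := Matrix.of fun i j => x j i
  have hcol : (M * V).col = fun i => (v i : Fin a → ℝ) := by
    ext j i
    rw [← hx j]
    simp [Matrix.mul_apply, V, Matrix.mulVec, dotProduct]
  have hinj : LinearMap.ker (M * V).mulVecLin = ⊥ :=
    LinearMap.ker_eq_bot.2 (Matrix.mulVec_injective_iff.2 (hcol ▸ hv'))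
  obtain ⟨g, hg⟩ := LinearMap.exists_leftInverse_of_injective _ hinj
  refine ⟨LinearMap.toMatrix' g, V, ?_⟩
  rw [Matrix.mul_assoc, ← LinearMap.toMatrix'_toLin' (M * V), ← LinearMap.toMatrix'_comp,
    Matrix.toLin'_apply', hg, LinearMap.toMatrix'_id]

theorem le_rank_of_det_ne_zero {a b r : ℕ} (U : Matrix (Fin r) (Fin a) ℝ)
    (M : Matrix (Fin a) (Fin b) ℝ) (V : Matrix (Fin b) (Fin r) ℝ) (h : (U * M * V).det ≠ 0) :
    r ≤ M.rank := by
  have h1 : (U * M * V).rank = r := by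
    rw [Matrix.rank_of_isUnit _ ((Matrix.isUnit_iff_isUnit_det _).2 h.isUnit), Fintype.card_fin]
  have h2 := Matrix.rank_mul_le_left (U * M) V
  have h3 := Matrix.rank_mul_le_right U M
  omega

/-- If `det (M * N) ≠ 0`, then a term of the expansion of the determinant along the rows of `M`
does not vanish. -/
theorem exists_of_det_mul_ne_zero {R : Type*} [CommRing R] {r a : ℕ}
    (M : Matrix (Fin r) (Fin a) R) (N : Matrix (Fin a) (Fin r) R) (h : (M * N).det ≠ 0) :
    ∃ f : Fin r → Fin a, (∀ i, M i (f i) ≠ 0) ∧ (N.submatrix f id).det ≠ 0 := by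
  have hdet : (M * N).det = ∑ f : Fin r → Fin a, (∏ i, M i (f i)) • (N.submatrix f id).det := by
    have h1 : M * N = fun i => ∑ k, M i k • N k := by
      ext i j
      simp [Matrix.mul_apply]
    calc (M * N).det = Matrix.detRowAlternating.toMultilinearMap (fun i => ∑ k, M i k • N k) := by
          rw [h1]; rfl
      _ = _ := by
          rw [MultilinearMap.map_sum]
          refine Finset.sum_congr rfl fun f _ => ?_
          rw [MultilinearMap.map_smul_univ]
          rfl
  rw [hdet] at h
  obtain ⟨f, _, hf⟩ := Finset.exists_ne_zero_of_sum_ne_zero h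
  refine ⟨f, fun i hi => hf ?_, fun hi => hf ?_⟩
  · rw [Finset.prod_eq_zero (Finset.mem_univ i) hi, zero_smul]
  · rw [hi, smul_zero]

theorem injective_of_det_submatrix_ne_zero {R : Type*} [CommRing R] {r a : ℕ}
    {N : Matrix (Fin a) (Fin r) R} {f : Fin r → Fin a} (h : (N.submatrix f id).det ≠ 0) :
    Function.Injective f := by
  intro i j hij
  by_contra hne
  exact h (Matrix.det_zero_of_row_eq hne (by ext k; simp [hij]))

-- Expand the determinant of `X - A` by Leibniz and then each product of binomials. A surviving term
-- of degree `k` takes `X` at `k` fixed points of `σ` and an entry of `A` at every other index. The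
-- other indices form `I`, which is covered by cycles of the graph; a fixed point of `σ` in `I` is a
-- loop.
open Polynomial in
theorem exists_perm_of_charpoly_coeff_ne_zero {n k : ℕ} (A : Matrix (Fin n) (Fin n) ℝ)
    (h : A.charpoly.coeff k ≠ 0) : ∃ (σ : Equiv.Perm (Fin n)) (I : Finset (Fin n)),
      I.card + k = n ∧ (∀ i ∈ I, A (σ i) i ≠ 0) ∧ ∀ i ∉ I, σ i = i := by
  rw [Matrix.charpoly, Matrix.det_apply', Polynomial.finsetSum_coeff] at h
  obtain ⟨σ, _, hσ⟩ := Finset.exists_ne_zero_of_sum_ne_zero h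
  have h1 : ∀ i, A.charmatrix (σ i) i = (if σ i = i then X else 0) + C (-A (σ i) i) := by
    intro i
    rw [Matrix.charmatrix_apply, Matrix.diagonal_apply, map_neg, sub_eq_add_neg]
  simp only [h1] at hσ
  rw [Finset.prod_add, Finset.mul_sum, Polynomial.finsetSum_coeff] at hσ
  obtain ⟨t, _, ht⟩ := Finset.exists_ne_zero_of_sum_ne_zero hσ
  have hfix : ∀ i ∈ t, σ i = i := by
    intro i hi
    by_contra hne
    apply ht
    rw [Finset.prod_eq_zero hi (if_neg hne)]
    simp
  rw [Finset.prod_congr rfl (fun i hi => if_pos (hfix i hi)), Finset.prod_const, ← map_prod] at ht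
  have hcast : ((Equiv.Perm.sign σ : ℤ) : ℝ[X]) = C ((Equiv.Perm.sign σ : ℤ) : ℝ) := by simp
  rw [hcast, Polynomial.coeff_C_mul, Polynomial.coeff_mul_C, Polynomial.coeff_X_pow] at ht
  refine ⟨σ, Finset.univ \ t, ?_, fun i hi h0 => ht ?_, fun i hi => hfix i (by simpa using hi)⟩
  · have hk : k = t.card := by
      by_contra hne
      simp [hne] at ht
    rw [Finset.card_sdiff_of_subset (Finset.subset_univ t), hk]
    have := Finset.card_le_univ t
    simp at this ⊢
    omega
  · rw [Finset.prod_eq_zero hi (by simp [h0])]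
    simp

/-- The hypothesis makes the generalized eigenspace of `0` equal to the kernel. The algebraic
multiplicity of `0`, which is the trailing degree of the characteristic polynomial, is thus `n -
rank A`. -/
theorem charpoly_coeff_ne_zero_of_ker_sq {n : ℕ} (A : Matrix (Fin n) (Fin n) ℝ)
    (h : ∀ x, A.mulVec (A.mulVec x) = 0 → A.mulVec x = 0) :
    A.charpoly.coeff (n - A.rank) ≠ 0 := by
  set φ : Module.End ℝ (Fin n → ℝ) := Matrix.toLin' A with hφ
  have hker : ∀ k x, (φ ^ (k + 1)) x = 0 → φ x = 0 := by
    intro k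
    induction k with
    | zero => intro x hx; simpa using hx
    | succ k ih =>
      intro x hx
      rw [pow_succ, Module.End.mul_apply] at hx
      exact h x (ih _ hx)
  have hE : φ.maxGenEigenspace 0 = LinearMap.ker φ := by
    ext x
    rw [Module.End.mem_maxGenEigenspace, LinearMap.mem_ker]
    constructor
    · rintro ⟨k, hk⟩
      rw [zero_smul, sub_zero] at hk
      apply hker k x
      rw [pow_succ', Module.End.mul_apply, hk, map_zero]
    · intro hx
      exact ⟨1, by simpa using hx⟩
  have h1 := φ.finrank_maxGenEigenspace_zero_eq
  rw [hE] at h1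
  have h2 := LinearMap.finrank_range_add_finrank_ker φ
  have h3 : Module.finrank ℝ (LinearMap.range φ) = A.rank := by
    rw [Matrix.rank, ← Matrix.toLin'_apply']
  rw [h3, h1, Module.finrank_fin_fun, hφ, Matrix.charpoly_toLin'] at h2
  have h4 : n - A.rank = A.charpoly.natTrailingDegree := by omega
  rw [h4]
  exact Polynomial.trailingCoeff_nonzero_iff_nonzero.2 A.charpoly_monic.ne_zero

/-! ## Output controllability -/

section fundamental

attribute [local instance] Matrix.linftyOpNormedRing Matrix.linftyOpNormedAlgebra

/-- Derivatives are stated entrywise, so that the matrix norm used for the exponential stays local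
to this section. -/
theorem exists_fundamentalMatrix {n : ℕ} (A : Matrix (Fin n) (Fin n) ℝ) :
    ∃ Φ : ℝ → Matrix (Fin n) (Fin n) ℝ, (∀ s t, Φ (s + t) = Φ s * Φ t) ∧ Φ 0 = 1 ∧
      ∀ t i j, HasDerivAt (fun s => Φ s i j) ((A * Φ t) i j) t := by
  refine ⟨fun t => NormedSpace.exp (t • A), fun s t => ?_, by simp, fun t i j => ?_⟩
  · simp only [add_smul]
    exact Matrix.exp_add_of_commute _ _
      (((Commute.refl A).smul_left s).smul_right t)
  · have h : HasDerivAt (fun s : ℝ => NormedSpace.exp (s • A)) (A * NormedSpace.exp (t • A)) t :=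
      hasDerivAt_exp_smul_const' A t
    exact hasDerivAt_pi.1 (hasDerivAt_pi.1 h i) j

end fundamental

-- The Gramian `G = ∫ K Kᵀ` on `[0, 1]` is invertible under this hypothesis, and then every output
-- can be corrected at time `1` by an input of the form `Kᵀ g`.
open Matrix in
theorem outputControllable_of_forall_vecMul_eq_zero {n m p : ℕ} {A : Matrix (Fin n) (Fin n) ℝ}
    {B : Matrix (Fin n) (Fin m) ℝ} {C : Matrix (Fin p) (Fin n) ℝ}
    (h : ∀ w : Fin p → ℝ, (∀ k : ℕ, w ᵥ* (C * A ^ k * B) = 0) → w = 0) :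
    OutputControllable A B C := by
  obtain ⟨Φ, hadd, hzero, hderiv⟩ := exists_fundamentalMatrix A
  have hcont : Continuous Φ :=
    continuous_pi fun i => continuous_pi fun j =>
      continuous_iff_continuousAt.2 fun t => (hderiv t i j).continuousAt
  set K : ℝ → Matrix (Fin p) (Fin m) ℝ := fun s => C * Φ (1 - s) * B with hK
  have hKc : Continuous K := by
    have : Continuous fun s : ℝ => Φ (1 - s) := hcont.comp (by fun_prop)
    exact (continuous_const.matrix_mul this).matrix_mul continuous_const
  set G : Matrix (Fin p) (Fin p) ℝ := Matrix.of fun i j => ∫ s in (0:ℝ)..1, (K s * (K s)ᵀ) i j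
    with hG
  have hKK : ∀ i j, Continuous fun s => (K s * (K s)ᵀ) i j := fun i j =>
    (hKc.matrix_mul hKc.matrix_transpose).matrix_elem i j
  have hGv : ∀ g i, (G *ᵥ g) i = ∫ s in (0:ℝ)..1, (K s *ᵥ ((K s)ᵀ *ᵥ g)) i := by
    intro g i
    simp only [Matrix.mulVec_mulVec]
    simp only [Matrix.mulVec, dotProduct]
    rw [intervalIntegral.integral_finsetSum]
    · simp [hG]
    · exact fun j _ => ((hKK i j).mul continuous_const).intervalIntegrable _ _
  have hGinj : ∀ g, G *ᵥ g = 0 → g = 0 := by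
    intro g hg
    apply h
    have hvc : Continuous fun s => (K s)ᵀ *ᵥ g := hKc.matrix_transpose.matrix_mulVec continuous_const
    -- `g · G g` is the integral of the nonnegative function `|Kᵀ g|²`.
    have h1 : ∫ s in (0:ℝ)..1, ((K s)ᵀ *ᵥ g) ⬝ᵥ ((K s)ᵀ *ᵥ g) = 0 := by
      have : g ⬝ᵥ (G *ᵥ g) = 0 := by rw [hg, dotProduct_zero]
      refine Eq.trans ?_ this
      simp only [dotProduct, hGv]
      rw [show (∑ i, g i * ∫ s in (0:ℝ)..1, (K s *ᵥ ((K s)ᵀ *ᵥ g)) i) =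
        ∑ i, ∫ s in (0:ℝ)..1, g i * (K s *ᵥ ((K s)ᵀ *ᵥ g)) i by
          simp [intervalIntegral.integral_const_mul]]
      rw [← intervalIntegral.integral_finsetSum]
      · refine intervalIntegral.integral_congr fun s _ => ?_
        change ((K s)ᵀ *ᵥ g) ⬝ᵥ ((K s)ᵀ *ᵥ g) = g ⬝ᵥ (K s *ᵥ ((K s)ᵀ *ᵥ g))
        rw [Matrix.dotProduct_mulVec g, Matrix.mulVec_transpose]
      · intro i _
        have : Continuous fun s => K s *ᵥ ((K s)ᵀ *ᵥ g) := hKc.matrix_mulVec hvc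
        exact (continuous_const.mul ((continuous_apply i).comp this)).intervalIntegrable _ _
    have h2 : ∀ s ∈ Set.Icc (0:ℝ) 1, (K s)ᵀ *ᵥ g = 0 := by
      by_contra hne
      push Not at hne
      obtain ⟨s, hs, hs0⟩ := hne
      have := intervalIntegral.integral_pos (f := fun s => ((K s)ᵀ *ᵥ g) ⬝ᵥ ((K s)ᵀ *ᵥ g))
        zero_lt_one (hvc.dotProduct hvc).continuousOn
        (fun x _ => Finset.sum_nonneg fun i _ => mul_self_nonneg _)
        ⟨s, hs, lt_of_le_of_ne (Finset.sum_nonneg fun i _ => mul_self_nonneg _)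
          (fun h0 => hs0 (dotProduct_self_eq_zero.1 h0.symm))⟩
      exact this.ne' h1
    -- Each differentiation of the identity inserts a factor `A` in front of `Φ t`. Derivatives
    -- within `[0, 1]` are used, so the endpoint `0`, where `Φ = 1`, is included.
    have h3 : ∀ k : ℕ, ∀ t ∈ Set.Icc (0:ℝ) 1, g ᵥ* (C * A ^ k * Φ t * B) = 0 := by
      intro k
      induction k with
      | zero =>
        intro t ht
        have := h2 (1 - t) ⟨by linarith [ht.2], by linarith [ht.1]⟩
        rw [Matrix.mulVec_transpose] at this
        simpa [hK] using this
      | succ k ih =>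
        intro t ht
        ext j
        have hd : HasDerivAt (fun s => (g ᵥ* (C * A ^ k * Φ s * B)) j)
            ((g ᵥ* (C * A ^ k * (A * Φ t) * B)) j) t := by
          simp only [Matrix.vecMul, dotProduct, Matrix.mul_apply (N := B),
            Matrix.mul_apply (M := C * A ^ k)]
          exact HasDerivAt.fun_sum fun i _ => HasDerivAt.const_mul _ <|
            HasDerivAt.fun_sum fun l _ => HasDerivAt.mul_const
              (HasDerivAt.fun_sum fun q _ => (hderiv t q l).const_mul _) _
        have h0 : HasDerivWithinAt (fun s => (g ᵥ* (C * A ^ k * Φ s * B)) j) 0 (Set.Icc 0 1) t :=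
          (hasDerivWithinAt_const t _ (0:ℝ)).congr (fun s hs => by rw [ih s hs]; rfl)
            (by rw [ih t ht]; rfl)
        have := (uniqueDiffOn_Icc zero_lt_one t ht).eq_deriv _ hd.hasDerivWithinAt h0
        simpa only [pow_succ, Matrix.mul_assoc, Pi.zero_apply] using this
    intro k
    simpa [hzero] using h3 k 0 (by simp)
  have hGu : IsUnit G := Matrix.mulVec_injective_iff_isUnit.1
    ((injective_iff_map_eq_zero G.mulVecLin).2 hGinj)
  rintro y₀ y₁ x₀ -
  -- The free motion contributes `C Φ(1) x₀` to the final output; the input has to supply the rest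
  -- as `G g`.
  obtain ⟨g, hg⟩ := Matrix.mulVec_surjective_iff_isUnit.2 hGu (y₁ - C *ᵥ (Φ 1 *ᵥ x₀))
  set u : ℝ → Fin m → ℝ := fun s => (K s)ᵀ *ᵥ g with hu
  have huc : Continuous u := hKc.matrix_transpose.matrix_mulVec continuous_const
  -- Variation of constants: the trajectory is `Φ t *ᵥ z t`.
  set z : ℝ → Fin n → ℝ := fun t => x₀ + ∫ s in (0:ℝ)..t, Φ (-s) *ᵥ (B *ᵥ u s) with hz
  have hvc : Continuous fun s => Φ (-s) *ᵥ (B *ᵥ u s) :=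
    (hcont.comp continuous_neg).matrix_mulVec (continuous_const.matrix_mulVec huc)
  have hzd : ∀ t, HasDerivAt z (Φ (-t) *ᵥ (B *ᵥ u t)) t := fun t =>
    (intervalIntegral.integral_hasDerivAt_right (hvc.intervalIntegrable _ _)
      (hvc.stronglyMeasurableAtFilter _ _) hvc.continuousAt).const_add _
  have hxd : ∀ t, HasDerivAt (fun t => Φ t *ᵥ z t) (A *ᵥ (Φ t *ᵥ z t) + B *ᵥ u t) t := by
    intro t
    refine hasDerivAt_pi.2 fun i => ?_
    have h1 : HasDerivAt (fun t => ∑ j, Φ t i j * z t j)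
        (∑ j, ((A * Φ t) i j * z t j + Φ t i j * (Φ (-t) *ᵥ (B *ᵥ u t)) j)) t :=
      HasDerivAt.fun_sum fun j _ => (hderiv t i j).mul (hasDerivAt_pi.1 (hzd t) j)
    have h2 : (A *ᵥ (Φ t *ᵥ z t) + B *ᵥ u t) i =
        ∑ j, ((A * Φ t) i j * z t j + Φ t i j * (Φ (-t) *ᵥ (B *ᵥ u t)) j) := by
      rw [Finset.sum_add_distrib, Matrix.mulVec_mulVec]
      change ((A * Φ t) *ᵥ z t) i + (B *ᵥ u t) i =
        ((A * Φ t) *ᵥ z t) i + (Φ t *ᵥ (Φ (-t) *ᵥ (B *ᵥ u t))) i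
      rw [Matrix.mulVec_mulVec (B *ᵥ u t), ← hadd, add_neg_cancel, hzero, Matrix.one_mulVec]
    rw [h2]
    exact h1
  have hxc : Continuous fun t => Φ t *ᵥ z t :=
    continuous_iff_continuousAt.2 fun t => (hxd t).continuousAt
  refine ⟨1, zero_lt_one, u, fun t => Φ t *ᵥ z t,
    ⟨huc.intervalIntegrable _ _, hxc.continuousOn, fun t _ => ?_⟩, ?_⟩
  · have hc : Continuous fun s => A *ᵥ (Φ s *ᵥ z s) + B *ᵥ u s :=
      (continuous_const.matrix_mulVec hxc).add (continuous_const.matrix_mulVec huc)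
    rw [intervalIntegral.integral_eq_sub_of_hasDerivAt (fun s _ => hxd s)
      (hc.intervalIntegrable _ _)]
    simp [hzero, hz]
  · have h1 : C *ᵥ (Φ 1 *ᵥ ∫ s in (0:ℝ)..1, Φ (-s) *ᵥ (B *ᵥ u s)) = G *ᵥ g := by
      ext i
      rw [hGv, Matrix.mulVec_mulVec]
      have := ContinuousLinearMap.intervalIntegral_comp_comm
        (LinearMap.toContinuousLinearMap (LinearMap.proj i ∘ₗ (C * Φ 1).mulVecLin))
        (hvc.intervalIntegrable (μ := volume) 0 1)
      refine this.symm.trans (intervalIntegral.integral_congr (μ := volume) fun s _ => ?_)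
      simp only [LinearMap.coe_toContinuousLinearMap', LinearMap.comp_apply, LinearMap.proj_apply,
        Matrix.mulVecLin_apply, Matrix.mulVec_mulVec, hu, hK, sub_eq_add_neg, hadd,
        Matrix.mul_assoc]
    simp only [hz, Matrix.mulVec_add, h1, hg]
    abel

-- A covector `w` that annihilates `CA` and `CB` gives an output component `w · y` that no input can
-- change. Counting dimensions, such a `w ≠ 0` exists as soon as `m + rank CA < p`.
open Matrix in
theorem OutputControllable.le_add_rank {n m p : ℕ} {A : Matrix (Fin n) (Fin n) ℝ}
    {B : Matrix (Fin n) (Fin m) ℝ} {C : Matrix (Fin p) (Fin n) ℝ} (h : OutputControllable A B C) :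
    p ≤ m + (C * A).rank := by
  by_contra hlt
  push Not at hlt
  -- The first factor is the range and not the whole space, so that its dimension is the rank of
  -- `CA`.
  let L : (Fin p → ℝ) →ₗ[ℝ] LinearMap.range (C * A)ᵀ.mulVecLin × (Fin m → ℝ) :=
    (C * A)ᵀ.mulVecLin.rangeRestrict.prod (C * B)ᵀ.mulVecLin
  have hL : LinearMap.ker L ≠ ⊥ := by
    apply LinearMap.ker_ne_bot_of_finrank_lt
    rw [Module.finrank_prod, Module.finrank_fin_fun, Module.finrank_fin_fun]
    have : Module.finrank ℝ (LinearMap.range (C * A)ᵀ.mulVecLin) = (C * A).rank :=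
      Matrix.rank_transpose (C * A)
    omega
  obtain ⟨w, hw, hw0⟩ := (Submodule.ne_bot_iff _).1 hL
  have hw1 : w ᵥ* (C * A) = 0 := by
    rw [← Matrix.mulVec_transpose]
    exact congrArg (fun q => (q.1 : Fin n → ℝ)) (LinearMap.mem_ker.1 hw)
  have hw2 : w ᵥ* (C * B) = 0 := by
    rw [← Matrix.mulVec_transpose]
    exact congrArg (fun q => q.2) (LinearMap.mem_ker.1 hw)
  -- Steering the output from `0` to `w` itself forces `w · w = 0`.
  obtain ⟨T, hT, u, x, hx, hxT⟩ := h 0 w 0 (by simp)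
  apply hw0
  apply dotProduct_self_eq_zero.1
  have hw3 : w ⬝ᵥ w = w ⬝ᵥ (C *ᵥ x T) := by rw [hxT]
  rw [hw3, hx.state_eq T ⟨hT.le, le_rfl⟩, zero_add]
  have hi : IntervalIntegrable (fun s => A *ᵥ x s + B *ᵥ u s) volume 0 T := by
    refine IntervalIntegrable.add ?_ ?_
    · refine ContinuousOn.intervalIntegrable ?_
      rw [Set.uIcc_of_le hT.le]
      exact (LinearMap.toContinuousLinearMap A.mulVecLin).continuous.comp_continuousOn
        hx.state_continuous
    · have := hx.input_integrable
      rw [intervalIntegrable_iff] at this ⊢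
      exact (LinearMap.toContinuousLinearMap B.mulVecLin).integrable_comp this
  let ℓ : (Fin n → ℝ) →ₗ[ℝ] ℝ := (dotProductBilin ℝ ℝ w) ∘ₗ C.mulVecLin
  have := ContinuousLinearMap.intervalIntegral_comp_comm (LinearMap.toContinuousLinearMap ℓ) hi
  refine this.symm.trans ?_
  have h0 : ∀ s, ℓ (A *ᵥ x s + B *ᵥ u s) = 0 := by
    intro s
    change w ⬝ᵥ (C *ᵥ (A *ᵥ x s + B *ᵥ u s)) = 0
    rw [Matrix.mulVec_add, dotProduct_add, Matrix.mulVec_mulVec, Matrix.mulVec_mulVec,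
      Matrix.dotProduct_mulVec, Matrix.dotProduct_mulVec, hw1, hw2]
    simp
  simp [h0]

-- Without inputs the trajectory from the zero state satisfies `x = ∫ A x`. By Grönwall it stays at
-- zero, and the output `1` is not reached.
open Matrix in
theorem OutputControllable.pos_of_pos {n m p : ℕ} {A : Matrix (Fin n) (Fin n) ℝ}
    {B : Matrix (Fin n) (Fin m) ℝ} {C : Matrix (Fin p) (Fin n) ℝ} (h : OutputControllable A B C)
    (hp : 0 < p) : 0 < m := by
  rcases Nat.eq_zero_or_pos m with rfl | hm
  swap
  · exact hm
  obtain ⟨T, hT, u, x, hx, hxT⟩ := h 0 1 0 (by simp)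
  have hB : ∀ v : Fin 0 → ℝ, B *ᵥ v = 0 := fun v => by ext i; simp [Matrix.mulVec, dotProduct]
  let L : (Fin n → ℝ) →L[ℝ] (Fin n → ℝ) := LinearMap.toContinuousLinearMap A.mulVecLin
  -- The trajectory is only known to be continuous on `[0, T]`; its constant extension makes the
  -- integral differentiable everywhere.
  set y : ℝ → Fin n → ℝ := Set.IccExtend hT.le (Set.domRestrict _ x) with hy
  have hyc : Continuous y := hx.state_continuous.domRestrict.Icc_extend'
  have hyx : ∀ t ∈ Set.Icc 0 T, y t = x t := fun t ht => Set.IccExtend_of_mem _ _ ht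
  have hLy : Continuous fun s => L (y s) := L.continuous.comp hyc
  set F : ℝ → Fin n → ℝ := fun t => ∫ s in (0:ℝ)..t, L (y s) with hF
  have hFx : ∀ t ∈ Set.Icc 0 T, F t = x t := by
    intro t ht
    rw [hx.state_eq t ht, zero_add]
    refine intervalIntegral.integral_congr fun s hs => ?_
    rw [Set.uIcc_of_le ht.1] at hs
    simp only [hB, add_zero]
    rw [hyx s ⟨hs.1, hs.2.trans ht.2⟩]
    rfl
  have hFd : ∀ t, HasDerivAt F (L (y t)) t := fun t =>
    intervalIntegral.integral_hasDerivAt_right (hLy.intervalIntegrable _ _)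
      (hLy.stronglyMeasurableAtFilter _ _) hLy.continuousAt
  have := norm_le_gronwallBound_of_norm_deriv_right_le (f := F) (f' := fun t => L (y t)) (δ := 0)
    (K := ‖L‖) (ε := 0) (a := 0) (b := T)
    (fun t _ => (hFd t).continuousAt.continuousWithinAt) (fun t _ => (hFd t).hasDerivWithinAt)
    (by simp [hF]) (fun t ht => by
      have ht' : t ∈ Set.Icc 0 T := ⟨ht.1, ht.2.le⟩
      rw [hyx t ht', hFx t ht', add_zero]
      exact L.le_opNorm _) T ⟨hT.le, le_rfl⟩
  rw [gronwallBound_ε0_δ0, hFx T ⟨hT.le, le_rfl⟩, norm_le_zero_iff] at this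
  rw [this, Matrix.mulVec_zero] at hxT
  exact absurd (congrFun hxT ⟨0, hp⟩) (by simp)

/-! ## A realization whose nonzero modes are controllable -/

/-- A left vector of the weighted permutation matrix of `σ` (all weights are `ν`), which is
a resolvent vector or an eigenvector for `μ`, see `cycleVec_sub`. -/
noncomputable def cycleVec {n : ℕ} (σ : Equiv.Perm (Fin n)) (l : ℕ) (ν : ℝ) (μ : ℂ) (t s : Fin n) :
    ℂ :=
  ∑ d ∈ Finset.range l, μ ^ (l - 1 - d) * (ν : ℂ) ^ d * if σ^[d] s = t then 1 else 0

/-- The two sums telescope, and since `σ^[l]` fixes `t`, both boundary terms live at `s = t`. If `μ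
^ l = ν ^ l` this is the equation of a left eigenvector; otherwise it is the equation of a multiple
of a row of the resolvent. -/
theorem cycleVec_sub {n : ℕ} (σ : Equiv.Perm (Fin n)) (l : ℕ) (ν : ℝ) (μ : ℂ) (t s : Fin n)
    (ht : σ^[l] t = t) :
    μ * cycleVec σ l ν μ t s - ν * cycleVec σ l ν μ t (σ s) =
      (μ ^ l - (ν : ℂ) ^ l) * if s = t then 1 else 0 := by
  set F : ℕ → ℂ := fun d => μ ^ (l - d) * (ν : ℂ) ^ d * if σ^[d] s = t then 1 else 0 with hF
  have h1 : μ * cycleVec σ l ν μ t s - ν * cycleVec σ l ν μ t (σ s) = F 0 - F l := by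
    rw [← Finset.sum_range_sub', cycleVec, cycleVec, Finset.mul_sum, Finset.mul_sum,
      ← Finset.sum_sub_distrib]
    refine Finset.sum_congr rfl fun d hd => ?_
    have hd' := Finset.mem_range.1 hd
    have e1 : l - d = l - 1 - d + 1 := by omega
    have e2 : l - (d + 1) = l - 1 - d := by omega
    have e3 : (if σ^[d + 1] s = t then (1 : ℂ) else 0) = if σ^[d] (σ s) = t then 1 else 0 :=
      if_congr (by rw [Function.iterate_succ_apply]) rfl rfl
    simp only [hF, e1, e2, e3]
    generalize (if σ^[d] s = t then (1 : ℂ) else 0) = x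
    generalize (if σ^[d] (σ s) = t then (1 : ℂ) else 0) = y
    ring
  have h2 : σ^[l] s = t ↔ s = t := by
    conv_lhs => rw [← ht]
    exact (σ.injective.iterate l).eq_iff
  rw [h1]
  simp only [hF, h2]
  by_cases hst : s = t <;> simp [hst]

theorem cycleVec_eq_zero {n : ℕ} (σ : Equiv.Perm (Fin n)) (l : ℕ) (ν : ℝ) (μ : ℂ) (t s : Fin n)
    (h : ∀ d < l, σ^[d] s ≠ t) : cycleVec σ l ν μ t s = 0 :=
  Finset.sum_eq_zero fun d hd => by rw [if_neg (h d (Finset.mem_range.1 hd)), mul_zero]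

/-- Within one period the orbit of `i` meets `σ^[d] i` only once, so a single term of the sum
survives. For `ν = 0` it survives through `0 ^ 0 = 1`, whence the condition `d = 0`. -/
theorem cycleVec_ne_zero {n : ℕ} (σ : Equiv.Perm (Fin n)) (i : Fin n) {d : ℕ} (ν : ℝ) {μ : ℂ}
    (hd : d < Function.minimalPeriod σ i) (hμ : μ ≠ 0) (hν : ν = 0 → d = 0) :
    cycleVec σ (Function.minimalPeriod σ i) ν μ (σ^[d] i) i ≠ 0 := by
  rw [cycleVec, Finset.sum_eq_single_of_mem d (Finset.mem_range.2 hd)]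
  · rw [if_pos rfl, mul_one]
    refine mul_ne_zero (pow_ne_zero _ hμ) ?_
    by_cases h : ν = 0
    · simp [hν h]
    · exact pow_ne_zero _ (by exact_mod_cast h)
  · intro d' hd' hne
    rw [if_neg, mul_zero]
    intro heq
    exact hne (Function.iterate_injOn_Iio_minimalPeriod (Finset.mem_range.1 hd') hd heq)

/-- There is a realization, supported on `Q`, of the matrices with the free entries `E` and of the
vectors supported on `S`, such that all the nonzero modes are controllable, with `#(I ∩ Q)`
distinct nonzero modes. -/
def ControllableOn {n : ℕ} (E : Fin n → Fin n → Prop) (S I Q : Finset (Fin n)) : Prop :=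
  ∃ (M : Matrix (Fin n) (Fin n) ℝ) (b : Fin n → ℝ) (Λ : Finset ℂ),
    (∀ i j, M i j ≠ 0 → E i j ∧ i ∈ Q ∧ j ∈ Q) ∧ (∀ i, b i ≠ 0 → i ∈ S ∧ i ∈ Q) ∧
    0 ∉ Λ ∧ Λ.card = (I ∩ Q).card ∧
    (∀ μ ∈ Λ, ∃ w : Fin n → ℂ, (∀ i ∉ Q, w i = 0) ∧
      (∀ j, μ * w j - ∑ i, w i * (M i j : ℂ) = 0) ∧ ∑ i, w i * (b i : ℂ) ≠ 0) ∧
    ∃ ρ : ℝ, 0 ≤ ρ ∧ ∀ μ : ℂ, ρ < ‖μ‖ → ∀ k ∈ Q, ∃ w : Fin n → ℂ, (∀ i ∉ Q, w i = 0) ∧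
      (∀ j, μ * w j - ∑ i, w i * (M i j : ℂ) = if j = k then 1 else 0) ∧
      ∑ i, w i * (b i : ℂ) ≠ 0

-- The cycle `c` of `i` is attached to `Q` with a coupling that only feeds from `Q` into `c`. The
-- matrix stays block triangular, so left vectors supported on `Q` keep their equations. A left
-- vector of the cycle has to be corrected on `Q`, and its product with `b` becomes its value at `i`
-- times the transfer function that drives `i`. The last clause of `ControllableOn` says that these
-- transfer functions have no zeros outside the radius `ρ`, which is why the new modes are placed
-- there.
set_option maxHeartbeats 1000000 in
theorem ControllableOn.extend {n : ℕ} {E : Fin n → Fin n → Prop} {S I Q : Finset (Fin n)}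
    (hQ : ControllableOn E S I Q) (σ : Equiv.Perm (Fin n)) (hI : ∀ i ∈ I, E (σ i) i)
    (hσ : ∀ i ∉ I, σ i = i) (hQσ : ∀ i, σ i ∈ Q ↔ i ∈ Q) {i : Fin n} (hi : i ∉ Q)
    (hiS : i ∈ S ∨ ∃ j ∈ Q, E i j) :
    ∃ Q', Q ⊆ Q' ∧ i ∈ Q' ∧ (∀ j, σ j ∈ Q' ↔ j ∈ Q') ∧ ControllableOn E S I Q' := by
  obtain ⟨M, b, Λ, hM, hb, h0, hcard, hΛ, ρ, hρ0, hρ⟩ := hQ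
  -- `h` is the coupling row from `Q` into `i`, and `g` is the direct input into `i`. One of them is
  -- zero, and `∑ w b + g` is the transfer function that drives `i`.
  obtain ⟨h, g, hh, hg, hw0⟩ : ∃ (h : Fin n → ℝ) (g : ℝ), (∀ j, h j ≠ 0 → E i j ∧ j ∈ Q) ∧
      (g ≠ 0 → i ∈ S) ∧ ∀ μ : ℂ, ρ < ‖μ‖ → ∃ w : Fin n → ℂ, (∀ i ∉ Q, w i = 0) ∧
      (∀ j, μ * w j - ∑ i, w i * (M i j : ℂ) = h j) ∧ ∑ i, w i * (b i : ℂ) + g ≠ 0 := by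
    rcases hiS with hiS | ⟨j, hj, hij⟩
    · exact ⟨0, 1, by simp, fun _ => hiS, fun μ _ => ⟨0, by simp, by simp, by simp⟩⟩
    · refine ⟨fun j' => if j' = j then 1 else 0, 0, ?_, by simp, fun μ hμ => ?_⟩
      · intro j' hj'
        have : j' = j := by
          by_contra hne
          simp [hne] at hj'
        exact this ▸ ⟨hij, hj⟩
      · obtain ⟨w, hw1, hw2, hw3⟩ := hρ μ hμ j hj
        exact ⟨w, hw1, fun j' => by rw [hw2]; by_cases hjj : j' = j <;> simp [hjj], by simpa using hw3⟩
  set l := Function.minimalPeriod σ i with hl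
  have hper : σ^[l] i = i := Function.iterate_minimalPeriod
  have hlpos : 0 < l := Function.minimalPeriod_pos_of_mem_periodicPts
    (σ.injective.mem_periodicPts i)
  set c : Finset (Fin n) := (Finset.range l).image fun d => σ^[d] i with hc
  have hmem : ∀ d, σ^[d] i ∈ c := by
    intro d
    refine Finset.mem_image.2 ⟨d % l, Finset.mem_range.2 (Nat.mod_lt _ hlpos), ?_⟩
    exact Function.iterate_mod_minimalPeriod_eq
  have hic : i ∈ c := hmem 0
  have hcσ : ∀ j, σ j ∈ c ↔ j ∈ c := by
    intro j
    constructor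
    · intro hj
      obtain ⟨d, hd, hdj⟩ := Finset.mem_image.1 hj
      have : j = σ^[d + (l - 1)] i := by
        apply σ.injective
        rw [← Function.iterate_succ_apply' σ, show (d + (l - 1)).succ = d + l by omega,
          Function.iterate_add_apply, hper, hdj]
      rw [this]
      exact hmem _
    · intro hj
      obtain ⟨d, hd, rfl⟩ := Finset.mem_image.1 hj
      rw [← Function.iterate_succ_apply' σ]
      exact hmem _
  have hiter : ∀ d j, σ^[d] j ∈ c ↔ j ∈ c := by
    intro d
    induction d with
    | zero => simp
    | succ d ih => intro j; rw [Function.iterate_succ_apply', hcσ, ih]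
  have hiterQ : ∀ d j, σ^[d] j ∈ Q ↔ j ∈ Q := by
    intro d
    induction d with
    | zero => simp
    | succ d ih => intro j; rw [Function.iterate_succ_apply', hQσ, ih]
  have hcQ : ∀ j ∈ c, j ∉ Q := by
    intro j hj
    obtain ⟨d, hd, rfl⟩ := Finset.mem_image.1 hj
    rwa [hiterQ]
  have hperc : ∀ j ∈ c, σ^[l] j = j := by
    intro j hj
    obtain ⟨d, hd, rfl⟩ := Finset.mem_image.1 hj
    rw [← Function.iterate_add_apply, add_comm, Function.iterate_add_apply, hper]
  have hcard_c : c.card = l := by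
    rw [hc, Finset.card_image_of_injOn, Finset.card_range]
    intro d hd d' hd' heq
    exact Function.iterate_injOn_Iio_minimalPeriod (Finset.mem_range.1 (Finset.mem_coe.1 hd))
      (Finset.mem_range.1 (Finset.mem_coe.1 hd')) heq
  have hσI : ∀ j, j ∈ I → σ j ∈ I := by
    intro j hj
    by_contra hne
    have := σ.injective (hσ _ hne)
    rw [this] at hne
    exact hne hj
  -- The new modes have modulus `ν`. Beyond `ρ` the drive of `i` does not vanish, and beyond all
  -- `‖μ‖`, `μ ∈ Λ`, they are different from the old modes. Outside `I` the index `i` is a fixed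
  -- point of `σ` and gets no loop.
  obtain ⟨ν, hν0, hνI, hνc⟩ : ∃ ν : ℝ, 0 ≤ ν ∧
      (i ∈ I → 0 < ν ∧ ρ < ν ∧ ∀ μ ∈ Λ, ‖μ‖ < ν) ∧ (i ∉ I → ν = 0) := by
    by_cases hiI : i ∈ I
    · refine ⟨ρ + 1 + ∑ μ ∈ Λ, ‖μ‖, by positivity, fun _ => ⟨by positivity, ?_, fun μ hμ => ?_⟩,
        fun h => absurd hiI h⟩
      · have : 0 ≤ ∑ μ ∈ Λ, ‖μ‖ := Finset.sum_nonneg fun _ _ => norm_nonneg _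
        linarith
      · have := Finset.single_le_sum (f := fun μ : ℂ => ‖μ‖) (fun _ _ => norm_nonneg _) hμ
        linarith
    · exact ⟨0, le_rfl, fun h => absurd h hiI, fun _ => rfl⟩
  have hl1 : i ∉ I → l = 1 := fun hiI =>
    Function.minimalPeriod_eq_one_iff_isFixedPt.2 (hσ i hiI)
  set M' : Matrix (Fin n) (Fin n) ℝ := Matrix.of fun a j =>
    M a j + (if a = σ j ∧ j ∈ c then ν else 0) + (if a = i then h j else 0) with hM'
  set b' : Fin n → ℝ := fun a => b a + if a = i then g else 0 with hb'
  have hMzero : ∀ a j, a ∉ Q → M a j = 0 := fun a j ha => by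
    by_contra hne
    exact ha (hM a j hne).2.1
  have hbzero : ∀ a, a ∉ Q → b a = 0 := fun a ha => by
    by_contra hne
    exact ha (hb a hne).2
  -- the action of `M'` on left vectors
  have hsumM : ∀ (w : Fin n → ℂ) j, ∑ a, w a * (M' a j : ℂ) =
      ∑ a, w a * (M a j : ℂ) + (if j ∈ c then w (σ j) * (ν : ℂ) else 0) + w i * (h j : ℂ) := by
    intro w j
    have e1 : ∀ a, w a * (M' a j : ℂ) = w a * (M a j : ℂ) +
        (if a = σ j then (if j ∈ c then w a * (ν : ℂ) else 0) else 0) +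
        (if a = i then w a * (h j : ℂ) else 0) := by
      intro a
      rw [hM', Matrix.of_apply, Complex.ofReal_add, Complex.ofReal_add, mul_add, mul_add,
        apply_ite Complex.ofReal, apply_ite Complex.ofReal, mul_ite, mul_ite, Complex.ofReal_zero,
        mul_zero, ite_and]
    simp only [e1, Finset.sum_add_distrib, Finset.sum_ite_eq', Finset.mem_univ, if_true]
  have hsumb : ∀ (w : Fin n → ℂ), ∑ a, w a * (b' a : ℂ) =
      ∑ a, w a * (b a : ℂ) + w i * (g : ℂ) := by
    intro w
    have e1 : ∀ a, w a * (b' a : ℂ) = w a * (b a : ℂ) + (if a = i then w a * (g : ℂ) else 0) := by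
      intro a
      rw [hb', Complex.ofReal_add, mul_add, apply_ite Complex.ofReal, mul_ite, Complex.ofReal_zero,
        mul_zero]
    simp only [e1, Finset.sum_add_distrib, Finset.sum_ite_eq', Finset.mem_univ, if_true]
  have holdM : ∀ (w : Fin n → ℂ), (∀ a ∉ Q, w a = 0) → ∀ j,
      ∑ a, w a * (M' a j : ℂ) = ∑ a, w a * (M a j : ℂ) := by
    intro w hw j
    rw [hsumM, hw i hi]
    by_cases hj : j ∈ c
    · rw [hw (σ j) (hcQ _ ((hcσ j).2 hj))]
      simp
    · simp [hj]
  have holdb : ∀ (w : Fin n → ℂ), (∀ a ∉ Q, w a = 0) →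
      ∑ a, w a * (b' a : ℂ) = ∑ a, w a * (b a : ℂ) := by
    intro w hw
    rw [hsumb, hw i hi]
    simp
  -- the new left vectors
  have hnew : ∀ μ : ℂ, ρ < ‖μ‖ → ∀ t ∈ c, ∃ w : Fin n → ℂ, (∀ a ∉ Q ∪ c, w a = 0) ∧
      (∀ j, μ * w j - ∑ a, w a * (M' a j : ℂ) =
        (μ ^ l - (ν : ℂ) ^ l) * if j = t then 1 else 0) ∧ ∑ a, w a * (b' a : ℂ) ≠ 0 := by
    intro μ hμ t ht
    obtain ⟨w0, hw1, hw2, hw3⟩ := hw0 μ hμ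
    have hμ0 : μ ≠ 0 := by
      rintro rfl
      rw [norm_zero] at hμ
      linarith
    set v := cycleVec σ l ν μ t with hv
    have hvc : ∀ a ∉ c, v a = 0 := fun a ha => cycleVec_eq_zero _ _ _ _ _ _ fun d _ hd =>
      ha ((hiter d a).1 (hd ▸ ht))
    have hvQ : ∀ a ∈ Q, v a = 0 := fun a ha => hvc a fun hac => hcQ a hac ha
    have hvi : v i ≠ 0 := by
      obtain ⟨d, hd, rfl⟩ := Finset.mem_image.1 ht
      refine cycleVec_ne_zero σ i ν (Finset.mem_range.1 hd) hμ0 fun hν => ?_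
      have hiI : i ∉ I := fun hiI => (hνI hiI).1.ne' hν
      have := Finset.mem_range.1 hd
      have := hl1 hiI
      omega
    -- The cycle vector, corrected on `Q` by the response to the row that couples `i` to `Q`.
    refine ⟨fun a => v a + v i * w0 a, fun a ha => ?_, fun j => ?_, ?_⟩
    · rw [Finset.mem_union, not_or] at ha
      simp [hvc a ha.2, hw1 a ha.1]
    · rw [hsumM, hw1 i hi]
      have e1 : ∑ a, (v a + v i * w0 a) * (M a j : ℂ) = v i * ∑ a, w0 a * (M a j : ℂ) := by
        rw [Finset.mul_sum]
        refine Finset.sum_congr rfl fun a _ => ?_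
        by_cases ha : a ∈ Q
        · rw [hvQ a ha]; ring
        · simp [hMzero a j ha]
      have e2 : (if j ∈ c then (v (σ j) + v i * w0 (σ j)) * (ν : ℂ) else 0) = ν * v (σ j) := by
        by_cases hj : j ∈ c
        · rw [if_pos hj, hw1 (σ j) (hcQ _ ((hcσ j).2 hj))]; ring
        · rw [if_neg hj, hvc (σ j) (fun hh => hj ((hcσ j).1 hh)), mul_zero]
      rw [e1, e2, ← cycleVec_sub σ l ν μ t j (hperc t ht)]
      linear_combination v i * hw2 j
    · rw [hsumb, hw1 i hi]
      have e1 : ∑ a, (v a + v i * w0 a) * (b a : ℂ) = v i * ∑ a, w0 a * (b a : ℂ) := by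
        rw [Finset.mul_sum]
        refine Finset.sum_congr rfl fun a _ => ?_
        by_cases ha : a ∈ Q
        · rw [hvQ a ha]; ring
        · simp [hbzero a ha]
      rw [e1]
      have : v i * ∑ a, w0 a * (b a : ℂ) + (v i + v i * 0) * (g : ℂ) =
          v i * (∑ a, w0 a * (b a : ℂ) + g) := by ring
      rw [this]
      exact mul_ne_zero hvi hw3
  have hM'E : ∀ a j, M' a j ≠ 0 → E a j ∧ a ∈ Q ∪ c ∧ j ∈ Q ∪ c := by
    intro a j haj
    simp only [Finset.mem_union]
    by_cases h1 : M a j ≠ 0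
    · have := hM a j h1
      exact ⟨this.1, Or.inl this.2.1, Or.inl this.2.2⟩
    by_cases h2 : a = σ j ∧ j ∈ c ∧ ν ≠ 0
    · obtain ⟨rfl, hj, hν⟩ := h2
      have hiI : i ∈ I := by
        by_contra hne
        exact hν (hνc hne)
      have hjI : j ∈ I := by
        obtain ⟨d, hd, rfl⟩ := Finset.mem_image.1 hj
        clear hd hj haj h1
        induction d with
        | zero => exact hiI
        | succ d ih => rw [Function.iterate_succ_apply']; exact hσI _ ih
      exact ⟨hI j hjI, Or.inr ((hcσ j).2 hj), Or.inr hj⟩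
    by_cases h3 : a = i ∧ h j ≠ 0
    · obtain ⟨rfl, hj⟩ := h3
      exact ⟨(hh j hj).1, Or.inr hic, Or.inl (hh j hj).2⟩
    exfalso
    apply haj
    simp only [hM', Matrix.of_apply]
    push Not at h1 h2 h3
    rw [h1]
    have e1 : (if a = σ j ∧ j ∈ c then ν else 0) = 0 := by
      split_ifs with hx
      · exact h2 hx.1 hx.2
      · rfl
    have e2 : (if a = i then h j else 0) = 0 := by
      split_ifs with hx
      · exact h3 hx
      · rfl
    rw [e1, e2]
    simp
  have hb'S : ∀ a, b' a ≠ 0 → a ∈ S ∧ a ∈ Q ∪ c := by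
    intro a ha
    rw [Finset.mem_union]
    by_cases h1 : b a ≠ 0
    · exact ⟨(hb a h1).1, Or.inl (hb a h1).2⟩
    push Not at h1
    simp only [hb', h1, zero_add] at ha
    by_cases h2 : a = i
    · subst h2
      exact ⟨hg (by simpa using ha), Or.inr hic⟩
    · simp [h2] at ha
  have hunion : ∀ w : Fin n → ℂ, (∀ a ∉ Q, w a = 0) → ∀ a ∉ Q ∪ c, w a = 0 := fun w hw a ha =>
    hw a fun hh => ha (Finset.mem_union_left _ hh)
  have hdisj : Disjoint (I ∩ Q) (I ∩ c) := Finset.disjoint_left.2 fun a ha ha' =>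
    hcQ a (Finset.mem_inter.1 ha').2 (Finset.mem_inter.1 ha).2
  -- A cycle of length `l` in `I` adds the `l` modes `ν ζ` with `ζ ^ l = 1`. The radius grows to
  -- `max ρ ν`, beyond which `μ ^ l ≠ ν ^ l`.
  refine ⟨Q ∪ c, Finset.subset_union_left, Finset.mem_union_right _ hic, fun j => by
    simp [Finset.mem_union, hQσ, hcσ], M', b',
    Λ ∪ (if i ∈ I then (Polynomial.nthRootsFinset l (1 : ℂ)).image (fun ζ => (ν : ℂ) * ζ) else ∅),
    hM'E, hb'S, ?_, ?_, ?_, max ρ ν, le_max_of_le_left hρ0, ?_⟩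
  · rw [Finset.mem_union, not_or]
    refine ⟨h0, fun hmem0 => ?_⟩
    split_ifs at hmem0 with hiI
    · obtain ⟨ζ, hζ, hζ0⟩ := Finset.mem_image.1 hmem0
      rw [Polynomial.mem_nthRootsFinset hlpos] at hζ
      rcases mul_eq_zero.1 hζ0 with h1 | h1
      · exact (hνI hiI).1.ne' (by exact_mod_cast h1)
      · rw [h1, zero_pow hlpos.ne'] at hζ
        exact zero_ne_one hζ
    · simp at hmem0
  · rw [Finset.inter_union_distrib_left, Finset.card_union_of_disjoint hdisj]
    by_cases hiI : i ∈ I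
    · have hcI : I ∩ c = c := by
        refine Finset.inter_eq_right.2 fun j hj => ?_
        obtain ⟨d, hd, rfl⟩ := Finset.mem_image.1 hj
        clear hd hj
        induction d with
        | zero => exact hiI
        | succ d ih => rw [Function.iterate_succ_apply']; exact hσI _ ih
      rw [if_pos hiI, hcI, hcard_c, Finset.card_union_of_disjoint, hcard, Finset.card_image_of_injective,
        (Complex.isPrimitiveRoot_exp l hlpos.ne').card_nthRootsFinset]
      · intro x y hxy
        exact mul_left_cancel₀ (by exact_mod_cast (hνI hiI).1.ne') hxy
      · refine Finset.disjoint_left.2 fun μ hμ hμ' => ?_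
        obtain ⟨ζ, hζ, rfl⟩ := Finset.mem_image.1 hμ'
        rw [Polynomial.mem_nthRootsFinset hlpos] at hζ
        have h1 := (hνI hiI).2.2 _ hμ
        rw [norm_mul, Complex.norm_eq_one_of_pow_eq_one hζ hlpos.ne', mul_one,
          Complex.norm_real, Real.norm_of_nonneg hν0] at h1
        exact lt_irrefl _ h1
    · have hcI : I ∩ c = ∅ := by
        refine Finset.eq_empty_of_forall_notMem fun j hj => ?_
        obtain ⟨hjI, hjc⟩ := Finset.mem_inter.1 hj
        obtain ⟨d, hd, rfl⟩ := Finset.mem_image.1 hjc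
        have h1 := Finset.mem_range.1 hd
        have h2 := hl1 hiI
        have : d = 0 := by omega
        subst this
        exact hiI hjI
      rw [if_neg hiI, hcI]
      simpa using hcard
  · intro μ hμ
    rcases Finset.mem_union.1 hμ with hμ | hμ
    · obtain ⟨w, h1, h2, h3⟩ := hΛ μ hμ
      exact ⟨w, hunion w h1, fun j => by rw [holdM w h1]; exact h2 j, by rwa [holdb w h1]⟩
    · split_ifs at hμ with hiI
      · obtain ⟨ζ, hζ, rfl⟩ := Finset.mem_image.1 hμ
        rw [Polynomial.mem_nthRootsFinset hlpos] at hζ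
        have hn : ρ < ‖(ν : ℂ) * ζ‖ := by
          rw [norm_mul, Complex.norm_eq_one_of_pow_eq_one hζ hlpos.ne', mul_one,
            Complex.norm_real, Real.norm_of_nonneg hν0]
          exact (hνI hiI).2.1
        obtain ⟨w, h1, h2, h3⟩ := hnew _ hn i hic
        refine ⟨w, h1, fun j => ?_, h3⟩
        rw [h2, mul_pow, hζ, mul_one, sub_self, zero_mul]
      · simp at hμ
  · intro μ hμ k hk
    have hμρ : ρ < ‖μ‖ := (le_max_left _ _).trans_lt hμ
    have hμν : ν < ‖μ‖ := (le_max_right _ _).trans_lt hμ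
    rcases Finset.mem_union.1 hk with hk | hk
    · obtain ⟨w, h1, h2, h3⟩ := hρ μ hμρ k hk
      exact ⟨w, hunion w h1, fun j => by rw [holdM w h1]; exact h2 j, by rwa [holdb w h1]⟩
    · obtain ⟨w, h1, h2, h3⟩ := hnew μ hμρ k hk
      have hne : μ ^ l - (ν : ℂ) ^ l ≠ 0 := by
        intro heq
        have h4 : ‖μ‖ ^ l = ν ^ l := by
          rw [← norm_pow, sub_eq_zero.1 heq, norm_pow, Complex.norm_real, Real.norm_of_nonneg hν0]
        exact (pow_lt_pow_left₀ hμν hν0 hlpos.ne').ne' h4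
      refine ⟨fun a => (μ ^ l - (ν : ℂ) ^ l)⁻¹ * w a, fun a ha => by simp [h1 a ha], fun j => ?_, ?_⟩
      · have h5 := h2 j
        simp only [mul_assoc, ← Finset.mul_sum]
        rw [show μ * ((μ ^ l - (ν : ℂ) ^ l)⁻¹ * w j) - (μ ^ l - (ν : ℂ) ^ l)⁻¹ *
          ∑ a, w a * (M' a j : ℂ) = (μ ^ l - (ν : ℂ) ^ l)⁻¹ *
          (μ * w j - ∑ a, w a * (M' a j : ℂ)) by ring, h5, ← mul_assoc, inv_mul_cancel₀ hne, one_mul]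
      · simp only [mul_assoc, ← Finset.mul_sum]
        exact mul_ne_zero (inv_ne_zero hne) h3

/-- While some state of `I` is missing from `Q`, a path to it from `S` contains a state outside `Q`
that lies in `S` or is fed by a state of `Q`. The cycle of this state is attached next. -/
theorem exists_controllableOn {n : ℕ} (E : Fin n → Fin n → Prop) (S I : Finset (Fin n))
    (σ : Equiv.Perm (Fin n)) (hI : ∀ i ∈ I, E (σ i) i) (hσ : ∀ i ∉ I, σ i = i)
    (hreach : ∀ i ∈ I, ∃ s ∈ S, Relation.ReflTransGen (fun a b => E b a) s i) :
    ∃ Q, I ⊆ Q ∧ ControllableOn E S I Q := by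
  have key : ∀ k, ∀ Q : Finset (Fin n), n - Q.card = k → (∀ i, σ i ∈ Q ↔ i ∈ Q) →
      ControllableOn E S I Q → ∃ Q, I ⊆ Q ∧ ControllableOn E S I Q := by
    intro k
    induction k using Nat.strong_induction_on with
    | _ k ih =>
      intro Q hk hQσ hQ
      by_cases hIQ : I ⊆ Q
      · exact ⟨Q, hIQ, hQ⟩
      obtain ⟨i, hiI, hiQ⟩ := Finset.not_subset.1 hIQ
      obtain ⟨s, hs, hsi⟩ := hreach i hiI
      have hex : ∃ i', i' ∉ Q ∧ (i' ∈ S ∨ ∃ j ∈ Q, E i' j) := by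
        by_contra hno
        push Not at hno
        have hall : ∀ i', Relation.ReflTransGen (fun a b => E b a) s i' → i' ∈ Q := by
          intro i' h'
          induction h' with
          | refl =>
            by_contra hne
            exact (hno s hne).1 hs
          | tail _ hbc ih' =>
            by_contra hne
            exact (hno _ hne).2 _ ih' hbc
        exact hiQ (hall i hsi)
      obtain ⟨i', hi'Q, hi'⟩ := hex
      obtain ⟨Q', hsub, hmem, hQ'σ, hQ'⟩ := hQ.extend σ hI hσ hQσ hi'Q hi'
      have hlt : Q.card < Q'.card := Finset.card_lt_card
        ⟨hsub, fun hle => hi'Q (hle hmem)⟩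
      have hle : Q'.card ≤ n := by simpa using Finset.card_le_univ Q'
      exact ih (n - Q'.card) (by omega) Q' rfl hQ'σ hQ'
  refine key _ ∅ rfl (by simp) ⟨0, 0, ∅, ?_⟩
  refine ⟨by simp, by simp, by simp, by simp, by simp, 0, le_rfl, by simp⟩

/-- A realization whose Krylov vectors `M b, M² b, …, M^r b` are linearly independent, where `r` is
the number of states that are covered by disjoint cycles. -/
theorem exists_krylov_linearIndependent {n r : ℕ} (E : Fin n → Fin n → Prop) (S I : Finset (Fin n))
    (σ : Equiv.Perm (Fin n)) (hI : ∀ i ∈ I, E (σ i) i) (hσ : ∀ i ∉ I, σ i = i)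
    (hreach : ∀ i ∈ I, ∃ s ∈ S, Relation.ReflTransGen (fun a b => E b a) s i) (hr : I.card = r) :
    ∃ (M : Matrix (Fin n) (Fin n) ℝ) (b : Fin n → ℝ), (∀ i j, M i j ≠ 0 → E i j) ∧
      (∀ i, b i ≠ 0 → i ∈ S) ∧
      LinearIndependent ℝ fun k : Fin r => (M ^ (k.val + 1)).mulVec b := by
  obtain ⟨Q, hIQ, M, b, Λ, hM, hb, h0, hcard, hΛ, -⟩ := exists_controllableOn E S I σ hI hσ hreach
  rw [Finset.inter_eq_left.2 hIQ, hr] at hcard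
  refine ⟨M, b, fun i j h => (hM i j h).1, fun i h => (hb i h).1, ?_⟩
  rw [Fintype.linearIndependent_iff]
  intro q hq
  -- Pairing a relation `∑ q k • M^(k+1) b = 0` with a left eigenvector `w` for `μ` gives `μ * (w ·
  -- b) * f(μ) = 0`. So `f`, of degree less than `r`, vanishes on the `r` elements of `Λ`.
  set f : Polynomial ℂ := ∑ k : Fin r, Polynomial.C (q k : ℂ) * Polynomial.X ^ k.val with hf
  have hdeg : f.degree < r := by
    refine (Polynomial.degree_sum_fin_lt _)
  have hroot : ∀ μ ∈ Λ, f.eval μ = 0 := by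
    intro μ hμ
    obtain ⟨w, -, hw2, hw3⟩ := hΛ μ hμ
    have hstep : ∀ y : Fin n → ℝ,
        ∑ i, w i * ((M.mulVec y i : ℝ) : ℂ) = μ * ∑ i, w i * (y i : ℂ) := by
      intro y
      have e1 : ∀ i, w i * ((M.mulVec y i : ℝ) : ℂ) = ∑ j, w i * (M i j : ℂ) * (y j : ℂ) := by
        intro i
        simp only [Matrix.mulVec, dotProduct, Complex.ofReal_sum, Complex.ofReal_mul,
          Finset.mul_sum, mul_assoc]
      rw [Finset.sum_congr rfl fun i _ => e1 i, Finset.sum_comm, Finset.mul_sum]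
      refine Finset.sum_congr rfl fun j _ => ?_
      rw [← Finset.sum_mul, ← sub_eq_zero.1 (hw2 j), mul_assoc]
    have hpow : ∀ k, ∑ i, w i * (((M ^ k).mulVec b i : ℝ) : ℂ) = μ ^ k * ∑ i, w i * (b i : ℂ) := by
      intro k
      induction k with
      | zero => simp
      | succ k ih => rw [pow_succ', pow_succ', ← Matrix.mulVec_mulVec, hstep, ih, mul_assoc]
    have h1 : ∑ k : Fin r, (q k : ℂ) * ∑ i, w i * (((M ^ (k.val + 1)).mulVec b i : ℝ) : ℂ) = 0 := by
      simp only [Finset.mul_sum]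
      rw [Finset.sum_comm]
      refine Finset.sum_eq_zero fun i _ => ?_
      have h2 := congrFun hq i
      rw [Finset.sum_apply] at h2
      have h3 : ∑ k : Fin r, (q k : ℂ) * (((M ^ (k.val + 1)).mulVec b i : ℝ) : ℂ) = 0 := by
        exact_mod_cast h2
      calc _ = w i * ∑ k : Fin r, (q k : ℂ) * (((M ^ (k.val + 1)).mulVec b i : ℝ) : ℂ) := by
            rw [Finset.mul_sum]
            exact Finset.sum_congr rfl fun k _ => by ring
        _ = 0 := by rw [h3, mul_zero]
    simp only [hpow] at h1
    have h2 : μ * (∑ i, w i * (b i : ℂ)) * f.eval μ = 0 := by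
      rw [← h1, hf, Polynomial.eval_finsetSum, Finset.mul_sum]
      refine Finset.sum_congr rfl fun k _ => ?_
      simp only [Polynomial.eval_mul, Polynomial.eval_C, Polynomial.eval_pow, Polynomial.eval_X]
      ring
    rcases mul_eq_zero.1 h2 with h3 | h3
    · rcases mul_eq_zero.1 h3 with h4 | h4
      · exact absurd (h4 ▸ hμ) h0
      · exact absurd h4 hw3
    · exact h3
  have hf0 : f = 0 := Polynomial.eq_zero_of_degree_lt_of_eval_finset_eq_zero Λ
    (hcard ▸ hdeg) hroot
  intro k
  have h1 : f.coeff k.val = (q k : ℂ) := by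
    rw [hf, Polynomial.finsetSum_coeff, Finset.sum_eq_single k]
    · simp
    · intro j _ hj
      rw [Polynomial.coeff_C_mul, Polynomial.coeff_X_pow, if_neg (fun h => hj (Fin.ext h.symm)),
        mul_zero]
    · simp
  rw [hf0, Polynomial.coeff_zero] at h1
  exact_mod_cast h1.symm

/-! ## Flows in the network and linkings -/

section flow

variable {n p : ℕ} {A : StructMatrix n n} {C : StructMatrix p n}

theorem sum_layerVertex (f : LayerVertex n n p → ℝ) :
    ∑ v, f v = ∑ i, f (.u i) + ∑ i, f (.x2 i) + ∑ i, f (.x1 i) + ∑ i, f (.y i) := by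
  let e : ((Fin n ⊕ Fin n) ⊕ Fin n) ⊕ Fin p ≃ LayerVertex n n p :=
    { toFun := fun x => match x with
        | .inl (.inl (.inl i)) => .u i
        | .inl (.inl (.inr i)) => .x2 i
        | .inl (.inr i) => .x1 i
        | .inr i => .y i
      invFun := fun x => match x with
        | .u i => .inl (.inl (.inl i))
        | .x2 i => .inl (.inl (.inr i))
        | .x1 i => .inl (.inr i)
        | .y i => .inr i
      left_inv := by rintro (((i | i) | i) | i) <;> rfl
      right_inv := by rintro (i | i | i | i) <;> rfl }
  rw [← e.sum_comp, Fintype.sum_sum_type, Fintype.sum_sum_type, Fintype.sum_sum_type]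
  rfl

theorem sum_netVertex (f : NetVertex n p → ℝ) :
    ∑ v, f v = f .source + f .sink + ∑ v, f (.inn v) + ∑ v, f (.out v) := by
  let e : ((Unit ⊕ Unit) ⊕ LayerVertex n n p) ⊕ LayerVertex n n p ≃ NetVertex n p :=
    { toFun := fun x => match x with
        | .inl (.inl (.inl _)) => .source
        | .inl (.inl (.inr _)) => .sink
        | .inl (.inr i) => .inn i
        | .inr i => .out i
      invFun := fun x => match x with
        | .source => .inl (.inl (.inl ()))
        | .sink => .inl (.inl (.inr ()))
        | .inn i => .inl (.inr i)
        | .out i => .inr i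
      left_inv := by rintro (((i | i) | i) | i) <;> rfl
      right_inv := by rintro (i | i | i | i) <;> rfl }
  rw [← e.sum_comp, Fintype.sum_sum_type, Fintype.sum_sum_type, Fintype.sum_sum_type]
  simp [e]

theorem netEdge_source_iff {v : NetVertex n p} :
    NetEdge A C .source v ↔ (∃ i, v = .inn (.u i)) ∨ ∃ i, v = .inn (.x2 i) := by
  constructor
  · rintro (_ | _ | _ | _ | _)
    · exact Or.inl ⟨_, rfl⟩
    · exact Or.inr ⟨_, rfl⟩
  · rintro (⟨i, rfl⟩ | ⟨i, rfl⟩)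
    · exact .source_u i
    · exact .source_x2 i

theorem netEdge_inn_iff {v : LayerVertex n n p} {w : NetVertex n p} :
    NetEdge A C (.inn v) w ↔ w = .out v := by
  constructor
  · rintro (_ | _ | _ | _ | _)
    rfl
  · rintro rfl
    exact .split v

theorem netEdge_out_u_iff {i : Fin n} {w : NetVertex n p} :
    NetEdge A C (.out (.u i)) w ↔ w = .inn (.x1 i) := by
  constructor
  · rintro (_ | ⟨_, _, h⟩ | _ | _ | _)
    cases h with
    | ux1 _ j h =>
      have : j = i := by simpa [structId] using h
      rw [this]
  · rintro rfl
    exact .layer _ _ (.ux1 i i (by simp [structId]))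

theorem netEdge_out_x2_iff {i : Fin n} {w : NetVertex n p} :
    NetEdge A C (.out (.x2 i)) w ↔ ∃ j, w = .inn (.x1 j) ∧ A j i = true := by
  constructor
  · rintro (_ | ⟨_, _, h⟩ | _ | _ | _)
    cases h with
    | x2x1 _ j h => exact ⟨j, rfl, h⟩
  · rintro ⟨j, rfl, h⟩
    exact .layer _ _ (.x2x1 i j h)

theorem netEdge_out_x1_iff {i : Fin n} {w : NetVertex n p} :
    NetEdge A C (.out (.x1 i)) w ↔ ∃ j, w = .inn (.y j) ∧ C j i = true := by
  constructor
  · rintro (_ | ⟨_, _, h⟩ | _ | _ | _)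
    cases h with
    | x1y _ j h => exact ⟨j, rfl, h⟩
  · rintro ⟨j, rfl, h⟩
    exact .layer _ _ (.x1y i j h)

theorem not_netEdge_sink {w : NetVertex n p} : ¬ NetEdge A C .sink w := by
  rintro (_ | _ | _ | _ | _)

/-- The flow out of the source into the vertices `xᵢ²`. -/
def stateValue (f : NetVertex n p → NetVertex n p → ℝ) : ℝ := ∑ i, f .source (.inn (.x2 i))

theorem FlowNetwork.IsFlow.eq_zero {f : NetVertex n p → NetVertex n p → ℝ}
    (hf : (flowNetwork A C).IsFlow f) {v w : NetVertex n p} (h : ¬ NetEdge A C v w) : f v w = 0 :=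
  hf.off_edge v w h

theorem FlowNetwork.IsFlow.le_one {f : NetVertex n p → NetVertex n p → ℝ}
    (hf : (flowNetwork A C).IsFlow f) (v w : NetVertex n p) : f v w ≤ 1 := by
  by_cases h : NetEdge A C v w
  · exact hf.le_cap v w h
  · rw [hf.eq_zero h]
    exact zero_le_one

/-- The flow equations, layer by layer. -/
theorem FlowNetwork.IsFlow.balance {f : NetVertex n p → NetVertex n p → ℝ}
    (hf : (flowNetwork A C).IsFlow f) :
    (∀ i, f .source (.inn (.u i)) = f (.out (.u i)) (.inn (.x1 i))) ∧
    (∀ i, f .source (.inn (.x2 i)) = f (.inn (.x2 i)) (.out (.x2 i))) ∧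
    (∀ i, f (.inn (.x2 i)) (.out (.x2 i)) = ∑ j, f (.out (.x2 i)) (.inn (.x1 j))) ∧
    (∀ i, f (.out (.u i)) (.inn (.x1 i)) + ∑ k, f (.out (.x2 k)) (.inn (.x1 i)) =
      f (.inn (.x1 i)) (.out (.x1 i))) ∧
    (∀ i, f (.inn (.x1 i)) (.out (.x1 i)) = ∑ j, f (.out (.x1 i)) (.inn (.y j))) ∧
    (∀ j, ∑ i, f (.out (.x1 i)) (.inn (.y j)) = f (.out (.y j)) .sink) ∧
    (flowNetwork A C).flowValue f = ∑ i, f .source (.inn (.u i)) + stateValue f ∧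
    (flowNetwork A C).flowCost f = ∑ i, f .source (.inn (.u i)) := by
  -- The flow vanishes off the edges; what is left of conservation at `vⁱ` and at `vᵒ` is `c1` and
  -- `c2`.
  have hz : ∀ {v w}, ¬ NetEdge A C v w → f v w = 0 := fun h => hf.eq_zero h
  have a1 : f .source .source = 0 := hz (by rintro ⟨⟩)
  have a2 : f .source .sink = 0 := hz (by rintro ⟨⟩)
  have a3 : ∀ v, f .source (.out v) = 0 := fun v => hz (by rintro ⟨⟩)
  have a4 : ∀ i, f .source (.inn (.x1 i)) = 0 := fun v => hz (by rintro ⟨⟩)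
  have a5 : ∀ i, f .source (.inn (.y i)) = 0 := fun v => hz (by rintro ⟨⟩)
  have a6 : ∀ v, f .sink v = 0 := fun v => hz not_netEdge_sink
  have a7 : ∀ v, f (.inn v) .source = 0 := fun v => hz (by rintro ⟨⟩)
  have a8 : ∀ v, f (.inn v) .sink = 0 := fun v => hz (by rintro ⟨⟩)
  have a9 : ∀ v w, f (.inn v) (.inn w) = 0 := fun v w => hz (by rintro ⟨⟩)
  have a10 : ∀ v, f (.out v) .source = 0 := fun v => hz (by rintro ⟨⟩)
  have a11 : ∀ v w, f (.out v) (.out w) = 0 := fun v w => hz (by rintro ⟨⟩)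
  have a12 : ∀ i, f (.out (.u i)) .sink = 0 := fun v => hz (by rintro ⟨⟩)
  have a13 : ∀ i, f (.out (.x2 i)) .sink = 0 := fun v => hz (by rintro ⟨⟩)
  have a14 : ∀ i, f (.out (.x1 i)) .sink = 0 := fun v => hz (by rintro ⟨⟩)
  have a15 : ∀ v i, f (.out v) (.inn (.u i)) = 0 := fun v i =>
    hz (by rintro (_ | ⟨_, _, ⟨⟩⟩))
  have a16 : ∀ v i, f (.out v) (.inn (.x2 i)) = 0 := fun v i =>
    hz (by rintro (_ | ⟨_, _, ⟨⟩⟩))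
  have a17 : ∀ j i, f (.out (.u j)) (.inn (.y i)) = 0 := fun v i =>
    hz (by rintro (_ | ⟨_, _, ⟨⟩⟩))
  have a18 : ∀ j i, f (.out (.x2 j)) (.inn (.y i)) = 0 := fun v i =>
    hz (by rintro (_ | ⟨_, _, ⟨⟩⟩))
  have a19 : ∀ j i, f (.out (.x1 j)) (.inn (.x1 i)) = 0 := fun v i =>
    hz (by rintro (_ | ⟨_, _, ⟨⟩⟩))
  have a20 : ∀ j v, f (.out (.y j)) (.inn v) = 0 := fun j v =>
    hz (by rintro (_ | ⟨_, _, ⟨⟩⟩))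
  have a21 : ∀ i j, i ≠ j → f (.out (.u i)) (.inn (.x1 j)) = 0 := fun i j h =>
    hz (by rw [netEdge_out_u_iff]; simpa using h.symm)
  have a22 : ∀ (v w : LayerVertex n n p), v ≠ w → f (.inn v) (.out w) = 0 := fun v w h =>
    hz (by rw [netEdge_inn_iff]; simpa using h.symm)
  have y1 : ∀ i, ∑ j, f (.out (.u j)) (.inn (.x1 i)) = f (.out (.u i)) (.inn (.x1 i)) := fun i =>
    Finset.sum_eq_single_of_mem i (Finset.mem_univ i) fun j _ hj => a21 _ _ hj
  have y2 : ∀ i, ∑ j, f (.out (.u i)) (.inn (.x1 j)) = f (.out (.u i)) (.inn (.x1 i)) := fun i =>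
    Finset.sum_eq_single_of_mem i (Finset.mem_univ i) fun j _ hj => a21 _ _ hj.symm
  have y3 : ∀ v, ∑ w, f (.inn v) (.out w) = f (.inn v) (.out v) := fun v =>
    Finset.sum_eq_single_of_mem v (Finset.mem_univ v) fun j _ hj => a22 _ _ hj.symm
  have y4 : ∀ v, ∑ w, f (.inn w) (.out v) = f (.inn v) (.out v) := fun v =>
    Finset.sum_eq_single_of_mem v (Finset.mem_univ v) fun j _ hj => a22 _ _ hj
  have c1 : ∀ v, f .source (.inn v) + ∑ w, f (.out w) (.inn v) = f (.inn v) (.out v) := by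
    intro v
    have : ∑ w, f w (.inn v) = ∑ w, f (.inn v) w := hf.conserve (.inn v) nofun nofun
    simpa [sum_netVertex, a6, a7, a8, a9, y3] using this
  have c2 : ∀ v, f (.inn v) (.out v) = f (.out v) .sink + ∑ w, f (.out v) (.inn w) := by
    intro v
    have : ∑ w, f w (.out v) = ∑ w, f (.out v) w := hf.conserve (.out v) nofun nofun
    simpa [sum_netVertex, a3, a6, a10, a11, y4] using this
  simp only [sum_layerVertex] at c1 c2
  refine ⟨fun i => ?_, fun i => ?_, fun i => ?_, fun i => ?_, fun i => ?_, fun j => ?_, ?_, ?_⟩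
  · have h1 := c1 (.u i)
    have h2 := c2 (.u i)
    simp only [a15, a16, a12, a17, y2, Finset.sum_const_zero, add_zero, zero_add] at h1 h2
    rw [h1, h2]
  · simpa [a16] using c1 (.x2 i)
  · simpa [a13, a15, a16, a18] using c2 (.x2 i)
  · simpa [a4, a19, a20, y1] using c1 (.x1 i)
  · simpa [a14, a15, a16, a19] using c2 (.x1 i)
  · have h1 := c1 (.y j)
    have h2 := c2 (.y j)
    simp only [a5, a17, a18, a20, Finset.sum_const_zero, add_zero, zero_add] at h1 h2
    rw [h1, h2]
  · change ∑ v, f .source v - ∑ v, f v .source = _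
    rw [sum_netVertex, sum_netVertex, sum_layerVertex]
    simp [a1, a2, a3, a4, a5, a6, a7, a10, stateValue]
  · have h1 : ∀ i, f .source (.inn (.u i)) = f (.out (.u i)) (.inn (.x1 i)) := by
      intro i
      have h1 := c1 (.u i)
      have h2 := c2 (.u i)
      simp only [a15, a16, a12, a17, y2, Finset.sum_const_zero, add_zero, zero_add] at h1 h2
      rw [h1, h2]
    change ∑ v, ∑ w, f v w * netCost v w = _
    simp only [sum_netVertex, sum_layerVertex, netCost, mul_zero, Finset.sum_const_zero, add_zero,
      zero_add, mul_ite, mul_one, Finset.sum_ite_eq, Finset.mem_univ, if_true, h1]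

/-! ### The flow of a linking -/

/-- A family of `q` vertex-disjoint paths from the vertices `uᵢ`, `xᵢ²` to the vertices `yⱼ`: the
path with index `j` passes through `x¹` of the state `via j` and ends in the output `dst j`; it
starts in `x²` of the state `src j` if there is one, and in `u` of the state `via j` otherwise. -/
structure Linking (A : StructMatrix n n) (C : StructMatrix p n) (q : ℕ) where
  src : Fin q → Option (Fin n)
  via : Fin q → Fin n
  dst : Fin q → Fin p
  src_inj : ∀ i j k, src i = some k → src j = some k → i = j
  via_inj : Function.Injective via
  dst_inj : Function.Injective dst
  src_via : ∀ j k, src j = some k → A (via j) k = true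
  via_dst : ∀ j, C (dst j) (via j) = true

namespace Linking

variable {q : ℕ} (K : Linking A C q)

/-- The first vertex of a path. -/
def start (j : Fin q) : LayerVertex n n p :=
  match K.src j with
  | none => .u (K.via j)
  | some k => .x2 k

/-- The vertices of a path in the flow network. -/
def vertex (j : Fin q) : Fin 8 → NetVertex n p :=
  ![.source, .inn (K.start j), .out (K.start j), .inn (.x1 (K.via j)), .out (.x1 (K.via j)),
    .inn (.y (K.dst j)), .out (.y (K.dst j)), .sink]

/-- The sum of the unit flows along the paths. -/
def flow (v w : NetVertex n p) : ℝ :=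
  ∑ j, ∑ e : Fin 7, if K.vertex j e.castSucc = v ∧ K.vertex j e.succ = w then 1 else 0

theorem start_injective : Function.Injective K.start := by
  intro i j h
  unfold start at h
  rcases hi : K.src i with _ | k <;> rcases hj : K.src j with _ | k' <;>
    simp only [hi, hj] at h
  · exact K.via_inj (by simpa using h)
  · simp at h
  · simp at h
  · have : k = k' := by simpa using h
    exact K.src_inj i j k' (this ▸ hi) hj

theorem start_ne_x1 (j : Fin q) (i : Fin n) : K.start j ≠ .x1 i := by
  unfold start
  split <;> simp

theorem start_ne_y (j : Fin q) (i : Fin p) : K.start j ≠ .y i := by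
  unfold start
  split <;> simp

theorem netEdge_vertex (j : Fin q) (e : Fin 7) :
    NetEdge A C (K.vertex j e.castSucc) (K.vertex j e.succ) := by
  fin_cases e
  · change NetEdge A C .source (.inn (K.start j))
    rw [netEdge_source_iff]
    unfold start
    split <;> simp
  · exact .split _
  · refine .layer _ _ ?_
    unfold start
    split
    · exact .ux1 _ _ (by simp [structId])
    · exact .x2x1 _ _ (K.src_via _ _ ‹_›)
  · exact .split _
  · exact .layer _ _ (.x1y _ _ (K.via_dst j))
  · exact .split _
  · exact .y_sink _

theorem sum_flow_right (v : NetVertex n p) :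
    ∑ w, K.flow v w = ∑ j, ∑ e : Fin 7, if K.vertex j e.castSucc = v then 1 else 0 := by
  unfold flow
  rw [Finset.sum_comm]
  refine Finset.sum_congr rfl fun j _ => ?_
  rw [Finset.sum_comm]
  refine Finset.sum_congr rfl fun e _ => ?_
  by_cases h : K.vertex j e.castSucc = v <;> simp [h]

theorem sum_flow_left (w : NetVertex n p) :
    ∑ v, K.flow v w = ∑ j, ∑ e : Fin 7, if K.vertex j e.succ = w then 1 else 0 := by
  unfold flow
  rw [Finset.sum_comm]
  refine Finset.sum_congr rfl fun j _ => ?_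
  rw [Finset.sum_comm]
  refine Finset.sum_congr rfl fun e _ => ?_
  by_cases h : K.vertex j e.succ = w <;> simp [h]

theorem flow_nonneg (v w : NetVertex n p) : 0 ≤ K.flow v w :=
  Finset.sum_nonneg fun _ _ => Finset.sum_nonneg fun _ _ => by split_ifs <;> simp

theorem sum_ite_le_one {ι α : Type} [Fintype ι] [DecidableEq α] {g : ι → α}
    (hg : Function.Injective g) (a : α) : ∑ j, (if g j = a then (1 : ℝ) else 0) ≤ 1 := by
  rw [Finset.sum_boole]
  have : (Finset.univ.filter fun j => g j = a).card ≤ 1 := Finset.card_le_one.2 fun i hi j hj =>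
    hg ((Finset.mem_filter.1 hi).2.trans (Finset.mem_filter.1 hj).2.symm)
  exact_mod_cast this

/-- The first vertices, the `via` states and the outputs are each distinct, so a vertex other than
the source and the sink is entered by at most one path. All capacity bounds follow from this. -/
theorem sum_vertex_le_one (w : NetVertex n p)
    (h1 : w ≠ .source) (h2 : w ≠ .sink) :
    ∑ j, ∑ e : Fin 7, (if K.vertex j e.succ = w then (1 : ℝ) else 0) ≤ 1 := by
  have hs := K.start_injective
  cases w with
  | source => exact absurd rfl h1
  | sink => exact absurd rfl h2
  | inn v =>
    cases v with
    | u i => simpa [-Finset.sum_boole, Fin.sum_univ_succ, vertex] using sum_ite_le_one hs (.u i)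
    | x2 i => simpa [-Finset.sum_boole, Fin.sum_univ_succ, vertex] using sum_ite_le_one hs (.x2 i)
    | x1 i => simpa [-Finset.sum_boole, Fin.sum_univ_succ, vertex, start_ne_x1] using sum_ite_le_one K.via_inj i
    | y i => simpa [-Finset.sum_boole, Fin.sum_univ_succ, vertex, start_ne_y] using sum_ite_le_one K.dst_inj i
  | out v =>
    cases v with
    | u i => simpa [-Finset.sum_boole, Fin.sum_univ_succ, vertex] using sum_ite_le_one hs (.u i)
    | x2 i => simpa [-Finset.sum_boole, Fin.sum_univ_succ, vertex] using sum_ite_le_one hs (.x2 i)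
    | x1 i => simpa [-Finset.sum_boole, Fin.sum_univ_succ, vertex, start_ne_x1] using sum_ite_le_one K.via_inj i
    | y i => simpa [-Finset.sum_boole, Fin.sum_univ_succ, vertex, start_ne_y] using sum_ite_le_one K.dst_inj i

theorem flow_conserve (v : NetVertex n p) (h1 : v ≠ .source) (h2 : v ≠ .sink) :
    ∑ w, K.flow w v = ∑ w, K.flow v w := by
  rw [sum_flow_left, sum_flow_right]
  refine Finset.sum_congr rfl fun j _ => ?_
  -- Entering and leaving are both compared with the visits to `v` among all eight vertices of the
  -- path; the two ends do not count, being the source and the sink.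
  have e1 : ∑ e : Fin 8, (if K.vertex j e = v then (1 : ℝ) else 0) =
      ∑ e : Fin 7, if K.vertex j e.succ = v then 1 else 0 := by
    rw [Fin.sum_univ_succ, if_neg (fun h => h1 h.symm), zero_add]
  have e2 : ∑ e : Fin 8, (if K.vertex j e = v then (1 : ℝ) else 0) =
      ∑ e : Fin 7, if K.vertex j e.castSucc = v then 1 else 0 := by
    rw [Fin.sum_univ_castSucc, if_neg (fun h => h2 h.symm), add_zero]
  rw [← e1, e2]

theorem isFlow : (flowNetwork A C).IsFlow K.flow where
  nonneg := K.flow_nonneg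
  off_edge := by
    intro v w h
    refine Finset.sum_eq_zero fun j _ => Finset.sum_eq_zero fun e _ => if_neg ?_
    rintro ⟨rfl, rfl⟩
    exact h (K.netEdge_vertex j e)
  le_cap := by
    intro v w hvw
    change K.flow v w ≤ 1
    have hv : v ≠ .sink := by
      rintro rfl
      exact not_netEdge_sink hvw
    by_cases hw : w = .sink
    · have hv' : v ≠ .source := by
        rintro rfl
        rw [hw] at hvw
        cases hvw
      refine (Finset.single_le_sum (fun w _ => K.flow_nonneg v w) (Finset.mem_univ w)).trans ?_
      rw [← K.flow_conserve v hv' hv, sum_flow_left]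
      exact K.sum_vertex_le_one v hv' hv
    · have hw' : w ≠ .source := by
        rintro rfl
        cases hvw
      refine (Finset.single_le_sum (fun v _ => K.flow_nonneg v w) (Finset.mem_univ v)).trans ?_
      rw [sum_flow_left]
      exact K.sum_vertex_le_one w hw' hw
  conserve := K.flow_conserve

theorem isIntegral : FlowNetwork.IsIntegral K.flow := fun v w =>
  ⟨∑ j, ∑ e : Fin 7, if K.vertex j e.castSucc = v ∧ K.vertex j e.succ = w then 1 else 0, by
    simp [flow]⟩

theorem flowValue_flow : (flowNetwork A C).flowValue K.flow = q := by
  change ∑ v, K.flow .source v - ∑ v, K.flow v .source = q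
  rw [sum_flow_left, sum_flow_right]
  simp [-Finset.sum_boole, Fin.sum_univ_succ, vertex]

theorem flow_source_x2 (i : Fin n) :
    K.flow .source (.inn (.x2 i)) = ∑ j, if K.src j = some i then 1 else 0 := by
  have h : ∀ j, K.start j = .x2 i ↔ K.src j = some i := by
    intro j
    unfold start
    split <;> simp_all
  simp [-Finset.sum_boole, flow, Fin.sum_univ_succ, vertex, h]

theorem flow_x2_ne_zero_iff (i : Fin n) :
    K.flow (.inn (.x2 i)) (.out (.x2 i)) ≠ 0 ↔ ∃ j, K.src j = some i := by
  rw [← K.isFlow.balance.2.1 i, flow_source_x2, Finset.sum_boole]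
  simp [Finset.filter_eq_empty_iff]

theorem flow_u_ne_zero_iff (i : Fin n) :
    K.flow (.out (.u i)) (.inn (.x1 i)) ≠ 0 ↔ ∃ j, K.src j = none ∧ K.via j = i := by
  have h : ∀ j, K.start j = .u i ↔ K.src j = none ∧ K.via j = i := by
    intro j
    unfold start
    split <;> simp_all
  have h2 : K.flow .source (.inn (.u i)) =
      ∑ j, if K.src j = none ∧ K.via j = i then 1 else 0 := by
    simp [-Finset.sum_boole, flow, Fin.sum_univ_succ, vertex, h]
  rw [← K.isFlow.balance.1 i, h2, Finset.sum_boole]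
  simp [Finset.filter_eq_empty_iff]

theorem stateValue_flow :
    stateValue K.flow = ((Finset.univ.filter fun j => K.src j ≠ none).card : ℝ) := by
  unfold stateValue
  simp only [flow_source_x2]
  rw [Finset.sum_comm, ← Finset.sum_boole]
  refine Finset.sum_congr rfl fun j _ => ?_
  rcases h : K.src j with _ | k <;> simp

end Linking

/-- All flow crosses from the layer `x¹` to the outputs, and each of the `p` outputs lets at most
one unit pass. -/
theorem FlowNetwork.IsFlow.flowValue_le {f : NetVertex n p → NetVertex n p → ℝ}
    (hf : (flowNetwork A C).IsFlow f) : (flowNetwork A C).flowValue f ≤ p ∧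
      (flowNetwork A C).flowValue f = ∑ j, ∑ i, f (.out (.x1 i)) (.inn (.y j)) := by
  obtain ⟨h1, h2, h3, h4, h5, h6, h7, -⟩ := hf.balance
  have h : (flowNetwork A C).flowValue f = ∑ j, ∑ i, f (.out (.x1 i)) (.inn (.y j)) := by
    rw [h7, Finset.sum_comm]
    simp only [stateValue, ← h5, ← h4, Finset.sum_add_distrib, h1, h2, h3]
    rw [Finset.sum_comm]
  refine ⟨?_, h⟩
  rw [h]
  calc ∑ j, ∑ i, f (.out (.x1 i)) (.inn (.y j)) ≤ ∑ _j : Fin p, (1 : ℝ) :=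
        Finset.sum_le_sum fun j _ => by rw [h6]; exact hf.le_one _ _
    _ = p := by simp

/-- The paths of an integral flow of value `p`. -/
theorem FlowNetwork.IsFlow.exists_linking {f : NetVertex n p → NetVertex n p → ℝ}
    (hf : (flowNetwork A C).IsFlow f) (hint : FlowNetwork.IsIntegral f)
    (hval : (flowNetwork A C).flowValue f = p) :
    ∃ K : Linking A C p, K.dst = id ∧
      (∀ j, K.src j = none → K.via j ∈ inputStates f) ∧
      ∀ j k, K.src j = some k → k ∈ linkedStates f := by
  obtain ⟨h1, h2, h3, h4, h5, h6, h7, -⟩ := hf.balance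
  have hone : ∀ v w, f v w ≠ 0 → f v w = 1 := by
    intro v w h
    obtain ⟨k, hk⟩ := hint v w
    have l1 := hf.nonneg v w
    have l2 := hf.le_one v w
    rw [hk] at h l1 l2 ⊢
    have l3 : (0 : ℤ) ≤ k := by exact_mod_cast l1
    have l4 : k ≤ 1 := by exact_mod_cast l2
    have l5 : k ≠ 0 := by exact_mod_cast h
    have : k = 1 := by omega
    rw [this]
    norm_num
  have hadj : ∀ v w, f v w ≠ 0 → NetEdge A C v w := fun v w h => by
    by_contra hne
    exact h (hf.eq_zero hne)
  -- A value of `p` saturates every output.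
  have hy : ∀ j, ∑ i, f (.out (.x1 i)) (.inn (.y j)) = 1 := by
    have hsum := hf.flowValue_le.2
    rw [hval] at hsum
    have hle : ∀ j ∈ Finset.univ, ∑ i, f (.out (.x1 i)) (.inn (.y j)) ≤ 1 := fun j _ => by
      rw [h6]; exact hf.le_one _ _
    intro j
    refine (Finset.sum_eq_sum_iff_of_le hle).1 ?_ j (Finset.mem_univ j)
    rw [← hsum]
    simp
  have hvia : ∀ j, ∃ i, f (.out (.x1 i)) (.inn (.y j)) ≠ 0 := fun j => by
    by_contra hno
    push Not at hno
    have := hy j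
    simp [hno] at this
  choose via hvia using hvia
  have hthru : ∀ j, f (.inn (.x1 (via j))) (.out (.x1 (via j))) = 1 := by
    intro j
    refine le_antisymm (hf.le_one _ _) ?_
    rw [h5, ← hone _ _ (hvia j)]
    exact Finset.single_le_sum (f := fun j' => f (.out (.x1 (via j))) (.inn (.y j')))
      (fun j' _ => hf.nonneg _ _) (Finset.mem_univ j)
  -- Two edges with unit flow that share a vertex of throughput at most one coincide; this yields
  -- the disjointness of the paths.
  have two_le : ∀ {ι : Type} [Fintype ι] [DecidableEq ι] (g : ι → ℝ) (a b : ι), (∀ i, 0 ≤ g i) →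
      g a = 1 → g b = 1 → ∑ i, g i ≤ 1 → a = b := by
    intro ι _ _ g a b hg ha hb hs
    by_contra hab
    have := Finset.sum_le_univ_sum_of_nonneg (s := {a, b}) hg
    rw [Finset.sum_pair hab, ha, hb] at this
    linarith
  have hsrc : ∀ j, ∃ s : Option (Fin n), (s = none → via j ∈ inputStates f) ∧
      ∀ k, s = some k → f (.out (.x2 k)) (.inn (.x1 (via j))) ≠ 0 := by
    intro j
    by_cases hu : f (.out (.u (via j))) (.inn (.x1 (via j))) = 0
    · have := h4 (via j)
      rw [hu, hthru, zero_add] at this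
      obtain ⟨k, _, hk⟩ := Finset.exists_ne_zero_of_sum_ne_zero (this ▸ one_ne_zero)
      exact ⟨some k, by simp, fun k' hk' => by rwa [← Option.some.inj hk']⟩
    · exact ⟨none, fun _ => by simpa [inputStates] using hu, by simp⟩
  choose src hsrc1 hsrc2 using hsrc
  have hvia_inj : Function.Injective via := by
    intro j j' hjj
    refine two_le (fun j' => f (.out (.x1 (via j))) (.inn (.y j'))) j j' (fun _ => hf.nonneg _ _)
      (hone _ _ (hvia j)) (hone _ _ (hjj ▸ hvia j')) ?_
    rw [← h5]
    exact hf.le_one _ _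
  refine ⟨⟨src, via, id, ?_, hvia_inj, Function.injective_id, ?_, ?_⟩, rfl, hsrc1, ?_⟩
  · intro i j k hi hj
    refine hvia_inj (two_le (fun l => f (.out (.x2 k)) (.inn (.x1 l))) _ _ (fun _ => hf.nonneg _ _)
      (hone _ _ (hsrc2 i k hi)) (hone _ _ (hsrc2 j k hj)) ?_)
    rw [← h3]
    exact hf.le_one _ _
  · intro j k hk
    obtain ⟨l, hl, hA⟩ := netEdge_out_x2_iff.1 (hadj _ _ (hsrc2 j k hk))
    have : via j = l := by simpa using hl
    rw [this, hA]
  · intro j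
    obtain ⟨l, hl, hC⟩ := netEdge_out_x1_iff.1 (hadj _ _ (hvia j))
    have : j = l := by simpa using hl
    subst this
    exact hC
  · intro j k hk
    change f _ _ ≠ 0
    rw [h3]
    refine (lt_of_lt_of_le zero_lt_one ?_).ne'
    rw [← hone _ _ (hsrc2 j k hk)]
    exact Finset.single_le_sum (f := fun l => f (.out (.x2 k)) (.inn (.x1 l)))
      (fun l _ => hf.nonneg _ _) (Finset.mem_univ _)

/-- Integrality and unit capacities leave only the flows `0` and `1` on the edges of cost one. -/
theorem FlowNetwork.IsFlow.card_inputStates {f : NetVertex n p → NetVertex n p → ℝ}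
    (hf : (flowNetwork A C).IsFlow f) (hint : FlowNetwork.IsIntegral f) :
    ((inputStates f).card : ℝ) = (flowNetwork A C).flowCost f := by
  obtain ⟨h1, -, -, -, -, -, -, h8⟩ := hf.balance
  rw [h8, inputStates, ← Finset.sum_boole]
  refine Finset.sum_congr rfl fun i _ => ?_
  rw [h1]
  split_ifs with h
  · obtain ⟨k, hk⟩ := hint (.out (.u i)) (.inn (.x1 i))
    have l1 := hf.nonneg (.out (.u i)) (.inn (.x1 i))
    have l2 := hf.le_one (.out (.u i)) (.inn (.x1 i))
    rw [hk] at h l1 l2 ⊢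
    have l3 : (0 : ℤ) ≤ k := by exact_mod_cast l1
    have l4 : k ≤ 1 := by exact_mod_cast l2
    have l5 : k ≠ 0 := by exact_mod_cast h
    have : k = 1 := by omega
    rw [this]
    norm_num
  · push Not at h
    exact h.symm

/-- A flow of full value is a minimum cost maximum flow if it takes as much as possible from the
states. -/
theorem isMinCostMaxFlow_of_stateValue {f : NetVertex n p → NetVertex n p → ℝ}
    (hf : (flowNetwork A C).IsFlow f) (hval : (flowNetwork A C).flowValue f = p)
    (hmax : ∀ g, (flowNetwork A C).IsFlow g → stateValue g ≤ stateValue f) :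
    (flowNetwork A C).IsMinCostMaxFlow f := by
  refine ⟨⟨hf, fun g hg => hval ▸ hg.flowValue_le.1⟩, fun g hg => ?_⟩
  have h1 := hg.2 f hf
  obtain ⟨-, -, -, -, -, -, h7, h8⟩ := hf.balance
  obtain ⟨-, -, -, -, -, -, h7', h8'⟩ := hg.1.balance
  have h2 := hg.1.flowValue_le.1
  have h3 := hmax g hg.1
  linarith

end flow

/-! ## Structural output controllability of a linked triple -/

theorem exists_realize_eq {a b : ℕ} (S : StructMatrix a b) (M : Matrix (Fin a) (Fin b) ℝ)
    (h : ∀ i j, M i j ≠ 0 → S i j = true) : ∃ θ, realize S θ = M := by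
  refine ⟨fun x => M x.1.1 x.1.2, ?_⟩
  ext i j
  by_cases hij : S i j = true
  · simp [realize, hij]
  · have : M i j = 0 := by
      by_contra hne
      exact hij (h i j hne)
    simp [realize, hij, this]

theorem realize_ne_zero {a b : ℕ} {S : StructMatrix a b} {θ : Params S} {i : Fin a} {j : Fin b}
    (h : realize S θ i j ≠ 0) : S i j = true := by
  by_contra hne
  exact h (by simp [realize, hne])

/-- For a diagonal matrix, `d² y = 0` implies `d y = 0` entry by entry. Diagonalizability enters the
proof only through this consequence. -/
theorem IsDiagonalizable.mulVec_eq_zero {n : ℕ} {A : Matrix (Fin n) (Fin n) ℝ}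
    (hA : IsDiagonalizable A) {x : Fin n → ℝ} (hx : A.mulVec (A.mulVec x) = 0) :
    A.mulVec x = 0 := by
  obtain ⟨P, d, hP⟩ := hA
  have hcast : ∀ v : Fin n → ℝ, (A.map Complex.ofReal).mulVec (fun i => (v i : ℂ)) =
      fun i => ((A.mulVec v i : ℝ) : ℂ) := by
    intro v
    ext i
    exact (RingHom.map_mulVec Complex.ofRealHom A v i).symm
  have hiP : (P⁻¹).val * P.val = 1 := by
    rw [← Units.val_mul, inv_mul_cancel, Units.val_one]
  set X : Fin n → ℂ := fun i => (x i : ℂ)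
  have h1 : (A.map Complex.ofReal).mulVec ((A.map Complex.ofReal).mulVec X) = 0 := by
    rw [hcast, hcast, hx]
    ext i
    simp
  set y := (P⁻¹).val.mulVec X with hy
  have h2 : ∀ v, (A.map Complex.ofReal).mulVec v =
      P.val.mulVec ((Matrix.diagonal d).mulVec ((P⁻¹).val.mulVec v)) := fun v => by
    rw [hP, Matrix.mulVec_mulVec, Matrix.mulVec_mulVec, Matrix.mul_assoc]
  have h3 : (Matrix.diagonal d).mulVec ((Matrix.diagonal d).mulVec y) = 0 := by
    have hc : ∀ v, (P⁻¹).val.mulVec (P.val.mulVec v) = v := fun v => by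
      rw [Matrix.mulVec_mulVec, hiP, Matrix.one_mulVec]
    have := congrArg (P⁻¹).val.mulVec h1
    rwa [h2, h2, Matrix.mulVec_zero, hc, hc] at this
  have h4 : (Matrix.diagonal d).mulVec y = 0 := by
    ext i
    have := congrFun h3 i
    simp only [Matrix.mulVec_diagonal, Pi.zero_apply] at this ⊢
    rcases mul_eq_zero.1 this with h | h
    · rw [h, zero_mul]
    · exact h
  have h5 : (A.map Complex.ofReal).mulVec X = 0 := by
    rw [h2, ← hy, h4, Matrix.mulVec_zero]
  rw [hcast] at h5
  ext i
  have h6 : ((A.mulVec x i : ℝ) : ℂ) = 0 := congrFun h5 i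
  exact_mod_cast h6

/-! ### Reachable states, cycles and generic controllability -/

section

variable {n m p : ℕ} {A : StructMatrix n n} {B : StructMatrix n m} {C : StructMatrix p n}

open Classical in
/-- The projection onto the states that are reachable from the inputs. -/
noncomputable def reachProj (A : StructMatrix n n) (B : StructMatrix n m) :
    Matrix (Fin n) (Fin n) ℝ :=
  Matrix.diagonal fun i => if ∃ s k, B s k = true ∧ Reachable A s i then 1 else 0

theorem mul_reachProj_apply (M : Matrix (Fin n) (Fin n) ℝ) (i j : Fin n) :
    ((∃ s k, B s k = true ∧ Reachable A s j) → (M * reachProj A B) i j = M i j) ∧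
    (¬ (∃ s k, B s k = true ∧ Reachable A s j) → (M * reachProj A B) i j = 0) := by
  rw [reachProj, Matrix.mul_diagonal]
  constructor
  · intro h
    rw [if_pos h, mul_one]
  · intro h
    rw [if_neg h, mul_zero]

theorem reachProj_mul_eq {q : ℕ} (M : Matrix (Fin n) (Fin q) ℝ)
    (h : ∀ i j, M i j ≠ 0 → ∃ s k, B s k = true ∧ Reachable A s i) :
    reachProj A B * M = M := by
  ext i j
  rw [reachProj, Matrix.diagonal_mul]
  by_cases hM : M i j = 0
  · rw [hM, mul_zero]
  · rw [if_pos (h i j hM), one_mul]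

/-- No edge leaves the set of reachable states, so the coordinate subspace of these states is
invariant under `A`. -/
theorem reachProj_mul_realize (α : Params A) :
    reachProj A B * (realize A α * reachProj A B) = realize A α * reachProj A B := by
  refine reachProj_mul_eq _ fun i j hij => ?_
  by_cases hj : ∃ s k, B s k = true ∧ Reachable A s j
  · rw [(mul_reachProj_apply _ i j).1 hj] at hij
    obtain ⟨s, k, hs, hr⟩ := hj
    exact ⟨s, k, hs, hr.tail (realize_ne_zero hij)⟩
  · exact absurd ((mul_reachProj_apply _ i j).2 hj) hij

theorem reachProj_mul_pow_mul (α : Params A) (β : Params B) (k : ℕ) :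
    reachProj A B * (realize A α ^ k * realize B β) = realize A α ^ k * realize B β := by
  induction k with
  | zero =>
    rw [pow_zero, Matrix.one_mul]
    exact reachProj_mul_eq _ fun i j hij => ⟨i, j, realize_ne_zero hij, .refl⟩
  | succ k ih =>
    have h1 : realize A α ^ (k + 1) * realize B β =
        (realize A α * reachProj A B) * (realize A α ^ k * realize B β) := by
      rw [Matrix.mul_assoc, ih, pow_succ', Matrix.mul_assoc]
    rw [h1, ← Matrix.mul_assoc, reachProj_mul_realize]

/-- The generic rank of the reachable part of `A` is attained on disjoint cycles of reachable
states. -/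
theorem exists_cycles (hA : GenericallyDiagonalizable A) :
    ∃ (σ : Equiv.Perm (Fin n)) (I : Finset (Fin n)),
      (∀ α : Params A, (realize A α * reachProj A B).rank ≤ I.card) ∧
      (∀ i ∈ I, A (σ i) i = true ∧ ∃ s k, B s k = true ∧ Reachable A s i) ∧
      ∀ i ∉ I, σ i = i := by
  obtain ⟨⟨α₁, hα₁⟩, hmax⟩ := grank_isGreatest fun α : Params A => realize A α * reachProj A B
  set r := grank fun α : Params A => realize A α * reachProj A B
  obtain ⟨U, V, hUV⟩ := exists_mul_mul_eq_one_of_le_rank _ hα₁.ge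
  obtain ⟨W, ⟨⟨S, rfl⟩, hne⟩, hW⟩ := hA
  obtain ⟨α₂, hα₂⟩ := (Set.ne_univ_iff_exists_notMem _).1 hne
  simp only [Set.mem_ofPred_eq, not_forall] at hα₂
  obtain ⟨q, hqS, hq⟩ := hα₂
  -- Attaining the maximal rank and avoiding the exceptional variety are both ensured by
  -- nonvanishing polynomials, so one `α` achieves both.
  have hpoly : (fun α : Params A => (U * (realize A α * reachProj A B) * V).det) ∈
      linePoly (Params A) :=
    linePoly_det <| linePoly_matrix_mul (linePoly_matrix_mul (fun i j => linePoly_const _)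
      (linePoly_matrix_mul (linePoly_realize A) fun i j => linePoly_const _))
      fun i j => linePoly_const _
  obtain ⟨α, h1, h2⟩ := linePoly_exists_ne_zero hpoly (linePoly_eval q) (x := α₁)
    (by rw [hUV]; simp) hq
  have hdiag := hW α fun h => h2 (h q hqS)
  have hrank : (realize A α * reachProj A B).rank = r :=
    le_antisymm (hmax ⟨α, rfl⟩) (le_rank_of_det_ne_zero _ _ _ h1)
  -- With `P` the projection, `P A P = A P` turns `(A P)² x = 0` into `A (A (P x)) = 0`, to which
  -- diagonalizability of `A` applies.
  have hker : ∀ x, (realize A α * reachProj A B).mulVec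
      ((realize A α * reachProj A B).mulVec x) = 0 →
      (realize A α * reachProj A B).mulVec x = 0 := by
    intro x hx
    rw [Matrix.mulVec_mulVec, Matrix.mul_assoc, reachProj_mul_realize, ← Matrix.mulVec_mulVec,
      ← Matrix.mulVec_mulVec] at hx
    rw [← Matrix.mulVec_mulVec]
    exact hdiag.mulVec_eq_zero hx
  have hc := charpoly_coeff_ne_zero_of_ker_sq _ hker
  obtain ⟨σ, I, hI, hσ, hfix⟩ := exists_perm_of_charpoly_coeff_ne_zero _ hc
  have hrn : (realize A α * reachProj A B).rank ≤ n := by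
    simpa using Matrix.rank_le_width (realize A α * reachProj A B)
  have hIr : I.card = r := by omega
  refine ⟨σ, I, fun α => hIr ▸ hmax ⟨α, rfl⟩, fun i hi => ?_, hfix⟩
  have h3 := hσ i hi
  by_cases hr : ∃ s k, B s k = true ∧ Reachable A s i
  · rw [(mul_reachProj_apply _ _ i).1 hr] at h3
    exact ⟨realize_ne_zero h3, hr⟩
  · exact absurd ((mul_reachProj_apply _ _ i).2 hr) h3

/-- All input channels carry the same signal. The required vector is written as `B 1` by putting
each of its nonzero entries into one free position of the corresponding row of `B`. -/
theorem exists_krylov_realization {σ : Equiv.Perm (Fin n)} {I : Finset (Fin n)}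
    (hI : ∀ i ∈ I, A (σ i) i = true ∧ ∃ s k, B s k = true ∧ Reachable A s i)
    (hσ : ∀ i ∉ I, σ i = i) :
    ∃ (α : Params A) (β : Params B), LinearIndependent ℝ fun k : Fin I.card =>
      (realize A α ^ (k.val + 1)).mulVec ((realize B β).mulVec 1) := by
  classical
  obtain ⟨M, b, hM, hb, hind⟩ := exists_krylov_linearIndependent
    (fun a b => A a b = true ∧ ∃ s k, B s k = true ∧ Reachable A s b)
    (Finset.univ.filter fun s => ∃ k, B s k = true) I σ hI hσ (by
      intro i hi
      obtain ⟨-, s, k, hs, hr⟩ := hI i hi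
      refine ⟨s, by simpa using ⟨k, hs⟩, ?_⟩
      clear hi
      induction hr with
      | refl => exact .refl
      | tail h1 h2 ih => exact ih.tail ⟨h2, s, k, hs, h1⟩) rfl
  obtain ⟨α, hα⟩ := exists_realize_eq A M fun i j h => (hM i j h).1
  have hcol : ∀ i, ∃ k : Fin m → ℝ, ∑ c, k c = b i ∧ ∀ c, k c ≠ 0 → B i c = true := by
    intro i
    by_cases hi : b i = 0
    · exact ⟨0, by simp [hi], by simp⟩
    · obtain ⟨c, hc⟩ : ∃ c, B i c = true := by simpa using hb i hi
      refine ⟨fun c' => if c' = c then b i else 0, by simp, fun c' hc' => ?_⟩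
      have : c' = c := by
        by_contra hne
        simp [hne] at hc'
      rw [this, hc]
  choose N hN1 hN2 using hcol
  obtain ⟨β, hβ⟩ := exists_realize_eq B (Matrix.of N) hN2
  refine ⟨α, β, ?_⟩
  have : (Matrix.of N).mulVec 1 = b := by
    ext i
    simp [Matrix.mulVec, dotProduct, hN1]
  rw [hα, hβ, this]
  exact hind

open Classical in
theorem Linking.exists_realization {q : ℕ} (K : Linking A C q) :
    ∃ (α : Params A) (γ : Params C),
      (∀ a b, realize A α a b = if ∃ j, K.via j = a ∧ K.src j = some b then 1 else 0) ∧
      ∀ i a, realize C γ i a = if ∃ j, K.dst j = i ∧ K.via j = a then 1 else 0 := by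
  obtain ⟨α, hα⟩ := exists_realize_eq A
    (Matrix.of fun a b => if ∃ j, K.via j = a ∧ K.src j = some b then (1 : ℝ) else 0) (by
      intro a b h
      have : ∃ j, K.via j = a ∧ K.src j = some b := by
        by_contra hne
        simp [hne] at h
      obtain ⟨j, rfl, hj⟩ := this
      exact K.src_via j b hj)
  obtain ⟨γ, hγ⟩ := exists_realize_eq C
    (Matrix.of fun i a => if ∃ j, K.dst j = i ∧ K.via j = a then (1 : ℝ) else 0) (by
      intro a b h
      have : ∃ j, K.dst j = a ∧ K.via j = b := by
        by_contra hne
        simp [hne] at h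
      obtain ⟨j, rfl, rfl⟩ := this
      exact K.via_dst j)
  exact ⟨α, γ, fun a b => by rw [hα]; rfl, fun i a => by rw [hγ]; rfl⟩

-- In the 0-1 realization along the paths, path `j` is fed by its own column of `B` if it starts in
-- a `u`, and by the column of `A` of its starting state otherwise. `V` and `V'` select these
-- columns, and disjointness of the paths makes the product the identity.
open Classical in
theorem Linking.exists_full_rank (K : Linking A C p) (hdst : K.dst = id) (col : Fin p → Fin m)
    (hcol : ∀ j, K.src j = none → B (K.via j) (col j) = true)
    (hinj : ∀ i j, K.src i = none → K.src j = none → col i = col j → i = j)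
    (hreach : ∀ j k, K.src j = some k → ∃ s c, B s c = true ∧ Reachable A s k) :
    ∃ (α : Params A) (β : Params B) (γ : Params C) (V : Matrix (Fin m) (Fin p) ℝ)
      (V' : Matrix (Fin n) (Fin p) ℝ),
      realize C γ * (realize B β * V + realize A α * reachProj A B * V') = 1 := by
  obtain ⟨α, γ, hα, hγ⟩ := K.exists_realization
  obtain ⟨β, hβ⟩ := exists_realize_eq B (Matrix.of fun a c =>
      if ∃ j, K.src j = none ∧ K.via j = a ∧ col j = c then (1 : ℝ) else 0) (by
    intro a b h
    have : ∃ j, K.src j = none ∧ K.via j = a ∧ col j = b := by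
      by_contra hne
      simp [hne] at h
    obtain ⟨j, hj, rfl, rfl⟩ := this
    exact hcol j hj)
  refine ⟨α, β, γ, Matrix.of fun c j => if K.src j = none ∧ c = col j then 1 else 0,
    Matrix.of fun b j => if K.src j = some b then 1 else 0, ?_⟩
  have h1 : ∀ a j, (realize B β *
      Matrix.of fun c j => if K.src j = none ∧ c = col j then (1 : ℝ) else 0) a j =
      if K.src j = none ∧ K.via j = a then 1 else 0 := by
    intro a j
    rw [Matrix.mul_apply]
    by_cases hj : K.src j = none
    · simp only [Matrix.of_apply, hj, true_and, mul_ite, mul_one, mul_zero, Finset.sum_ite_eq',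
        Finset.mem_univ, if_true, hβ]
      refine if_congr ⟨?_, fun h => ⟨j, hj, h, rfl⟩⟩ rfl rfl
      rintro ⟨j', hj', hv, hc⟩
      rwa [← hinj j' j hj' hj hc]
    · simp [hj]
  have h2 : ∀ a j, (realize A α * reachProj A B *
      Matrix.of fun b j => if K.src j = some b then (1 : ℝ) else 0) a j =
      if K.src j ≠ none ∧ K.via j = a then 1 else 0 := by
    intro a j
    rw [Matrix.mul_apply]
    rcases hj : K.src j with _ | k
    · simp [hj]
    · simp only [Matrix.of_apply, hj, Option.some.injEq, mul_ite, mul_one, mul_zero,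
        Finset.sum_ite_eq, Finset.mem_univ, if_true, ne_eq, reduceCtorEq, not_false_eq_true,
        true_and]
      rw [(mul_reachProj_apply _ a k).1 (hreach j k hj), hα]
      refine if_congr ⟨?_, fun h => ⟨j, h, hj⟩⟩ rfl rfl
      rintro ⟨j', hv, hk⟩
      rwa [← K.src_inj j' j k hk hj]
  ext i j
  rw [Matrix.mul_apply]
  simp only [Matrix.add_apply, h1, h2]
  rw [Finset.sum_eq_single (K.via j)]
  · rw [hγ, Matrix.one_apply]
    have h3 : (∃ j', K.dst j' = i ∧ K.via j' = K.via j) ↔ i = j := by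
      simp [hdst, K.via_inj.eq_iff, eq_comm]
    rw [if_congr h3 rfl rfl]
    by_cases hj : K.src j = none <;> simp [hj]
  · intro a _ ha
    simp [ha.symm]
  · simp

/-- At a generic parameter the Krylov matrix has rank `#I`, and `C` times the columns of `B` and `A
P` has full row rank, `P` being the projection to the reachable states. If `w C A^k B = 0` for all
`k`, then `x = w C` annihilates the Krylov matrix. Its range is that of `A P`, so `x` annihilates `A
P` and `B`, and full row rank gives `w = 0`. -/
theorem Linking.structurallyOutputControllable (hA : GenericallyDiagonalizable A)
    (K : Linking A C p) (hdst : K.dst = id) (col : Fin p → Fin m)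
    (hcol : ∀ j, K.src j = none → B (K.via j) (col j) = true)
    (hinj : ∀ i j, K.src i = none → K.src j = none → col i = col j → i = j)
    (hreach : ∀ j k, K.src j = some k → ∃ s c, B s c = true ∧ Reachable A s k) :
    StructurallyOutputControllable A B C := by
  obtain ⟨σ, I, hrank, hI, hσ⟩ := exists_cycles (B := B) hA
  obtain ⟨α₁, β₁, hind⟩ := exists_krylov_realization hI hσ
  obtain ⟨α₂, β₂, γ₂, V, V', hV⟩ := K.exists_full_rank hdst col hcol hinj hreach
  let Θ := Params A × Params B × Params C
  let pA : Θ →ₗ[ℝ] Params A := LinearMap.fst ℝ _ _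
  let pB : Θ →ₗ[ℝ] Params B := LinearMap.fst ℝ _ _ ∘ₗ LinearMap.snd ℝ _ _
  let pC : Θ →ₗ[ℝ] Params C := LinearMap.snd ℝ _ _ ∘ₗ LinearMap.snd ℝ _ _
  have lA : ∀ i j, (fun θ : Θ => realize A θ.1 i j) ∈ linePoly Θ := fun i j =>
    linePoly_comp (linePoly_realize A i j) pA
  have lB : ∀ i j, (fun θ : Θ => realize B θ.2.1 i j) ∈ linePoly Θ := fun i j =>
    linePoly_comp (linePoly_realize B i j) pB
  have lC : ∀ i j, (fun θ : Θ => realize C θ.2.2 i j) ∈ linePoly Θ := fun i j =>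
    linePoly_comp (linePoly_realize C i j) pC
  let Kr : Θ → Matrix (Fin n) (Fin I.card) ℝ := fun θ => Matrix.of fun i k =>
    ∑ c, (realize A θ.1 ^ (k.val + 1) * realize B θ.2.1) i c
  have hKr : ∀ θ i k, Kr θ i k =
      ((realize A θ.1 ^ (k.val + 1)).mulVec ((realize B θ.2.1).mulVec 1)) i := by
    intro θ i k
    rw [Matrix.mulVec_mulVec]
    simp [Kr, Matrix.mulVec, dotProduct]
  have lKr : ∀ i k, (fun θ => Kr θ i k) ∈ linePoly Θ := fun i k =>
    linePoly_sum (s := Finset.univ)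
      fun c _ => linePoly_matrix_mul (linePoly_matrix_pow lA (k.val + 1)) lB i c
  obtain ⟨U, hU⟩ : ∃ U : Matrix (Fin I.card) (Fin n) ℝ, U * Kr (α₁, β₁, γ₂) = 1 := by
    have hinj : LinearMap.ker (Kr (α₁, β₁, γ₂)).mulVecLin = ⊥ := by
      refine LinearMap.ker_eq_bot.2 (Matrix.mulVec_injective_iff.2 ?_)
      have : (Kr (α₁, β₁, γ₂)).col = fun k : Fin I.card =>
          (realize A α₁ ^ (k.val + 1)).mulVec ((realize B β₁).mulVec 1) := by
        ext k i
        exact hKr _ i k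
      rw [this]
      exact hind
    obtain ⟨g, hg⟩ := LinearMap.exists_leftInverse_of_injective _ hinj
    refine ⟨LinearMap.toMatrix' g, ?_⟩
    rw [← LinearMap.toMatrix'_toLin' (Kr (α₁, β₁, γ₂)), ← LinearMap.toMatrix'_comp,
      Matrix.toLin'_apply', hg, LinearMap.toMatrix'_id]
  obtain ⟨⟨α, β, γ⟩, h1, h2⟩ := linePoly_exists_ne_zero (E := Θ)
    (f := fun θ => (U * Kr θ).det)
    (g := fun θ => (realize C θ.2.2 * (realize B θ.2.1 * V +
      realize A θ.1 * reachProj A B * V')).det)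
    (linePoly_det (linePoly_matrix_mul (fun i j => linePoly_const _) lKr))
    (linePoly_det (linePoly_matrix_mul lC (linePoly_matrix_add
      (linePoly_matrix_mul lB fun i j => linePoly_const _)
      (linePoly_matrix_mul (linePoly_matrix_mul lA fun i j => linePoly_const _)
        fun i j => linePoly_const _))))
    (x := (α₁, β₁, γ₂)) (y := (α₂, β₂, γ₂)) (by rw [hU]; simp)
    (by rw [hV]; simp)
  refine ⟨α, β, γ, outputControllable_of_forall_vecMul_eq_zero fun w hw => ?_⟩
  set x := Matrix.vecMul w (realize C γ) with hx
  have hxk : ∀ k, Matrix.vecMul x (realize A α ^ k * realize B β) = 0 := by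
    intro k
    rw [hx, Matrix.vecMul_vecMul, ← Matrix.mul_assoc, hw]
  have hxKr : Matrix.vecMul x (Kr (α, β, γ)) = 0 := by
    ext k
    have h3 : Matrix.vecMul x (Kr (α, β, γ)) k =
        ∑ c, Matrix.vecMul x (realize A α ^ (k.val + 1) * realize B β) c := by
      simp only [Matrix.vecMul, dotProduct, Kr, Matrix.of_apply, Finset.mul_sum]
      rw [Finset.sum_comm]
    rw [h3, hxk]
    simp
  -- The columns of `A^k B` are supported on reachable states, so a factor `A P` can be split off
  -- the Krylov matrix.
  have hfac : Kr (α, β, γ) = realize A α * reachProj A B *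
      Matrix.of fun i (k : Fin I.card) => ∑ c, (realize A α ^ k.val * realize B β) i c := by
    ext i k
    have h3 : realize A α ^ (k.val + 1) * realize B β =
        (realize A α * reachProj A B) * (realize A α ^ k.val * realize B β) := by
      rw [Matrix.mul_assoc, reachProj_mul_pow_mul, pow_succ', Matrix.mul_assoc]
    simp only [Kr, Matrix.of_apply, h3]
    rw [Matrix.mul_apply]
    simp only [Matrix.of_apply, Finset.mul_sum]
    rw [Finset.sum_comm]
    simp only [Matrix.mul_apply (M := realize A α * reachProj A B)]
  -- Inclusion comes from the factorization. The dimensions agree because `A P` never has rank above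
  -- `#I`, whereas the Krylov matrix has rank at least `#I`.
  have hrange : LinearMap.range (Kr (α, β, γ)).mulVecLin =
      LinearMap.range (realize A α * reachProj A B).mulVecLin := by
    apply Submodule.eq_of_le_of_finrank_le
    · rw [hfac, Matrix.mulVecLin_mul]
      exact LinearMap.range_comp_le_range _ _
    · refine (hrank α).trans ?_
      have := le_rank_of_det_ne_zero U (Kr (α, β, γ)) 1 (by simpa using h1)
      exact this
  have hxA : Matrix.vecMul x (realize A α * reachProj A B) = 0 := by
    rw [← dotProduct_eq_zero_iff]
    intro v
    rw [← Matrix.dotProduct_mulVec]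
    obtain ⟨v', hv'⟩ : (realize A α * reachProj A B).mulVec v ∈
        LinearMap.range (Kr (α, β, γ)).mulVecLin := by
      rw [hrange]
      exact ⟨v, rfl⟩
    rw [← hv', Matrix.mulVecLin_apply, Matrix.dotProduct_mulVec, hxKr, zero_dotProduct]
  refine Matrix.eq_zero_of_vecMul_eq_zero h2 ?_
  have hxB := hxk 0
  rw [pow_zero, Matrix.one_mul] at hxB
  rw [← Matrix.vecMul_vecMul, ← hx, Matrix.vecMul_add, ← Matrix.vecMul_vecMul, hxB,
    ← Matrix.vecMul_vecMul, hxA, Matrix.zero_vecMul, Matrix.zero_vecMul, add_zero]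

/-! ## Generic ranks and linkings -/

/-- In the realization along the paths, the paths that start in `x²` single out an identity
submatrix of `C A`. -/
theorem Linking.card_le_structRankMul {q : ℕ} (K : Linking A C q) :
    (Finset.univ.filter fun j => K.src j ≠ none).card ≤ structRankMul C A := by
  classical
  obtain ⟨α, γ, hα, hγ⟩ := K.exists_realization
  refine le_trans ?_ ((grank_isGreatest fun θ : Params C × Params A =>
    realize C θ.1 * realize A θ.2).2 ⟨(γ, α), rfl⟩)
  set J := Finset.univ.filter fun j => K.src j ≠ none with hJ
  set e : Fin J.card ≃ J := J.equivFin.symm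
  have he : ∀ s, K.src (e s) ≠ none := fun s => (Finset.mem_filter.1 (e s).2).2
  refine le_rank_of_det_ne_zero (Matrix.of fun s i => if i = K.dst (e s) then 1 else 0) _
    (Matrix.of fun b s => if K.src (e s) = some b then 1 else 0) ?_
  suffices h : (Matrix.of fun s i => if i = K.dst (e s) then (1 : ℝ) else 0) *
      (realize C γ * realize A α) *
      (Matrix.of fun b s => if K.src (e s) = some b then (1 : ℝ) else 0) = 1 by
    rw [h]
    simp
  have h1 : ∀ a s, (realize A α *
      (Matrix.of fun b s => if K.src (e s) = some b then (1 : ℝ) else 0)) a s =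
      if a = K.via (e s) then 1 else 0 := by
    intro a s
    obtain ⟨k, hk⟩ := Option.ne_none_iff_exists'.1 (he s)
    rw [Matrix.mul_apply]
    simp only [Matrix.of_apply, hk, Option.some.injEq, mul_ite, mul_one, mul_zero,
      Finset.sum_ite_eq, Finset.mem_univ, if_true, hα]
    refine if_congr ⟨?_, fun h => ⟨e s, h.symm, hk⟩⟩ rfl rfl
    rintro ⟨j, rfl, hj⟩
    rw [K.src_inj j (e s) k hj hk]
  have h2 : ∀ i s, (realize C γ * (realize A α *
      (Matrix.of fun b s => if K.src (e s) = some b then (1 : ℝ) else 0))) i s =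
      if i = K.dst (e s) then 1 else 0 := by
    intro i s
    rw [Matrix.mul_apply]
    simp only [h1, mul_ite, mul_one, mul_zero, Finset.sum_ite_eq', Finset.mem_univ, if_true, hγ]
    refine if_congr ⟨?_, fun h => ⟨e s, h.symm, rfl⟩⟩ rfl rfl
    rintro ⟨j, rfl, hj⟩
    rw [K.via_inj hj]
  ext s t
  rw [Matrix.mul_assoc, Matrix.mul_assoc, Matrix.mul_apply]
  simp only [h2, Matrix.of_apply, mul_ite, mul_one, mul_zero, Finset.sum_ite_eq', Finset.mem_univ,
    if_true, Matrix.one_apply]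
  refine if_congr ⟨fun h => ?_, fun h => by rw [h]⟩ rfl rfl
  exact (e.injective (Subtype.ext (K.dst_inj h))).symm

/-- A nonzero minor of `C` contains a nonzero term; the rows and columns that it uses are distinct
and joined by free entries. -/
theorem exists_linking_of_structRank (C : StructMatrix p n) (A : StructMatrix n n) :
    ∃ K : Linking A C (structRank C), ∀ j, K.src j = none := by
  obtain ⟨⟨γ, hγ⟩, -⟩ := grank_isGreatest fun θ : Params C => realize C θ
  change (realize C γ).rank = structRank C at hγ
  obtain ⟨U, V, hUV⟩ := exists_mul_mul_eq_one_of_le_rank _ hγ.ge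
  have h1 : (U * (realize C γ * V)).det ≠ 0 := by
    rw [← Matrix.mul_assoc, hUV]
    simp
  obtain ⟨f, -, hf⟩ := exists_of_det_mul_ne_zero _ _ h1
  have h2 : ((realize C γ).submatrix f id * V).det ≠ 0 := hf
  obtain ⟨g, hg, hV⟩ := exists_of_det_mul_ne_zero _ _ h2
  exact ⟨⟨fun _ => none, g, f, by simp, injective_of_det_submatrix_ne_zero hV,
    injective_of_det_submatrix_ne_zero hf, by simp, fun j => realize_ne_zero (hg j)⟩,
    fun _ => rfl⟩

/-- The expansion is applied to `C`, then to `A`, then leaves a minor of `V`. At each layer a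
repeated index would make the remaining determinant vanish, which gives disjointness. -/
theorem exists_linking_of_structRankMul (C : StructMatrix p n) (A : StructMatrix n n) :
    ∃ K : Linking A C (structRankMul C A), ∀ j, K.src j ≠ none := by
  obtain ⟨⟨⟨γ, α⟩, hγ⟩, -⟩ := grank_isGreatest fun θ : Params C × Params A =>
    realize C θ.1 * realize A θ.2
  change (realize C γ * realize A α).rank = structRankMul C A at hγ
  obtain ⟨U, V, hUV⟩ := exists_mul_mul_eq_one_of_le_rank _ hγ.ge
  have h1 : (U * (realize C γ * (realize A α * V))).det ≠ 0 := by
    rw [← Matrix.mul_assoc (realize C γ), ← Matrix.mul_assoc, hUV]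
    simp
  obtain ⟨f, -, hf⟩ := exists_of_det_mul_ne_zero _ _ h1
  have h2 : ((realize C γ).submatrix f id * (realize A α * V)).det ≠ 0 := hf
  obtain ⟨g, hg, hg'⟩ := exists_of_det_mul_ne_zero _ _ h2
  have h3 : ((realize A α).submatrix g id * V).det ≠ 0 := hg'
  obtain ⟨k, hk, hV⟩ := exists_of_det_mul_ne_zero _ _ h3
  refine ⟨⟨fun j => some (k j), g, f, ?_, injective_of_det_submatrix_ne_zero hg',
    injective_of_det_submatrix_ne_zero hf, ?_, fun j => realize_ne_zero (hg j)⟩, by simp⟩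
  · intro i j l hi hj
    refine injective_of_det_submatrix_ne_zero hV ?_
    rw [Option.some.inj hi, Option.some.inj hj]
  · intro j l hl
    rw [← Option.some.inj hl]
    exact realize_ne_zero (hk j)

end

/-! ## Greedy bipartite matchings -/

/-- `m` is a matching: `m r = ℓ + 1` means that `r` is matched with `ℓ`, and `m r = 0` means that
`r` is free. -/
structure IsMatching (adj : ℕ → ℕ → Prop) (N : ℕ) (m : ℕ → ℕ) : Prop where
  adj_of_eq : ∀ r < N, ∀ l, m r = l + 1 → adj l r
  inj : ∀ r < N, ∀ r' < N, m r ≠ 0 → m r = m r' → r = r'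

/-- A set of matched vertices on the right, which contains all the neighbours of their partners. -/
def IsClosedSet (adj : ℕ → ℕ → Prop) (N : ℕ) (m : ℕ → ℕ) (D : Finset ℕ) : Prop :=
  ∀ r ∈ D, r < N ∧ ∃ l, m r = l + 1 ∧ ∀ r' < N, adj l r' → r' ∈ D

/-- A certificate that `l` cannot be matched in addition to the matched vertices below `l`. -/
def IsBlocked (adj : ℕ → ℕ → Prop) (N : ℕ) (m : ℕ → ℕ) (l : ℕ) : Prop :=
  ∃ D, IsClosedSet adj N m D ∧ (∀ r ∈ D, m r ≤ l) ∧ ∀ r < N, adj l r → r ∈ D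

/-- The result of the greedy algorithm on the left vertices `0, …, L - 1`. -/
structure IsGreedyMatching (adj : ℕ → ℕ → Prop) (L N : ℕ) (m : ℕ → ℕ) : Prop
    extends IsMatching adj N m where
  le_of_lt : ∀ r < N, m r ≤ L
  matched_or_blocked : ∀ l < L, (∃ r < N, m r = l + 1) ∨ IsBlocked adj N m l

open Classical in
/-- The number of the matched left vertices below `k` is an upper bound for the weight of fractional
matchings. -/
theorem IsGreedyMatching.sum_le_card {adj : ℕ → ℕ → Prop} {L N : ℕ} {m : ℕ → ℕ}
    (hm : IsGreedyMatching adj L N m) {z : ℕ → ℕ → ℝ} (h0 : ∀ l r, 0 ≤ z l r)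
    (hadj : ∀ l r, r < N → z l r ≠ 0 → adj l r)
    (hcol : ∀ r < N, ∑ l ∈ Finset.range L, z l r ≤ 1)
    (hrow : ∀ l < L, ∑ r ∈ Finset.range N, z l r ≤ 1) {k : ℕ} (hk : k ≤ L) :
    ∑ l ∈ Finset.range k, ∑ r ∈ Finset.range N, z l r ≤
      (((Finset.range k).filter fun l => ∃ r < N, m r = l + 1).card : ℝ) := by
  have hD : ∀ l, ∃ D, l < k → (¬ ∃ r < N, m r = l + 1) → IsClosedSet adj N m D ∧
      (∀ r ∈ D, m r ≤ l) ∧ ∀ r < N, adj l r → r ∈ D := by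
    intro l
    by_cases h : l < k ∧ ¬ ∃ r < N, m r = l + 1
    · obtain ⟨D, hD⟩ := (hm.matched_or_blocked l (h.1.trans_le hk)).resolve_left h.2
      exact ⟨D, fun _ _ => hD⟩
    · exact ⟨∅, fun h1 h2 => absurd ⟨h1, h2⟩ h⟩
  choose D hD using hD
  set un := (Finset.range k).filter fun l => ¬ ∃ r < N, m r = l + 1 with hun
  -- A Hall-type obstruction: the unmatched vertices below `k` and the partners of `DD` have all
  -- their neighbours in `DD`, so their total weight is at most `#DD ≤ #mD`. The certificates bound
  -- the labels of their vertices, hence the partners lie below `k` too. Every other vertex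
  -- contributes at most one.
  set DD := un.biUnion D with hDD
  have hDDmem : ∀ r ∈ DD, r < N ∧ ∃ l, m r = l + 1 ∧ l < k ∧ ∀ r' < N, adj l r' → r' ∈ DD := by
    intro r hr
    obtain ⟨l, hl, hrl⟩ := Finset.mem_biUnion.1 hr
    obtain ⟨hlk, hlm⟩ := Finset.mem_filter.1 hl
    have hlk' := Finset.mem_range.1 hlk
    obtain ⟨h1, h2, h3⟩ := hD l hlk' hlm
    obtain ⟨h4, l', h5, h6⟩ := h1 r hrl
    have h7 := h2 r hrl
    exact ⟨h4, l', h5, by omega, fun r' hr' hadj' => Finset.mem_biUnion.2 ⟨l, hl, h6 r' hr' hadj'⟩⟩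
  set mt := (Finset.range k).filter fun l => ∃ r < N, m r = l + 1 with hmt
  set mD := mt.filter fun l => ∃ r ∈ DD, m r = l + 1 with hmD
  have hclosed : ∀ l ∈ un ∪ mD, ∀ r < N, adj l r → r ∈ DD := by
    intro l hl r hr hlr
    rcases Finset.mem_union.1 hl with hl | hl
    · obtain ⟨hlk, hlm⟩ := Finset.mem_filter.1 hl
      exact Finset.mem_biUnion.2 ⟨l, hl, (hD l (Finset.mem_range.1 hlk) hlm).2.2 r hr hlr⟩
    · obtain ⟨-, r', hr', hrl⟩ := Finset.mem_filter.1 hl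
      obtain ⟨-, l', h5, -, h6⟩ := hDDmem r' hr'
      have : l = l' := by omega
      exact h6 r hr (this ▸ hlr)
  have hDDN : DD ⊆ Finset.range N := fun r hr => Finset.mem_range.2 (hDDmem r hr).1
  have hLk : un ∪ mD ⊆ Finset.range L := by
    intro l hl
    have : l < k := by
      rcases Finset.mem_union.1 hl with hl | hl
      · exact Finset.mem_range.1 (Finset.mem_filter.1 hl).1
      · exact Finset.mem_range.1 (Finset.mem_filter.1 (Finset.mem_filter.1 hl).1).1
    exact Finset.mem_range.2 (this.trans_le hk)
  have hcard : DD.card ≤ mD.card := by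
    refine Finset.card_le_card_of_injOn (fun r => m r - 1) ?_ ?_
    · intro r hr
      obtain ⟨h1, l, h2, h3, -⟩ := hDDmem r (Finset.mem_coe.1 hr)
      have : m r - 1 = l := by omega
      simp only [this]
      exact Finset.mem_coe.2 (Finset.mem_filter.2 ⟨Finset.mem_filter.2
        ⟨Finset.mem_range.2 h3, r, h1, h2⟩, r, hr, h2⟩)
    · intro r hr r' hr' heq
      obtain ⟨h1, l, h2, -, -⟩ := hDDmem r (Finset.mem_coe.1 hr)
      obtain ⟨h1', l', h2', -, -⟩ := hDDmem r' (Finset.mem_coe.1 hr')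
      simp only at heq
      exact hm.inj r h1 r' h1' (by omega) (by omega)
  have hsplit : Finset.range k = (un ∪ mD) ∪ (mt \ mD) := by
    ext l
    simp only [hun, hmD, hmt, Finset.mem_union, Finset.mem_filter, Finset.mem_sdiff]
    generalize (∃ r < N, m r = l + 1) = P
    generalize (∃ r ∈ DD, m r = l + 1) = R
    tauto
  have hdisj : Disjoint (un ∪ mD) (mt \ mD) := by
    refine Finset.disjoint_left.2 fun l hl hl' => ?_
    obtain ⟨h1, h2⟩ := Finset.mem_sdiff.1 hl'
    rcases Finset.mem_union.1 hl with hl | hl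
    · exact (Finset.mem_filter.1 hl).2 (Finset.mem_filter.1 h1).2
    · exact h2 hl
  rw [hsplit, Finset.sum_union hdisj]
  have hA : ∑ l ∈ un ∪ mD, ∑ r ∈ Finset.range N, z l r ≤ (mD.card : ℝ) := by
    calc ∑ l ∈ un ∪ mD, ∑ r ∈ Finset.range N, z l r
        = ∑ l ∈ un ∪ mD, ∑ r ∈ DD, z l r := by
          refine Finset.sum_congr rfl fun l hl => (Finset.sum_subset hDDN fun r hr hrD => ?_).symm
          by_contra hne
          have hr' := Finset.mem_range.1 hr
          exact hrD (hclosed l hl r hr' (hadj l r hr' hne))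
      _ = ∑ r ∈ DD, ∑ l ∈ un ∪ mD, z l r := Finset.sum_comm
      _ ≤ ∑ r ∈ DD, 1 := Finset.sum_le_sum fun r hr =>
          (Finset.sum_le_sum_of_subset_of_nonneg hLk fun l _ _ => h0 l r).trans
            (hcol r (hDDmem r hr).1)
      _ = (DD.card : ℝ) := by simp
      _ ≤ mD.card := by exact_mod_cast hcard
  have hB : ∑ l ∈ mt \ mD, ∑ r ∈ Finset.range N, z l r ≤ ((mt \ mD).card : ℝ) := by
    calc _ ≤ ∑ l ∈ mt \ mD, (1 : ℝ) := Finset.sum_le_sum fun l hl => hrow l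
          ((Finset.mem_range.1 (Finset.mem_filter.1 (Finset.mem_sdiff.1 hl).1).1).trans_le hk)
      _ = _ := by simp
  have hC : (mD.card : ℝ) + ((mt \ mD).card : ℝ) = mt.card := by
    have h1 : mD ⊆ mt := Finset.filter_subset _ _
    have h2 := Finset.card_sdiff_add_card_eq_card h1
    rw [← h2]
    push_cast
    ring
  linarith

/-! ## The bipartite graph of the flow network -/

/-- The bipartite graph with the left vertices `xᵢ¹` (index `i`), `xᵢ²` (index `n + i`), `uᵢ` (index
`n + n + i`) and the right vertices `xᵢ¹` (index `i`), `yⱼ` (index `n + j`). -/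
def NetAdj {n p : ℕ} (A : StructMatrix n n) (C : StructMatrix p n) (l r : ℕ) : Prop :=
  (∃ i : Fin n, l = i ∧ r = i) ∨
  (∃ (i : Fin n) (j : Fin p), (l = i ∧ r = n + j) ∧ C j i = true) ∨
  (∃ i j : Fin n, (l = n + i ∧ r = j) ∧ A j i = true) ∨
  ∃ i : Fin n, l = n + n + i ∧ r = i

section

variable {n p : ℕ} {A : StructMatrix n n} {C : StructMatrix p n}

/-- The fractional matching of a flow. -/
noncomputable def flowMatching (g : NetVertex n p → NetVertex n p → ℝ) (l r : ℕ) : ℝ :=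
  (∑ i : Fin n, if l = i ∧ r = i then 1 - g (.inn (.x1 i)) (.out (.x1 i)) else 0) +
  (∑ i : Fin n, ∑ j : Fin p, if l = i ∧ r = n + j then g (.out (.x1 i)) (.inn (.y j)) else 0) +
  (∑ i : Fin n, ∑ j : Fin n, if l = n + i ∧ r = j then g (.out (.x2 i)) (.inn (.x1 j)) else 0) +
  ∑ i : Fin n, if l = n + n + i ∧ r = i then g (.out (.u i)) (.inn (.x1 i)) else 0

theorem sum_flowMatching (g : NetVertex n p → NetVertex n p → ℝ) (l : ℕ) :
    ∑ r ∈ Finset.range (n + p), flowMatching g l r =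
      (∑ i : Fin n, if l = i then 1 - g (.inn (.x1 i)) (.out (.x1 i)) else 0) +
      (∑ i : Fin n, if l = i then ∑ j : Fin p, g (.out (.x1 i)) (.inn (.y j)) else 0) +
      (∑ i : Fin n, if l = n + i then ∑ j : Fin n, g (.out (.x2 i)) (.inn (.x1 j)) else 0) +
      ∑ i : Fin n, if l = n + n + i then g (.out (.u i)) (.inn (.x1 i)) else 0 := by
  have h : ∀ (P : Prop) [Decidable P] (b : ℕ) (c : ℝ), b < n + p →
      ∑ r ∈ Finset.range (n + p), (if P ∧ r = b then c else 0) = if P then c else 0 := by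
    intro P _ b c hb
    by_cases hP : P <;> simp [hP, hb]
  have e1 : ∀ i : Fin n, (i : ℕ) < n + p := fun i => by omega
  have e2 : ∀ j : Fin p, n + (j : ℕ) < n + p := fun i => by omega
  unfold flowMatching
  simp only [Finset.sum_add_distrib]
  rw [Finset.sum_comm, Finset.sum_comm (s := Finset.range (n + p)) (t := (Finset.univ : Finset (Fin n))),
    Finset.sum_comm (s := Finset.range (n + p)) (t := (Finset.univ : Finset (Fin n))),
    Finset.sum_comm (s := Finset.range (n + p)) (t := (Finset.univ : Finset (Fin n)))]
  congr 1
  · congr 1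
    · congr 1
      · exact Finset.sum_congr rfl fun i _ => h _ _ _ (e1 i)
      · refine Finset.sum_congr rfl fun i _ => ?_
        rw [Finset.sum_comm, Finset.sum_congr rfl fun j _ => h _ _ _ (e2 j)]
        by_cases hl : l = i <;> simp [hl]
    · refine Finset.sum_congr rfl fun i _ => ?_
      rw [Finset.sum_comm, Finset.sum_congr rfl fun j _ => h _ _ _ (e1 j)]
      by_cases hl : l = n + i <;> simp [hl]
  · exact Finset.sum_congr rfl fun i _ => h _ _ _ (e1 i)

/-- A left vertex `xᵢ¹` is always saturated: the capacity of the state that the flow leaves unused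
is the weight of the edge that matches `xᵢ¹` with itself. -/
theorem sum_flowMatching_eq {g : NetVertex n p → NetVertex n p → ℝ}
    (hg : (flowNetwork A C).IsFlow g) (i : Fin n) :
    ∑ r ∈ Finset.range (n + p), flowMatching g i r = 1 ∧
    ∑ r ∈ Finset.range (n + p), flowMatching g (n + i) r = g .source (.inn (.x2 i)) ∧
    ∑ r ∈ Finset.range (n + p), flowMatching g (n + n + i) r = g .source (.inn (.u i)) := by
  obtain ⟨h1, h2, h3, h4, h5, -⟩ := hg.balance
  have e1 : ∀ j : Fin n, (i : ℕ) ≠ n + j := fun j => by omega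
  have e2 : ∀ j : Fin n, (i : ℕ) ≠ n + n + j := fun j => by omega
  have e3 : ∀ j : Fin n, n + (i : ℕ) ≠ j := fun j => by omega
  have e4 : ∀ j : Fin n, n + (i : ℕ) ≠ n + n + j := fun j => by omega
  have e5 : ∀ j : Fin n, n + n + (i : ℕ) ≠ j := fun j => by omega
  have e6 : ∀ j : Fin n, n + n + (i : ℕ) ≠ n + j := fun j => by omega
  refine ⟨?_, ?_, ?_⟩
  · rw [sum_flowMatching]
    simp only [e1, e2, if_false, Finset.sum_const_zero, add_zero, Fin.val_inj, Finset.sum_ite_eq,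
      Finset.mem_univ, if_true, ← h5]
    ring
  · rw [sum_flowMatching]
    simp only [e3, e4, if_false, Finset.sum_const_zero, add_zero, zero_add, Nat.add_left_cancel_iff,
      Fin.val_inj, Finset.sum_ite_eq, Finset.mem_univ, if_true]
    rw [h2, h3]
  · rw [sum_flowMatching]
    simp only [e5, e6, if_false, Finset.sum_const_zero, zero_add, Nat.add_left_cancel_iff,
      Fin.val_inj, Finset.sum_ite_eq, Finset.mem_univ, if_true]
    rw [h1]

theorem sum_range_two_mul (f : ℕ → ℝ) :
    ∑ l ∈ Finset.range (n + n), f l = ∑ i : Fin n, f i + ∑ i : Fin n, f (n + i) := by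
  rw [Finset.sum_range_add, Finset.sum_range, Finset.sum_range]

theorem sum_range_three_mul (f : ℕ → ℝ) :
    ∑ l ∈ Finset.range (n + n + n), f l =
      ∑ i : Fin n, f i + ∑ i : Fin n, f (n + i) + ∑ i : Fin n, f (n + n + i) := by
  rw [Finset.sum_range_add, sum_range_two_mul, Finset.sum_range]

theorem flowMatching_col_le {g : NetVertex n p → NetVertex n p → ℝ}
    (hg : (flowNetwork A C).IsFlow g) (r : ℕ) (hr : r < n + p) :
    ∑ l ∈ Finset.range (n + n + n), flowMatching g l r ≤ 1 := by
  obtain ⟨h1, h2, h3, h4, h5, h6, -⟩ := hg.balance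
  have h : ∀ (P : Prop) [Decidable P] (b : ℕ) (c : ℝ), b < n + n + n →
      ∑ l ∈ Finset.range (n + n + n), (if l = b ∧ P then c else 0) = if P then c else 0 := by
    intro P _ b c hb
    by_cases hP : P <;> simp [hP, hb]
  have e1 : ∀ i : Fin n, (i : ℕ) < n + n + n := fun i => by omega
  have e2 : ∀ i : Fin n, n + (i : ℕ) < n + n + n := fun i => by omega
  have e3 : ∀ i : Fin n, n + n + (i : ℕ) < n + n + n := fun i => by omega
  have key : ∑ l ∈ Finset.range (n + n + n), flowMatching g l r =
      (∑ i : Fin n, if r = i then 1 - g (.inn (.x1 i)) (.out (.x1 i)) else 0) +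
      (∑ i : Fin n, ∑ j : Fin p, if r = n + j then g (.out (.x1 i)) (.inn (.y j)) else 0) +
      (∑ i : Fin n, ∑ j : Fin n, if r = j then g (.out (.x2 i)) (.inn (.x1 j)) else 0) +
      ∑ i : Fin n, if r = i then g (.out (.u i)) (.inn (.x1 i)) else 0 := by
    unfold flowMatching
    simp only [Finset.sum_add_distrib]
    rw [Finset.sum_comm, Finset.sum_comm (s := Finset.range (n + n + n))
        (t := (Finset.univ : Finset (Fin n))),
      Finset.sum_comm (s := Finset.range (n + n + n)) (t := (Finset.univ : Finset (Fin n))),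
      Finset.sum_comm (s := Finset.range (n + n + n)) (t := (Finset.univ : Finset (Fin n)))]
    congr 1
    · congr 1
      · congr 1
        · exact Finset.sum_congr rfl fun i _ => h _ _ _ (e1 i)
        · refine Finset.sum_congr rfl fun i _ => ?_
          rw [Finset.sum_comm]
          exact Finset.sum_congr rfl fun j _ => h _ _ _ (e1 i)
      · refine Finset.sum_congr rfl fun i _ => ?_
        rw [Finset.sum_comm]
        exact Finset.sum_congr rfl fun j _ => h _ _ _ (e2 i)
    · exact Finset.sum_congr rfl fun i _ => h _ _ _ (e3 i)
  rw [key]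
  by_cases hrn : r < n
  · obtain ⟨i, rfl⟩ : ∃ i : Fin n, r = i := ⟨⟨r, hrn⟩, rfl⟩
    have e4 : ∀ j : Fin p, (i : ℕ) ≠ n + j := fun j => by omega
    simp only [e4, if_false, Finset.sum_const_zero, add_zero, Fin.val_inj, Finset.sum_ite_eq,
      Finset.mem_univ, if_true]
    rw [← h4]
    linarith
  · obtain ⟨j, rfl⟩ : ∃ j : Fin p, r = n + j := ⟨⟨r - n, by omega⟩, by simp; omega⟩
    have e4 : ∀ i : Fin n, n + (j : ℕ) ≠ i := fun i => by omega
    simp only [e4, if_false, Finset.sum_const_zero, add_zero, zero_add, Nat.add_left_cancel_iff,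
      Fin.val_inj, Finset.sum_ite_eq, Finset.mem_univ, if_true]
    rw [h6]
    exact hg.le_one _ _

theorem flowMatching_nonneg {g : NetVertex n p → NetVertex n p → ℝ}
    (hg : (flowNetwork A C).IsFlow g) (l r : ℕ) : 0 ≤ flowMatching g l r := by
  have h1 := hg.nonneg
  have h2 : ∀ i : Fin n, 0 ≤ 1 - g (.inn (.x1 i)) (.out (.x1 i)) := fun i => by
    linarith [hg.le_one (.inn (.x1 i)) (.out (.x1 i))]
  refine add_nonneg (add_nonneg (add_nonneg ?_ ?_) ?_) ?_
  · refine Finset.sum_nonneg fun i _ => ?_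
    split_ifs
    · exact h2 i
    · exact le_rfl
  · refine Finset.sum_nonneg fun i _ => Finset.sum_nonneg fun j _ => ?_
    split_ifs
    · exact h1 _ _
    · exact le_rfl
  · refine Finset.sum_nonneg fun i _ => Finset.sum_nonneg fun j _ => ?_
    split_ifs
    · exact h1 _ _
    · exact le_rfl
  · refine Finset.sum_nonneg fun i _ => ?_
    split_ifs
    · exact h1 _ _
    · exact le_rfl

theorem flowMatching_adj {g : NetVertex n p → NetVertex n p → ℝ}
    (hg : (flowNetwork A C).IsFlow g) {l r : ℕ} (h : flowMatching g l r ≠ 0) : NetAdj A C l r := by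
  by_contra hno
  unfold NetAdj at hno
  push Not at hno
  obtain ⟨h1, h2, h3, h4⟩ := hno
  apply h
  unfold flowMatching
  have e1 : ∀ (i : Fin n), ¬ (l = i ∧ r = i) := fun i hi => h1 i hi.1 hi.2
  have e4 : ∀ (i : Fin n), ¬ (l = n + n + i ∧ r = i) := fun i hi => h4 i hi.1 hi.2
  simp only [e1, e4, if_false, Finset.sum_const_zero, add_zero, zero_add]
  rw [Finset.sum_eq_zero, Finset.sum_eq_zero, add_zero]
  · refine fun i _ => Finset.sum_eq_zero fun j _ => ?_
    split_ifs with hij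
    · refine hg.eq_zero fun hE => h3 i j hij ?_
      obtain ⟨j', hj', hA⟩ := netEdge_out_x2_iff.1 hE
      have : j = j' := by simpa using hj'
      rw [this, hA]
    · rfl
  · refine fun i _ => Finset.sum_eq_zero fun j _ => ?_
    split_ifs with hij
    · refine hg.eq_zero fun hE => h2 i j hij ?_
      obtain ⟨j', hj', hA⟩ := netEdge_out_x1_iff.1 hE
      have : j = j' := by simpa using hj'
      rw [this, hA]
    · rfl

-- The bound for greedy matchings is used at `k = n`, `2 n` and `3 n`. At `n` it shows that every
-- `xᵢ¹` is matched. Subtracting this at `2 n` compares the number of matched `x²` with the state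
-- value of any flow, and at `3 n` it bounds the total value.
open Classical in
theorem IsGreedyMatching.flow_le_card {m : ℕ → ℕ}
    (hm : IsGreedyMatching (NetAdj A C) (n + n + n) (n + p) m)
    {g : NetVertex n p → NetVertex n p → ℝ} (hg : (flowNetwork A C).IsFlow g) :
    (∀ l < n, ∃ r < n + p, m r = l + 1) ∧
    stateValue g ≤ ((Finset.univ.filter fun i : Fin n => ∃ r < n + p, m r = n + i + 1).card : ℝ) ∧
    (n : ℝ) + (flowNetwork A C).flowValue g ≤
      (((Finset.range (n + p)).filter fun r => m r ≠ 0).card : ℝ) := by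
  have hrow : ∀ l < n + n + n, ∑ r ∈ Finset.range (n + p), flowMatching g l r ≤ 1 := by
    intro l hl
    by_cases h1 : l < n
    · exact (sum_flowMatching_eq hg ⟨l, h1⟩).1.le
    by_cases h2 : l < n + n
    · have := (sum_flowMatching_eq hg ⟨l - n, by omega⟩).2.1
      simp only [show n + (l - n) = l by omega] at this
      rw [this]
      exact hg.le_one _ _
    · have := (sum_flowMatching_eq hg ⟨l - (n + n), by omega⟩).2.2
      simp only [show n + n + (l - (n + n)) = l by omega] at this
      rw [this]
      exact hg.le_one _ _
  have key := fun k (hk : k ≤ n + n + n) => hm.sum_le_card (flowMatching_nonneg hg)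
    (fun l r _ h => flowMatching_adj hg h) (flowMatching_col_le hg) hrow hk
  have hx1 : ∀ l < n, ∃ r < n + p, m r = l + 1 := by
    have h1 := key n (by omega)
    rw [Finset.sum_range, Finset.sum_congr rfl fun i _ => (sum_flowMatching_eq hg i).1] at h1
    simp only [Finset.sum_const, Finset.card_univ, Fintype.card_fin, nsmul_eq_mul, mul_one] at h1
    have h2 : n ≤ ((Finset.range n).filter fun l => ∃ r < n + p, m r = l + 1).card := by
      exact_mod_cast h1
    have h3 := Finset.eq_of_subset_of_card_le (Finset.filter_subset
      (fun l => ∃ r < n + p, m r = l + 1) (Finset.range n)) (by simpa using h2)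
    intro l hl
    have h4 : l ∈ Finset.range n := Finset.mem_range.2 hl
    rw [← h3] at h4
    exact (Finset.mem_filter.1 h4).2
  refine ⟨hx1, ?_, ?_⟩
  · have h1 := key (n + n) (by omega)
    rw [← Finset.sum_boole, sum_range_two_mul, sum_range_two_mul,
      Finset.sum_congr rfl fun i _ => (sum_flowMatching_eq hg i).1,
      Finset.sum_congr rfl fun i _ => (sum_flowMatching_eq hg i).2.1] at h1
    rw [Finset.sum_congr rfl fun (i : Fin n) _ => if_pos (hx1 i i.2), Finset.sum_boole] at h1
    unfold stateValue
    linarith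
  · have h1 := key (n + n + n) le_rfl
    rw [sum_range_three_mul,
      Finset.sum_congr rfl fun i _ => (sum_flowMatching_eq hg i).1,
      Finset.sum_congr rfl fun i _ => (sum_flowMatching_eq hg i).2.1,
      Finset.sum_congr rfl fun i _ => (sum_flowMatching_eq hg i).2.2] at h1
    obtain ⟨-, -, -, -, -, -, h7, -⟩ := hg.balance
    have h2 : ((Finset.range (n + n + n)).filter fun l => ∃ r < n + p, m r = l + 1).card ≤
        ((Finset.range (n + p)).filter fun r => m r ≠ 0).card := by
      have hch : ∀ l, ∃ r, (∃ r < n + p, m r = l + 1) → r < n + p ∧ m r = l + 1 := fun l => by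
        by_cases h : ∃ r < n + p, m r = l + 1
        · obtain ⟨r, hr⟩ := h
          exact ⟨r, fun _ => hr⟩
        · exact ⟨0, fun h' => absurd h' h⟩
      choose F hF using hch
      refine Finset.card_le_card_of_injOn F ?_ ?_
      · intro l hl
        obtain ⟨h3, h4⟩ := hF l (Finset.mem_filter.1 (Finset.mem_coe.1 hl)).2
        exact Finset.mem_coe.2 (Finset.mem_filter.2 ⟨Finset.mem_range.2 h3, by omega⟩)
      · intro l hl l' hl' heq
        have h3 := (hF l (Finset.mem_filter.1 (Finset.mem_coe.1 hl)).2).2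
        have h4 := (hF l' (Finset.mem_filter.1 (Finset.mem_coe.1 hl')).2).2
        rw [heq] at h3
        omega
    have h3 : (((Finset.range (n + n + n)).filter fun l => ∃ r < n + p, m r = l + 1).card : ℝ) ≤
        (((Finset.range (n + p)).filter fun r => m r ≠ 0).card : ℝ) := by exact_mod_cast h2
    simp only [Finset.sum_const, Finset.card_univ, Fintype.card_fin, nsmul_eq_mul, mul_one] at h1
    unfold stateValue at h7
    linarith

/-- The linking of a greedy matching. -/
theorem IsGreedyMatching.exists_linking {m : ℕ → ℕ}
    (hm : IsGreedyMatching (NetAdj A C) (n + n + n) (n + p) m) (hp : 0 < p)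
    (hC : structRank C = p) :
    ∃ K : Linking A C p, (∀ i, i ∈ inputStates K.flow ↔ m i = n + n + i + 1) ∧
      (∀ i, i ∈ linkedStates K.flow ↔ ∃ r < n, m r = n + i + 1) ∧
      ∀ g, (flowNetwork A C).IsFlow g → stateValue g ≤ stateValue K.flow := by
  classical
  obtain ⟨K₀, -⟩ := exists_linking_of_structRank C A
  obtain ⟨hx1, -, hN⟩ := hm.flow_le_card K₀.isFlow
  rw [K₀.flowValue_flow, hC] at hN
  -- Since there is a flow of value `p`, all `n + p` right vertices are matched.
  have hall : ∀ r < n + p, m r ≠ 0 := by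
    have h1 : n + p ≤ ((Finset.range (n + p)).filter fun r => m r ≠ 0).card := by exact_mod_cast hN
    have h2 := Finset.eq_of_subset_of_card_le (Finset.filter_subset (fun r => m r ≠ 0)
      (Finset.range (n + p))) (by simpa using h1)
    intro r hr
    have h3 := Finset.mem_range.2 hr
    rw [← h2] at h3
    exact (Finset.mem_filter.1 h3).2
  have hadj : ∀ r < n + p, NetAdj A C (m r - 1) r := fun r hr =>
    hm.adj_of_eq r hr _ (by have := hall r hr; omega)
  have hy : ∀ j : Fin p, ∃ i : Fin n, m (n + j) = i + 1 ∧ C j i = true := by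
    intro j
    have h0 := hall (n + j) (by omega)
    rcases hadj (n + j) (by omega) with ⟨i, h1, h2⟩ | ⟨i, j', ⟨h1, h2⟩, h3⟩ |
      ⟨i, j', ⟨h1, h2⟩, h3⟩ | ⟨i, h1, h2⟩
    · omega
    · have : j = j' := Fin.ext (by omega)
      exact ⟨i, by omega, this ▸ h3⟩
    · omega
    · omega
  choose via hvia hviaC using hy
  -- The left `xᵢ¹` of a state on a path is already matched with an output, so the right `xᵢ¹` is
  -- matched with an `x²` or with `uᵢ`, never with itself.
  have hx : ∀ i : Fin n, (∃ j, via j = i) → ∃ s : Option (Fin n),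
      (s = none ↔ m i = n + n + i + 1) ∧ ∀ k, s = some k ↔ m i = n + k + 1 ∧ A i k = true := by
    rintro i ⟨j, rfl⟩
    have h0 := hall (via j) (by omega)
    have hne : m (via j) ≠ via j + 1 := by
      intro heq
      have := hm.inj (via j) (by omega) (n + j) (by omega) h0 (by rw [heq, hvia])
      omega
    rcases hadj (via j) (by omega) with ⟨i, h1, h2⟩ | ⟨i, j', ⟨h1, h2⟩, h3⟩ |
      ⟨i, j', ⟨h1, h2⟩, h3⟩ | ⟨i, h1, h2⟩
    · omega
    · omega
    · have h4 : via j = j' := Fin.ext h2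
      refine ⟨some i, ⟨by simp, fun h => by omega⟩, fun k => ⟨fun h => ?_, fun h => ?_⟩⟩
      · rw [← Option.some.inj h]
        exact ⟨by omega, h4 ▸ h3⟩
      · exact congrArg some (Fin.ext (by omega))
    · exact ⟨none, ⟨fun _ => by omega, fun _ => rfl⟩, fun k => ⟨by simp, fun h => by omega⟩⟩
  choose! s hs1 hs2 using hx
  have hviainj : Function.Injective via := by
    intro j j' hjj
    have := hm.inj (n + j) (by omega) (n + j') (by omega) (hall _ (by omega))
      (by rw [hvia, hvia, hjj])
    exact Fin.ext (by omega)
  -- the state vertices that are not on a path are matched with themselves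
  have hback : ∀ i : Fin n, m i ≠ i + 1 → ∃ j, via j = i := by
    intro i hi
    obtain ⟨r, hr, hri⟩ := hx1 i i.2
    have h0 := hadj r hr
    rcases h0 with ⟨i', h1, h2⟩ | ⟨i', j', ⟨h1, h2⟩, h3⟩ | ⟨i', j', ⟨h1, h2⟩, h3⟩ | ⟨i', h1, h2⟩
    · have : r = i := by omega
      exact absurd (this ▸ hri) hi
    · refine ⟨j', Fin.ext ?_⟩
      have h5 := hvia j'
      rw [← h2] at h5
      omega
    · omega
    · omega
  have hin : ∀ i : Fin n, (∃ j, s (via j) = none ∧ via j = i) ↔ m i = n + n + i + 1 := by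
    intro i
    constructor
    · rintro ⟨j, h1, rfl⟩
      exact (hs1 _ ⟨j, rfl⟩).1 h1
    · intro h
      obtain ⟨j, rfl⟩ := hback i (by omega)
      exact ⟨j, (hs1 _ ⟨j, rfl⟩).2 h, rfl⟩
  have hlink : ∀ k : Fin n, (∃ j, s (via j) = some k) ↔ ∃ r < n + p, m r = n + k + 1 := by
    intro k
    constructor
    · rintro ⟨j, h1⟩
      exact ⟨via j, by omega, ((hs2 _ ⟨j, rfl⟩ k).1 h1).1⟩
    · rintro ⟨r, hr, hrk⟩
      rcases hadj r hr with ⟨i', h1, h2⟩ | ⟨i', j', ⟨h1, h2⟩, h3⟩ | ⟨i', j', ⟨h1, h2⟩, h3⟩ |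
        ⟨i', h1, h2⟩
      · omega
      · omega
      · subst h2
        have h4 : k = i' := Fin.ext (by omega)
        obtain ⟨j, rfl⟩ := hback j' (by omega)
        exact ⟨j, (hs2 _ ⟨j, rfl⟩ k).2 ⟨hrk, h4 ▸ h3⟩⟩
      · omega
  have hlink' : ∀ k : Fin n, (∃ r < n + p, m r = n + k + 1) → ∃ r < n, m r = n + k + 1 := by
    rintro k hr
    obtain ⟨j, hj⟩ := (hlink k).2 hr
    exact ⟨via j, by omega, ((hs2 _ ⟨j, rfl⟩ k).1 hj).1⟩
  let K : Linking A C p :=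
    { src := fun j => s (via j)
      via := via
      dst := id
      src_inj := by
        intro i j k hi hj
        have h1 := ((hs2 _ ⟨i, rfl⟩ k).1 hi).1
        have h2 := ((hs2 _ ⟨j, rfl⟩ k).1 hj).1
        exact hviainj (Fin.ext (hm.inj (via i) (by omega) (via j) (by omega) (by omega) (by omega)))
      via_inj := hviainj
      dst_inj := Function.injective_id
      src_via := fun j k h => ((hs2 _ ⟨j, rfl⟩ k).1 h).2
      via_dst := hviaC }
  refine ⟨K, fun i => ?_, fun k => ?_, fun g hg => ?_⟩
  · rw [inputStates, Finset.mem_filter, K.flow_u_ne_zero_iff, ← hin i]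
    simp only [Finset.mem_univ, true_and]
    exact Iff.rfl
  · change K.flow _ _ ≠ 0 ↔ _
    rw [K.flow_x2_ne_zero_iff]
    exact (hlink k).trans ⟨hlink' k, fun ⟨r, hr, h⟩ => ⟨r, by omega, h⟩⟩
  · refine (hm.flow_le_card hg).2.1.trans ?_
    rw [K.stateValue_flow]
    have hch : ∀ k : Fin n, ∃ j, (∃ r < n + p, m r = n + k + 1) → s (via j) = some k := fun k => by
      by_cases h : ∃ r < n + p, m r = n + k + 1
      · obtain ⟨j, hj⟩ := (hlink k).2 h
        exact ⟨j, fun _ => hj⟩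
      · exact ⟨⟨0, hp⟩, fun h' => absurd h' h⟩
    choose F hF using hch
    have : (Finset.univ.filter fun i : Fin n => ∃ r < n + p, m r = n + i + 1).card ≤
        (Finset.univ.filter fun j => K.src j ≠ none).card := by
      refine Finset.card_le_card_of_injOn F ?_ ?_
      · intro k hk
        have h1 := hF k (Finset.mem_filter.1 (Finset.mem_coe.1 hk)).2
        refine Finset.mem_coe.2 (Finset.mem_filter.2 ⟨Finset.mem_univ _, ?_⟩)
        change s (via (F k)) ≠ none
        rw [h1]
        simp
      · intro k hk k' hk' heq
        have h1 := hF k (Finset.mem_filter.1 (Finset.mem_coe.1 hk)).2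
        have h2 := hF k' (Finset.mem_filter.1 (Finset.mem_coe.1 hk')).2
        rw [heq, h2] at h1
        exact (Option.some.inj h1).symm
    exact_mod_cast this

end

/-! ## The search for an augmenting path -/

/-- The state of the breadth-first search from `src`. The queue has the left vertices `QL k`, `k < t`,
where `QL k` is the partner of `QR k` for `0 < k`; the right vertex `r` was found from
`QL (par r)`. The first `h` left vertices are processed, and `QL h` is processed up to `r₀`. -/
structure BfsInv (adj : ℕ → ℕ → Prop) (N : ℕ) (m : ℕ → ℕ) (src : ℕ) (vis par QL QR : ℕ → ℕ)
    (h t fd fr r₀ : ℕ) : Prop where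
  tail_pos : 1 ≤ t
  head_le : h ≤ t
  queue_zero : QL 0 = src
  queue : ∀ k, 1 ≤ k → k < t → QR k < N ∧ vis (QR k) ≠ 0 ∧ m (QR k) = QL k + 1 ∧ par (QR k) < k
  queue_inj : ∀ k k', 1 ≤ k → k < t → 1 ≤ k' → k' < t → QR k = QR k' → k = k'
  parent : ∀ r < N, vis r ≠ 0 → par r < t ∧ adj (QL (par r)) r
  queued : ∀ r < N, vis r ≠ 0 → m r ≠ 0 → ∃ k, 1 ≤ k ∧ k < t ∧ QR k = r
  found : fd ≠ 0 → fr < N ∧ vis fr ≠ 0 ∧ m fr = 0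
  not_found : fd = 0 → ∀ r < N, vis r ≠ 0 → m r ≠ 0
  processed : ∀ k < h, ∀ r < N, adj (QL k) r → vis r ≠ 0
  processing : ∀ r < r₀, adj (QL h) r → vis r ≠ 0

namespace BfsInv

variable {adj : ℕ → ℕ → Prop} {N : ℕ} {m : ℕ → ℕ} {src : ℕ} {vis par QL QR : ℕ → ℕ}
  {h t fd fr r₀ : ℕ}

theorem init {vis par QL QR : ℕ → ℕ} (fr : ℕ) (hv : ∀ r < N, vis r = 0) (hQ : QL 0 = src) :
    BfsInv adj N m src vis par QL QR 0 1 0 fr 0 where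
  tail_pos := le_rfl
  head_le := by omega
  queue_zero := hQ
  queue := fun k h1 h2 => by omega
  queue_inj := fun k k' h1 h2 => by omega
  parent := fun r hr h => absurd (hv r hr) h
  queued := fun r hr h => absurd (hv r hr) h
  found := fun h => absurd rfl h
  not_found := fun _ r hr h => absurd (hv r hr) h
  processed := fun k hk => by omega
  processing := fun r hr => by omega

/-- Behind the source the queue consists of partners of distinct right vertices. This bounds the
number of passes of the search. -/
theorem tail_le (H : BfsInv adj N m src vis par QL QR h t fd fr r₀) : t ≤ N + 1 := by
  have : (Finset.Ico 1 t).card ≤ (Finset.range N).card := by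
    refine Finset.card_le_card_of_injOn QR ?_ ?_
    · intro k hk
      obtain ⟨h1, h2⟩ := Finset.mem_Ico.1 (Finset.mem_coe.1 hk)
      exact Finset.mem_coe.2 (Finset.mem_range.2 (H.queue k h1 h2).1)
    · intro k hk k' hk' heq
      obtain ⟨h1, h2⟩ := Finset.mem_Ico.1 (Finset.mem_coe.1 hk)
      obtain ⟨h3, h4⟩ := Finset.mem_Ico.1 (Finset.mem_coe.1 hk')
      exact H.queue_inj k k' h1 h2 h3 h4 heq
  rw [Nat.card_Ico, Finset.card_range] at this
  omega

theorem skip (H : BfsInv adj N m src vis par QL QR h t fd fr r₀)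
    (hskip : adj (QL h) r₀ → vis r₀ ≠ 0) :
    BfsInv adj N m src vis par QL QR h t fd fr (r₀ + 1) :=
  { H with
    processing := fun r hr hadj => by
      rcases Nat.lt_succ_iff_lt_or_eq.1 hr with h1 | rfl
      · exact H.processing r h1 hadj
      · exact hskip hadj }

theorem visit_free (H : BfsInv adj N m src vis par QL QR h t fd fr r₀) (hht : h < t) (hr : r₀ < N)
    (hadj : adj (QL h) r₀) (hvis : vis r₀ = 0) (hm : m r₀ = 0) :
    BfsInv adj N m src (Function.update vis r₀ 1) (Function.update par r₀ h) QL QR h t 1 r₀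
      (r₀ + 1) where
  tail_pos := H.tail_pos
  head_le := H.head_le
  queue_zero := H.queue_zero
  queue := fun k h1 h2 => by
    obtain ⟨a, b, c, d⟩ := H.queue k h1 h2
    have hne : QR k ≠ r₀ := fun he => by rw [he] at b; exact b hvis
    rw [Function.update_of_ne hne, Function.update_of_ne hne]
    exact ⟨a, b, c, d⟩
  queue_inj := H.queue_inj
  parent := fun r hr' hv => by
    by_cases he : r = r₀
    · subst he
      rw [Function.update_self]
      exact ⟨hht, hadj⟩
    · rw [Function.update_of_ne he] at hv ⊢
      exact H.parent r hr' hv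
  queued := fun r hr' hv hmr => by
    by_cases he : r = r₀
    · exact absurd (he ▸ hm) hmr
    · rw [Function.update_of_ne he] at hv
      exact H.queued r hr' hv hmr
  found := fun _ => ⟨hr, by simp, hm⟩
  not_found := fun h0 => absurd h0 one_ne_zero
  processed := fun k hk r hr' hadj' => by
    by_cases he : r = r₀
    · subst he; simp
    · rw [Function.update_of_ne he]
      exact H.processed k hk r hr' hadj'
  processing := fun r hr' hadj' => by
    by_cases he : r = r₀
    · subst he; simp
    · rw [Function.update_of_ne he]
      exact H.processing r (by omega) hadj'

theorem visit_matched (H : BfsInv adj N m src vis par QL QR h t fd fr r₀) (hht : h < t) (hr : r₀ < N)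
    (hadj : adj (QL h) r₀) (hvis : vis r₀ = 0) (hm : m r₀ ≠ 0) :
    BfsInv adj N m src (Function.update vis r₀ 1) (Function.update par r₀ h)
      (Function.update QL t (m r₀ - 1)) (Function.update QR t r₀) h (t + 1) fd fr (r₀ + 1) where
  tail_pos := by omega
  head_le := by omega
  queue_zero := by
    rw [Function.update_of_ne (by have := H.tail_pos; omega)]
    exact H.queue_zero
  queue := fun k h1 h2 => by
    by_cases hk : k = t
    · subst hk
      simp only [Function.update_self]
      exact ⟨hr, one_ne_zero, by omega, hht⟩
    · obtain ⟨a, b, c, d⟩ := H.queue k h1 (by omega)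
      have hne : QR k ≠ r₀ := fun he => by rw [he] at b; exact b hvis
      rw [Function.update_of_ne hk, Function.update_of_ne hk, Function.update_of_ne hne,
        Function.update_of_ne hne]
      exact ⟨a, b, c, d⟩
  queue_inj := fun k k' h1 h2 h3 h4 heq => by
    have hq : ∀ k, 1 ≤ k → k < t → QR k ≠ r₀ := fun k h1 h2 he => by
      have := (H.queue k h1 h2).2.1
      rw [he] at this
      exact this hvis
    by_cases hk : k = t <;> by_cases hk' : k' = t
    · omega
    · rw [hk, Function.update_self, Function.update_of_ne hk'] at heq
      exact absurd heq.symm (hq k' h3 (by omega))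
    · rw [hk', Function.update_self, Function.update_of_ne hk] at heq
      exact absurd heq (hq k h1 (by omega))
    · rw [Function.update_of_ne hk, Function.update_of_ne hk'] at heq
      exact H.queue_inj k k' h1 (by omega) h3 (by omega) heq
  parent := fun r hr' hv => by
    by_cases he : r = r₀
    · subst he
      rw [Function.update_self, Function.update_of_ne hht.ne]
      exact ⟨by omega, hadj⟩
    · rw [Function.update_of_ne he] at hv ⊢
      obtain ⟨h1, h2⟩ := H.parent r hr' hv
      rw [Function.update_of_ne h1.ne]
      exact ⟨by omega, h2⟩
  queued := fun r hr' hv hmr => by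
    by_cases he : r = r₀
    · exact ⟨t, H.tail_pos, by omega, by rw [Function.update_self, he]⟩
    · rw [Function.update_of_ne he] at hv
      obtain ⟨k, h1, h2, h3⟩ := H.queued r hr' hv hmr
      exact ⟨k, h1, by omega, by rwa [Function.update_of_ne h2.ne]⟩
  found := fun h0 => by
    obtain ⟨h1, h2, h3⟩ := H.found h0
    have hne : fr ≠ r₀ := by
      rintro rfl
      exact hm h3
    refine ⟨h1, ?_, h3⟩
    rw [Function.update_of_ne hne]
    exact h2
  not_found := fun h0 r hr' hv => by
    by_cases he : r = r₀
    · exact he ▸ hm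
    · rw [Function.update_of_ne he] at hv
      exact H.not_found h0 r hr' hv
  processed := fun k hk r hr' hadj' => by
    rw [Function.update_of_ne (by omega)] at hadj'
    by_cases he : r = r₀
    · subst he; simp
    · rw [Function.update_of_ne he]
      exact H.processed k hk r hr' hadj'
  processing := fun r hr' hadj' => by
    rw [Function.update_of_ne hht.ne] at hadj'
    by_cases he : r = r₀
    · subst he; simp
    · rw [Function.update_of_ne he]
      exact H.processing r (by omega) hadj'

theorem next (H : BfsInv adj N m src vis par QL QR h t fd fr N) (hht : h < t) :
    BfsInv adj N m src vis par QL QR (h + 1) t fd fr 0 :=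
  { H with
    head_le := hht
    processed := fun k hk r hr hadj => by
      rcases Nat.lt_succ_iff_lt_or_eq.1 hk with h1 | rfl
      · exact H.processed k h1 r hr hadj
      · exact H.processing r hr hadj
    processing := fun r hr => by omega }

/-- When the queue runs empty without meeting a free vertex, the visited right vertices form the
closed set that blocks `src`. -/
theorem greedy_of_not_found (H : BfsInv adj N m src vis par QL QR h t 0 fr 0) (hht : ¬ h < t)
    (hm : IsGreedyMatching adj src N m) : IsGreedyMatching adj (src + 1) N m where
  adj_of_eq := hm.adj_of_eq
  inj := hm.inj
  le_of_lt := fun r hr => (hm.le_of_lt r hr).trans (Nat.le_succ _)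
  matched_or_blocked := fun l hl => by
    classical
    rcases Nat.lt_succ_iff_lt_or_eq.1 hl with h1 | rfl
    · exact hm.matched_or_blocked l h1
    right
    have ht : h = t := le_antisymm H.head_le (not_lt.1 hht)
    refine ⟨(Finset.range N).filter fun r => vis r ≠ 0, fun r hr => ?_, fun r hr => ?_,
      fun r hr hadj => ?_⟩
    · obtain ⟨h1, h2⟩ := Finset.mem_filter.1 hr
      have hrN := Finset.mem_range.1 h1
      obtain ⟨k, h3, h4, h5⟩ := H.queued r hrN h2 (H.not_found rfl r hrN h2)
      refine ⟨hrN, QL k, ?_, fun r' hr' hadj => ?_⟩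
      · rw [← h5]
        exact (H.queue k h3 h4).2.2.1
      · exact Finset.mem_filter.2 ⟨Finset.mem_range.2 hr', H.processed k (by omega) r' hr' hadj⟩
    · exact hm.le_of_lt r (Finset.mem_range.1 (Finset.mem_filter.1 hr).1)
    · refine Finset.mem_filter.2 ⟨Finset.mem_range.2 hr, H.processed 0 ?_ r hr ?_⟩
      · have := H.tail_pos
        omega
      · rwa [H.queue_zero]

end BfsInv

/-- The state of the augmentation: `m'` is a matching with the exception of the vertex `r`, which is
to be matched with `QL h`. -/
structure AugInv (adj : ℕ → ℕ → Prop) (N : ℕ) (m : ℕ → ℕ) (vis par QR : ℕ → ℕ)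
    (t : ℕ) (m' : ℕ → ℕ) (r h : ℕ) : Prop where
  lt : r < N
  visited : vis r ≠ 0
  eq_par : h = par r
  lt_tail : h < t
  unchanged : ∀ k, 1 ≤ k → k ≤ h → m' (QR k) = m (QR k)
  adj_of_eq : ∀ x < N, x ≠ r → ∀ l, m' x = l + 1 → adj l x
  inj : ∀ x < N, ∀ y < N, x ≠ r → y ≠ r → m' x ≠ 0 → m' x = m' y → x = y
  matched : ∀ l, (∃ x < N, x ≠ r ∧ m' x = l + 1) ↔ ∃ x < N, m x = l + 1
  closed : ∀ D, IsClosedSet adj N m D → r ∉ D ∧ ∀ x ∈ D, m' x = m x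

namespace AugInv

variable {adj : ℕ → ℕ → Prop} {N : ℕ} {m : ℕ → ℕ} {src : ℕ} {vis par QL QR : ℕ → ℕ}
  {h t fd fr r₀ : ℕ}

theorem init (H : BfsInv adj N m src vis par QL QR h t fd fr r₀) (hfd : fd ≠ 0)
    (hm : IsMatching adj N m) : AugInv adj N m vis par QR t m fr (par fr) where
  lt := (H.found hfd).1
  visited := (H.found hfd).2.1
  eq_par := rfl
  lt_tail := (H.parent _ (H.found hfd).1 (H.found hfd).2.1).1
  unchanged := fun _ _ _ => rfl
  adj_of_eq := fun x hx _ l hl => hm.adj_of_eq x hx l hl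
  inj := fun x hx y hy _ _ => hm.inj x hx y hy
  matched := fun l => by
    constructor
    · rintro ⟨x, hx, -, hl⟩
      exact ⟨x, hx, hl⟩
    · rintro ⟨x, hx, hl⟩
      refine ⟨x, hx, ?_, hl⟩
      rintro rfl
      have := (H.found hfd).2.2
      omega
  closed := fun D hD => ⟨fun hr => by
    obtain ⟨-, l, h1, -⟩ := hD _ hr
    have := (H.found hfd).2.2
    omega, fun _ _ => rfl⟩

variable {m' : ℕ → ℕ} {r h' : ℕ}

/-- The exceptional vertex moves from `r` back to `QR h'`, whose partner takes over `r`; queue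
indices decrease along parents, so this ends at the source. If `QR h'` were in a closed set, then so
would be the neighbour `r` of its partner. Hence the path never enters a closed set. -/
theorem step (G : AugInv adj N m vis par QR t m' r h')
    (H : BfsInv adj N m src vis par QL QR h t fd fr r₀) (h0 : 0 < h') :
    AugInv adj N m vis par QR t (Function.update m' r (m' (QR h'))) (QR h') (par (QR h')) ∧
      par (QR h') < h' := by
  obtain ⟨q1, q2, q3, q4⟩ := H.queue h' h0 G.lt_tail
  have hne : QR h' ≠ r := by
    intro he
    rw [he, ← G.eq_par] at q4
    exact lt_irrefl _ q4
  have hm' : m' (QR h') = QL h' + 1 := by rw [G.unchanged h' h0 le_rfl, q3]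
  have hadj : adj (QL h') r := by
    have := (H.parent r G.lt G.visited).2
    rwa [← G.eq_par] at this
  refine ⟨⟨q1, q2, rfl, (H.parent _ q1 q2).1, ?_, ?_, ?_, ?_, ?_⟩, q4⟩
  · intro k h1 h2
    have : QR k ≠ r := by
      intro he
      have := (H.queue k h1 (by have := G.lt_tail; omega)).2.2.2
      rw [he, ← G.eq_par] at this
      omega
    rw [Function.update_of_ne this]
    exact G.unchanged k h1 (by omega)
  · intro x hx hxr l hl
    by_cases hxe : x = r
    · rw [hxe, Function.update_self, hm'] at hl
      rw [hxe, ← Nat.succ_injective hl]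
      exact hadj
    · rw [Function.update_of_ne hxe] at hl
      exact G.adj_of_eq x hx hxe l hl
  · intro x hx y hy hxr hyr hx0 hxy
    by_cases hxe : x = r <;> by_cases hye : y = r
    · rw [hxe, hye]
    · rw [hxe, Function.update_self, Function.update_of_ne hye] at hxy
      exact absurd (G.inj _ q1 y hy hne hye (by omega) hxy).symm hyr
    · rw [hye, Function.update_self, Function.update_of_ne hxe] at hxy
      exact absurd (G.inj _ q1 x hx hne hxe (by omega) hxy.symm).symm hxr
    · rw [Function.update_of_ne hxe] at hx0 hxy
      rw [Function.update_of_ne hye] at hxy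
      exact G.inj x hx y hy hxe hye hx0 hxy
  · intro l
    rw [← G.matched l]
    constructor
    · rintro ⟨x, hx, hxr, hl⟩
      by_cases hxe : x = r
      · rw [hxe, Function.update_self] at hl
        exact ⟨QR h', q1, hne, hl⟩
      · rw [Function.update_of_ne hxe] at hl
        exact ⟨x, hx, hxe, hl⟩
    · rintro ⟨x, hx, hxr, hl⟩
      by_cases hxe : x = QR h'
      · exact ⟨r, G.lt, hne.symm, by rw [Function.update_self, ← hxe, hl]⟩
      · exact ⟨x, hx, hxe, by rw [Function.update_of_ne hxr, hl]⟩
  · intro D hD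
    obtain ⟨c1, c2⟩ := G.closed D hD
    refine ⟨fun hq => ?_, fun x hx => ?_⟩
    · obtain ⟨-, l, h1, h2⟩ := hD _ hq
      rw [q3] at h1
      exact c1 (h2 r G.lt (Nat.succ_injective h1 ▸ hadj))
    · have : x ≠ r := fun he => c1 (he ▸ hx)
      rw [Function.update_of_ne this]
      exact c2 x hx

/-- The last exceptional vertex is adjacent to the source. Earlier left vertices remain matched, and
earlier blocking certificates remain valid because the matching is unchanged on closed sets. -/
theorem greedy (G : AugInv adj N m vis par QR t m' r 0)
    (H : BfsInv adj N m src vis par QL QR h t fd fr r₀) (hm : IsGreedyMatching adj src N m) :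
    IsGreedyMatching adj (src + 1) N (Function.update m' r (src + 1)) := by
  have hadj : adj src r := by
    have := (H.parent r G.lt G.visited).2
    rwa [← G.eq_par, H.queue_zero] at this
  have hsrc : ∀ x < N, x ≠ r → m' x ≤ src := by
    intro x hx hxr
    by_contra hlt
    obtain ⟨y, hy, hym⟩ := (G.matched (m' x - 1)).1 ⟨x, hx, hxr, by omega⟩
    have := hm.le_of_lt y hy
    omega
  refine ⟨⟨?_, ?_⟩, ?_, ?_⟩
  · intro x hx l hl
    by_cases hxe : x = r
    · rw [hxe, Function.update_self] at hl
      rw [hxe, ← Nat.succ_injective hl]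
      exact hadj
    · rw [Function.update_of_ne hxe] at hl
      exact G.adj_of_eq x hx hxe l hl
  · intro x hx y hy hx0 hxy
    by_cases hxe : x = r <;> by_cases hye : y = r
    · rw [hxe, hye]
    · rw [hxe, Function.update_self, Function.update_of_ne hye] at hxy
      have := hsrc y hy hye
      omega
    · rw [hye, Function.update_self, Function.update_of_ne hxe] at hxy
      have := hsrc x hx hxe
      omega
    · rw [Function.update_of_ne hxe] at hx0 hxy
      rw [Function.update_of_ne hye] at hxy
      exact G.inj x hx y hy hxe hye hx0 hxy
  · intro x hx
    by_cases hxe : x = r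
    · rw [hxe, Function.update_self]
    · rw [Function.update_of_ne hxe]
      exact (hsrc x hx hxe).trans (Nat.le_succ _)
  · intro l hl
    rcases Nat.lt_succ_iff_lt_or_eq.1 hl with h1 | rfl
    · rcases hm.matched_or_blocked l h1 with h2 | ⟨D, hD, hDl, hDadj⟩
      · obtain ⟨x, hx, hxr, hl⟩ := (G.matched l).2 h2
        exact Or.inl ⟨x, hx, by rw [Function.update_of_ne hxr, hl]⟩
      · obtain ⟨c1, c2⟩ := G.closed D hD
        have heq : ∀ x ∈ D, Function.update m' r (src + 1) x = m x := fun x hx => by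
          have : x ≠ r := fun he => c1 (he ▸ hx)
          rw [Function.update_of_ne this]
          exact c2 x hx
        refine Or.inr ⟨D, fun x hx => ?_, fun x hx => ?_, hDadj⟩
        · rw [heq x hx]
          exact hD x hx
        · rw [heq x hx]
          exact hDl x hx
    · exact Or.inl ⟨r, G.lt, by rw [Function.update_self]⟩

end AugInv

/-! ## Reasoning about programs -/

section mem

variable (s : Mem)

@[simp] theorem Mem.setReg_reg (r v r' : ℕ) :
    (s.setReg r v).reg r' = if r' = r then v else s.reg r' := by
  simp [Mem.setReg, Function.update_apply]

@[simp] theorem Mem.setReg_arr (r v : ℕ) : (s.setReg r v).arr = s.arr := rfl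

@[simp] theorem Mem.setArr_reg (a i j v : ℕ) : (s.setArr a i j v).reg = s.reg := rfl

@[simp] theorem Mem.setArr_arr (a i j v a' i' j' : ℕ) : (s.setArr a i j v).arr a' i' j' =
    if a' = a ∧ i' = i ∧ j' = j then v else s.arr a' i' j' := rfl

theorem Mem.setArr_arr_of_ne {a i j v a' : ℕ} (h : a' ≠ a) :
    (s.setArr a i j v).arr a' = s.arr a' := by
  ext i' j'
  simp [h]

theorem Mem.setArr_column (a i v : ℕ) : (fun x => (s.setArr a i 0 v).arr a x 0) =
    Function.update (fun x => s.arr a x 0) i v := by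
  ext x
  simp [Function.update_apply]

end mem

theorem Cond.eval_eq (s : Mem) (e e' : Expr) :
    (Cond.eq e e').eval s = true ↔ e.eval s = e'.eval s := decide_eq_true_iff

theorem Cond.eval_lt (s : Mem) (e e' : Expr) :
    (Cond.lt e e').eval s = true ↔ e.eval s < e'.eval s := decide_eq_true_iff

theorem Cond.eval_not (s : Mem) (c : Cond) : (Cond.not c).eval s = true ↔ ¬ c.eval s = true := by
  simp [Cond.eval]

theorem Cond.eval_and (s : Mem) (c c' : Cond) :
    (Cond.and c c').eval s = true ↔ c.eval s = true ∧ c'.eval s = true := by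
  simp [Cond.eval]

/-- The program `P`, started in memory `s`, halts after at most `T` steps in a memory with the
property `Post`. -/
def Runs (P : Prog) (s : Mem) (T : ℕ) (Post : Mem → Prop) : Prop :=
  ∃ s' t, Exec P s s' t ∧ t ≤ T ∧ Post s'

namespace Prog

/-- The registers that a program may change. -/
def regs : Prog → List ℕ
  | skip => []
  | assign r _ => [r]
  | write _ _ _ _ => []
  | seq P Q => P.regs ++ Q.regs
  | ite _ P Q => P.regs ++ Q.regs
  | loop _ P => P.regs

/-- The arrays that a program may change. -/
def arrs : Prog → List ℕ
  | skip => []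
  | assign _ _ => []
  | write a _ _ _ => [a]
  | seq P Q => P.arrs ++ Q.arrs
  | ite _ P Q => P.arrs ++ Q.arrs
  | loop _ P => P.arrs

def loopFree : Prog → Bool
  | skip => true
  | assign _ _ => true
  | write _ _ _ _ => true
  | seq P Q => P.loopFree && Q.loopFree
  | ite _ P Q => P.loopFree && Q.loopFree
  | loop _ _ => false

/-- The effect of a program without loops. -/
def run : Prog → Mem → Mem
  | skip, s => s
  | assign r e, s => s.setReg r (e.eval s)
  | write a i j e, s => s.setArr a (i.eval s) (j.eval s) (e.eval s)
  | seq P Q, s => Q.run (P.run s)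
  | ite c P Q, s => if c.eval s = true then P.run s else Q.run s
  | loop _ _, s => s

/-- A bound for the running time of a program without loops. -/
def cost : Prog → ℕ
  | skip => 1
  | assign _ e => e.steps + 1
  | write _ i j e => i.steps + j.steps + e.steps + 1
  | seq P Q => P.cost + Q.cost
  | ite c P Q => c.steps + 1 + max P.cost Q.cost
  | loop _ _ => 0

/-- The loop `for i = 0, 1, …` below the value of the register `b`. -/
def forLoop (i b : ℕ) (P : Prog) : Prog :=
  .seq (.assign i (.const 0))
    (.loop (.lt (.reg i) (.reg b)) (.seq P (.assign i (.succ (.reg i)))))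

end Prog

/-- A syntactic frame rule: preservation of untouched memory reduces to membership in explicit
lists, which `decide` settles. -/
theorem Exec.frame {P : Prog} {s s' : Mem} {t : ℕ} (h : Exec P s s' t) :
    (∀ r ∉ P.regs, s'.reg r = s.reg r) ∧ ∀ a ∉ P.arrs, s'.arr a = s.arr a := by
  induction h with
  | skip => simp
  | assign s r e => simp +contextual [Prog.regs]
  | write s a i j e =>
    refine ⟨by simp, fun a' ha' => Mem.setArr_arr_of_ne s ?_⟩
    simpa [Prog.arrs] using ha'
  | seq h₁ h₂ ih₁ ih₂ =>
    simp only [Prog.regs, Prog.arrs, List.mem_append, not_or]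
    exact ⟨fun r hr => (ih₂.1 r hr.2).trans (ih₁.1 r hr.1),
      fun a ha => (ih₂.2 a ha.2).trans (ih₁.2 a ha.1)⟩
  | ite_true hc h ih =>
    simp only [Prog.regs, Prog.arrs, List.mem_append, not_or]
    exact ⟨fun r hr => ih.1 r hr.1, fun a ha => ih.2 a ha.1⟩
  | ite_false hc h ih =>
    simp only [Prog.regs, Prog.arrs, List.mem_append, not_or]
    exact ⟨fun r hr => ih.1 r hr.2, fun a ha => ih.2 a ha.2⟩
  | loop_false hc => simp
  | loop_true hc h₁ h₂ ih₁ ih₂ =>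
    exact ⟨fun r hr => (ih₂.1 r hr).trans (ih₁.1 r hr), fun a ha => (ih₂.2 a ha).trans (ih₁.2 a ha)⟩

theorem Exec.of_loopFree {P : Prog} (h : P.loopFree = true) (s : Mem) :
    ∃ t ≤ P.cost, Exec P s (P.run s) t := by
  induction P generalizing s with
  | skip => exact ⟨1, le_rfl, .skip s⟩
  | assign r e => exact ⟨_, le_rfl, .assign s r e⟩
  | write a i j e => exact ⟨_, le_rfl, .write s a i j e⟩
  | seq P Q ihP ihQ =>
    simp only [Prog.loopFree, Bool.and_eq_true] at h
    obtain ⟨t₁, h₁, e₁⟩ := ihP h.1 s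
    obtain ⟨t₂, h₂, e₂⟩ := ihQ h.2 (P.run s)
    exact ⟨_, add_le_add h₁ h₂, .seq e₁ e₂⟩
  | ite c P Q ihP ihQ =>
    simp only [Prog.loopFree, Bool.and_eq_true] at h
    by_cases hc : c.eval s = true
    · obtain ⟨t, ht, e⟩ := ihP h.1 s
      refine ⟨c.steps + 1 + t, by simp [Prog.cost, ht], ?_⟩
      rw [Prog.run, if_pos hc]
      exact .ite_true hc e
    · obtain ⟨t, ht, e⟩ := ihQ h.2 s
      refine ⟨c.steps + 1 + t, by simp [Prog.cost, ht], ?_⟩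
      rw [Prog.run, if_neg hc]
      exact .ite_false (by simpa using hc) e
  | loop c P => simp [Prog.loopFree] at h

namespace Runs

variable {P Q : Prog} {s : Mem} {T T₁ T₂ : ℕ} {Post Post₁ : Mem → Prop}

theorem mono (h : Runs P s T₁ Post₁) (hT : T₁ ≤ T) (hP : ∀ s', Post₁ s' → Post s') :
    Runs P s T Post := by
  obtain ⟨s', t, h1, h2, h3⟩ := h
  exact ⟨s', t, h1, h2.trans hT, hP s' h3⟩

theorem frame (h : Runs P s T Post) : Runs P s T fun s' =>
    Post s' ∧ (∀ r ∉ P.regs, s'.reg r = s.reg r) ∧ ∀ a ∉ P.arrs, s'.arr a = s.arr a := by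
  obtain ⟨s', t, h1, h2, h3⟩ := h
  exact ⟨s', t, h1, h2, h3, h1.frame⟩

theorem of_loopFree (h : P.loopFree = true) (hPost : Post (P.run s)) : Runs P s P.cost Post := by
  obtain ⟨t, h1, h2⟩ := Exec.of_loopFree h s
  exact ⟨_, t, h2, h1, hPost⟩

theorem seq (h₁ : Runs P s T₁ Post₁)
    (h₂ : ∀ s', Post₁ s' → (∀ r ∉ P.regs, s'.reg r = s.reg r) →
      (∀ a ∉ P.arrs, s'.arr a = s.arr a) → Runs Q s' T₂ Post) :
    Runs (.seq P Q) s (T₁ + T₂) Post := by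
  obtain ⟨s₁, t₁, e₁, l₁, p₁⟩ := h₁
  obtain ⟨s₂, t₂, e₂, l₂, p₂⟩ := h₂ s₁ p₁ e₁.frame.1 e₁.frame.2
  exact ⟨s₂, _, .seq e₁ e₂, add_le_add l₁ l₂, p₂⟩

theorem ite {c : Cond} (h₁ : c.eval s = true → Runs P s T₁ Post)
    (h₂ : c.eval s = false → Runs Q s T₁ Post) : Runs (.ite c P Q) s (c.steps + 1 + T₁) Post := by
  rcases hc : c.eval s with _ | _
  · obtain ⟨s', t, e, l, p⟩ := h₂ hc
    exact ⟨s', _, .ite_false hc e, Nat.add_le_add_left l _, p⟩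
  · obtain ⟨s', t, e, l, p⟩ := h₁ hc
    exact ⟨s', _, .ite_true hc e, Nat.add_le_add_left l _, p⟩

/-- The rule for loops; the first argument of the invariant bounds the number of iterations. -/
theorem loop {c : Cond} (Inv : ℕ → Mem → Prop)
    (step : ∀ k s, Inv k s → c.eval s = true → ∃ k', k = k' + 1 ∧ Runs P s T (Inv k')) (k : ℕ)
    (s : Mem) (h : Inv k s) : Runs (.loop c P) s (k * (c.steps + 1 + T) + (c.steps + 1))
      fun s' => c.eval s' = false ∧ ∃ k', Inv k' s' := by
  induction k generalizing s with
  | zero =>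
    rcases hc : c.eval s with _ | _
    · exact ⟨s, _, .loop_false hc, by simp, hc, 0, h⟩
    · obtain ⟨k', hk', -⟩ := step 0 s h hc
      omega
  | succ k ih =>
    rcases hc : c.eval s with _ | _
    · exact ⟨s, _, .loop_false hc, by simp, hc, _, h⟩
    · obtain ⟨k', hk', s₁, t₁, e₁, l₁, p₁⟩ := step (k + 1) s h hc
      obtain rfl : k = k' := by omega
      obtain ⟨s₂, t₂, e₂, l₂, p₂⟩ := ih s₁ p₁
      refine ⟨s₂, _, .loop_true hc e₁ e₂, ?_, p₂⟩
      rw [Nat.succ_mul]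
      omega

/-- Per iteration, `7` counts the test (`4`) and the increment (`3`); the final `6` counts the
initialization (`2`) and the failing test (`4`). The body establishes the invariant for the memory
after the increment. -/
theorem forLoop {i b : ℕ} (Inv : ℕ → Mem → Prop) (hi : i ∉ P.regs) (hb : b ∉ P.regs) (hib : i ≠ b)
    (h0 : Inv 0 (s.setReg i 0))
    (step : ∀ k < s.reg b, ∀ s', s'.reg i = k → (∀ r ∉ P.regs, r ≠ i → s'.reg r = s.reg r) →
      (∀ a ∉ P.arrs, s'.arr a = s.arr a) → Inv k s' →
      Runs P s' T fun s'' => Inv (k + 1) (s''.setReg i (k + 1))) :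
    Runs (Prog.forLoop i b P) s (s.reg b * (T + 7) + 6) (Inv (s.reg b)) := by
  set B := s.reg b with hB
  -- `f` is the number of iterations left.
  let J : ℕ → Mem → Prop := fun f s' => s'.reg i + f = B ∧
    (∀ r ∉ P.regs, r ≠ i → s'.reg r = s.reg r) ∧
    (∀ a ∉ P.arrs, s'.arr a = s.arr a) ∧ Inv (s'.reg i) s'
  have hloop := loop (c := .lt (.reg i) (.reg b)) (P := .seq P (.assign i (.succ (.reg i))))
    (T := T + 3) J (by
      rintro f s' ⟨h1, h2, h3, h4⟩ hc
      have hlt : s'.reg i < s'.reg b := (Cond.eval_lt _ _ _).1 hc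
      rw [h2 b hb hib.symm, ← hB] at hlt
      refine ⟨f - 1, by omega, ?_⟩
      refine seq (step (s'.reg i) hlt s' rfl h2 h3 h4) (T₂ := 3) fun s'' p f1 f2 => ?_
      refine (of_loopFree (P := .assign i (.succ (.reg i))) rfl ?_).mono
        (Post₁ := J (f - 1)) (by simp [Prog.cost, Expr.steps]) fun _ h => h
      have e1 : s''.reg i = s'.reg i := f1 i hi
      simp only [Prog.run, Expr.eval, e1]
      refine ⟨by simp; omega, fun r hr hri => ?_, fun a ha => ?_, by simpa using p⟩
      · simp only [Mem.setReg_reg, if_neg hri]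
        rw [f1 r hr, h2 r hr hri]
      · rw [Mem.setReg_arr, f2 a ha, h3 a ha]) B (s.setReg i 0)
    ⟨by simp, fun r _ hr => by simp [hr], fun a _ => rfl, by simpa using h0⟩
  obtain ⟨s', t, e, l, h1, f, h2, h3, h4, h5⟩ := hloop
  refine ⟨s', _, .seq (.assign s i (.const 0)) e, ?_, ?_⟩
  · simp only [Cond.steps, Expr.steps] at l ⊢
    have : B * (1 + 1 + 1 + 1 + (T + 3)) = B * (T + 7) := by ring
    omega
  · have h6 : ¬ s'.reg i < s'.reg b := by
      intro h
      rw [(Cond.eval_lt s' (.reg i) (.reg b)).2 h] at h1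
      cases h1
    rw [h3 b hb hib.symm, ← hB] at h6
    have h7 : s'.reg i = B := by omega
    exact h7 ▸ h5

/-- A loop that marks positions of an array. -/
theorem forMark {i b a : ℕ} {c : Cond} {e₁ e₂ : Expr} (hib : i ≠ b) (Pc : ℕ → Prop) (f₁ f₂ : ℕ → ℕ)
    (h : ∀ k < s.reg b, ∀ s', s'.reg i = k → (∀ r, r ≠ i → s'.reg r = s.reg r) →
      (∀ a', a' ≠ a → s'.arr a' = s.arr a') →
      (∀ x y, s'.arr a x y ≠ 0 ↔ s.arr a x y ≠ 0 ∨ ∃ k' < k, Pc k' ∧ x = f₁ k' ∧ y = f₂ k') →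
      (c.eval s' = true ↔ Pc k) ∧ e₁.eval s' = f₁ k ∧ e₂.eval s' = f₂ k) :
    Runs (Prog.forLoop i b (.ite c (.write a e₁ e₂ (.const 1)) .skip)) s
      (s.reg b * (c.steps + e₁.steps + e₂.steps + 10) + 6) fun s' =>
        ∀ x y, s'.arr a x y ≠ 0 ↔ s.arr a x y ≠ 0 ∨ ∃ k < s.reg b, Pc k ∧ x = f₁ k ∧ y = f₂ k := by
  refine (forLoop (s := s) (T := c.steps + e₁.steps + e₂.steps + 3)
    (fun k s' => ∀ x y, s'.arr a x y ≠ 0 ↔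
      s.arr a x y ≠ 0 ∨ ∃ k' < k, Pc k' ∧ x = f₁ k' ∧ y = f₂ k')
    (by simp [Prog.regs]) (by simp [Prog.regs]) hib (by simp) ?_).mono (by
      have : c.steps + e₁.steps + e₂.steps + 3 + 7 = c.steps + e₁.steps + e₂.steps + 10 := by ring
      rw [this]) fun _ h => h
  intro k hk s' hi hr ha hInv
  obtain ⟨h1, h2, h3⟩ := h k hk s' hi (fun r => hr r (by simp [Prog.regs]))
    (fun a' ha' => ha a' (by simpa [Prog.arrs] using ha')) hInv
  refine (of_loopFree rfl ?_).mono (Post₁ := fun s'' => ∀ x y, (s''.setReg i (k + 1)).arr a x y ≠ 0 ↔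
      s.arr a x y ≠ 0 ∨ ∃ k' < k + 1, Pc k' ∧ x = f₁ k' ∧ y = f₂ k')
    (by simp [Prog.cost, Expr.steps]; omega) fun _ h => h
  intro x y
  have hex : (∃ k' < k + 1, Pc k' ∧ x = f₁ k' ∧ y = f₂ k') ↔
      (∃ k' < k, Pc k' ∧ x = f₁ k' ∧ y = f₂ k') ∨ (Pc k ∧ x = f₁ k ∧ y = f₂ k) := by
    constructor
    · rintro ⟨k', h4, h5⟩
      rcases Nat.lt_succ_iff_lt_or_eq.1 h4 with h6 | rfl
      · exact Or.inl ⟨k', h6, h5⟩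
      · exact Or.inr h5
    · rintro (⟨k', h4, h5⟩ | h5)
      · exact ⟨k', by omega, h5⟩
      · exact ⟨k, by omega, h5⟩
  rw [hex, ← or_assoc, ← hInv x y, Mem.setReg_arr]
  by_cases hc : c.eval s' = true
  · have hP := h1.1 hc
    simp only [Prog.run, hc, if_true, Expr.eval, h2, h3, Mem.setArr_arr, true_and]
    by_cases hxy : x = f₁ k ∧ y = f₂ k <;> simp [hxy, hP]
  · have hP : ¬ Pc k := fun hP => hc (h1.2 hP)
    simp only [Prog.run, hc, hP]
    simp

end Runs

/-! ## The program: the bipartite graph -/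

namespace Runs

variable {s : Mem}

/-- A double loop that marks positions of an array. -/
theorem forMark₂ {i j b b' a : ℕ} {c : Cond} {e₁ e₂ : Expr} (hib : i ≠ b) (hij : i ≠ j) (hjb : j ≠ b)
    (hjb' : j ≠ b') (hib' : i ≠ b') (Pc : ℕ → ℕ → Prop) (f₁ f₂ : ℕ → ℕ → ℕ)
    (h : ∀ k < s.reg b, ∀ l < s.reg b', ∀ s', s'.reg i = k → s'.reg j = l →
      (∀ r, r ≠ i → r ≠ j → s'.reg r = s.reg r) →
      (∀ a', a' ≠ a → s'.arr a' = s.arr a') → (∀ x y, s.arr a x y ≠ 0 → s'.arr a x y ≠ 0) →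
      (∀ x y, s'.arr a x y ≠ 0 → s.arr a x y ≠ 0 ∨
        ∃ k' < s.reg b, ∃ l' < s.reg b', Pc k' l' ∧ x = f₁ k' l' ∧ y = f₂ k' l') →
      (c.eval s' = true ↔ Pc k l) ∧ e₁.eval s' = f₁ k l ∧ e₂.eval s' = f₂ k l) :
    Runs (Prog.forLoop i b (Prog.forLoop j b' (.ite c (.write a e₁ e₂ (.const 1)) .skip))) s
      (s.reg b * (s.reg b' * (c.steps + e₁.steps + e₂.steps + 10) + 13) + 6) fun s' =>
        ∀ x y, s'.arr a x y ≠ 0 ↔ s.arr a x y ≠ 0 ∨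
          ∃ k < s.reg b, ∃ l < s.reg b', Pc k l ∧ x = f₁ k l ∧ y = f₂ k l := by
  refine forLoop (s := s) (T := s.reg b' * (c.steps + e₁.steps + e₂.steps + 10) + 6)
    (fun k s' => ∀ x y, s'.arr a x y ≠ 0 ↔
      s.arr a x y ≠ 0 ∨ ∃ k' < k, ∃ l < s.reg b', Pc k' l ∧ x = f₁ k' l ∧ y = f₂ k' l)
    (by simp [Prog.regs, Prog.forLoop, hij]) (by simp [Prog.regs, Prog.forLoop, hjb.symm]) hib
    (by simp) ?_
  intro k hk s₁ hi hr ha hInv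
  have hr' : ∀ r, r ≠ i → r ≠ j → s₁.reg r = s.reg r := fun r h1 h2 =>
    hr r (by simp [Prog.regs, Prog.forLoop, h2]) h1
  have hb' : s₁.reg b' = s.reg b' := hr' b' hib'.symm hjb'.symm
  have ha' : ∀ a', a' ≠ a → s₁.arr a' = s.arr a' := fun a' h1 =>
    ha a' (by simp [Prog.arrs, Prog.forLoop, h1])
  have hmark := forMark (s := s₁) (i := j) (b := b') (a := a) (c := c) (e₁ := e₁) (e₂ := e₂) hjb'
    (Pc k) (f₁ k) (f₂ k) (by
      intro l hl s' hj h1 h2 h3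
      rw [hb'] at hl
      refine h k hk l hl s' (by rw [h1 i hij, hi]) hj
        (fun r h4 h5 => (h1 r h5).trans (hr' r h4 h5)) (fun a' h4 => (h2 a' h4).trans (ha' a' h4))
        (fun x y h4 => (h3 x y).2 (Or.inl ((hInv x y).2 (Or.inl h4)))) fun x y h4 => ?_
      rcases (h3 x y).1 h4 with h5 | ⟨l', h5, h6⟩
      · rcases (hInv x y).1 h5 with h7 | ⟨k', h7, h8⟩
        · exact Or.inl h7
        · exact Or.inr ⟨k', by omega, h8⟩
      · exact Or.inr ⟨k, hk, l', by omega, h6⟩)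
  rw [hb'] at hmark
  refine hmark.mono le_rfl fun s' h' x y => ?_
  rw [Mem.setReg_arr, h' x y, hInv x y, or_assoc]
  refine or_congr_right ⟨?_, ?_⟩
  · rintro (⟨k', h1, h2⟩ | ⟨l, h1, h2⟩)
    · exact ⟨k', by omega, h2⟩
    · exact ⟨k, by omega, l, h1, h2⟩
  · rintro ⟨k', h1, l, h2, h3⟩
    rcases Nat.lt_succ_iff_lt_or_eq.1 h1 with h4 | rfl
    · exact Or.inl ⟨k', h4, l, h2, h3⟩
    · exact Or.inr ⟨l, h2, h3⟩

end Runs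

/-- The memory contains the input `(A, C)`. -/
structure Mem.HasInput {n p : ℕ} (s : Mem) (A : StructMatrix n n) (C : StructMatrix p n) :
    Prop where
  reg_zero : s.reg 0 = n
  reg_one : s.reg 1 = p
  arr_zero : s.arr 0 = encodeMatrix A
  arr_one : s.arr 1 = encodeMatrix C

theorem hasInput_inputMem {n p : ℕ} (A : StructMatrix n n) (C : StructMatrix p n) :
    (inputMem A C).HasInput A C := ⟨rfl, rfl, rfl, rfl⟩

theorem encodeMatrix_ne_zero_iff {a b : ℕ} (M : StructMatrix a b) (i : Fin a) (j : Fin b) :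
    encodeMatrix M i j ≠ 0 ↔ M i j = true := by
  simp [encodeMatrix]

theorem Mem.HasInput.of_eq {n p : ℕ} {A : StructMatrix n n} {C : StructMatrix p n} {s s' : Mem}
    (h : s.HasInput A C) (h0 : s'.reg 0 = s.reg 0) (h1 : s'.reg 1 = s.reg 1)
    (h2 : s'.arr 0 = s.arr 0) (h3 : s'.arr 1 = s.arr 1) : s'.HasInput A C :=
  ⟨h0.trans h.1, h1.trans h.2, h2.trans h.3, h3.trans h.4⟩

namespace Prog

/-- Stores consecutive numbers in a column of the array `3`. -/
def storeColumn (c : ℕ) : Prog :=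
  forLoop 5 0 (.seq (.write 3 (.reg 5) (.const c) (.reg 3)) (.assign 3 (.succ (.reg 3))))

/-- Computes `n + i` and `2 n + i` for `i < n` (in the array `3`), and `n + p` and `3 n` (in the
registers `3` and `4`). -/
def offsets : Prog :=
  .seq (.assign 3 (.reg 0)) (.seq (storeColumn 0) (.seq (storeColumn 1) (.seq
    (.seq (.assign 4 (.reg 3)) (.assign 3 (.reg 0))) (forLoop 5 1 (.assign 3 (.succ (.reg 3)))))))

/-- Stores the adjacency matrix of the bipartite graph in the array `4`. -/
def graph : Prog :=
  .seq (forLoop 5 0 (.ite (.eq (.const 0) (.const 0)) (.write 4 (.reg 5) (.reg 5) (.const 1)) .skip))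
  (.seq (forLoop 5 0 (.ite (.eq (.const 0) (.const 0))
    (.write 4 (.read 3 (.reg 5) (.const 1)) (.reg 5) (.const 1)) .skip))
  (.seq (forLoop 5 0 (forLoop 6 1 (.ite (.not (.eq (.read 1 (.reg 6) (.reg 5)) (.const 0)))
    (.write 4 (.reg 5) (.read 3 (.reg 6) (.const 0)) (.const 1)) .skip)))
  (forLoop 5 0 (forLoop 6 0 (.ite (.not (.eq (.read 0 (.reg 6) (.reg 5)) (.const 0)))
    (.write 4 (.read 3 (.reg 5) (.const 0)) (.reg 6) (.const 1)) .skip)))))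

end Prog

/-- The machine cannot add, so the offsets are tabulated by counting: register `3` continues from
its old value, and two successive columns hold `n + i` and `2 n + i`. -/
theorem runs_storeColumn (c : ℕ) (s : Mem) :
    Runs (Prog.storeColumn c) s (s.reg 0 * 14 + 6) fun s' => s'.reg 3 = s.reg 3 + s.reg 0 ∧
      ∀ x y, s'.arr 3 x y = if x < s.reg 0 ∧ y = c then s.reg 3 + x else s.arr 3 x y := by
  refine Runs.forLoop (T := 7) (fun k s' => s'.reg 3 = s.reg 3 + k ∧
      ∀ x y, s'.arr 3 x y = if x < k ∧ y = c then s.reg 3 + x else s.arr 3 x y)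
    (by simp [Prog.regs]) (by simp [Prog.regs]) (by decide) (by simp) ?_
  rintro k hk s' hi - - ⟨h1, h2⟩
  refine (Runs.of_loopFree rfl ?_).mono (Post₁ := fun s'' => (s''.setReg 5 (k + 1)).reg 3 =
      s.reg 3 + (k + 1) ∧ ∀ x y, (s''.setReg 5 (k + 1)).arr 3 x y =
        if x < k + 1 ∧ y = c then s.reg 3 + x else s.arr 3 x y)
    (by simp [Prog.cost, Expr.steps]) fun _ h => h
  simp only [Prog.run, Expr.eval, Mem.setReg_reg, Mem.setReg_arr, Mem.setArr_reg, Mem.setArr_arr,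
    hi, h1, h2]
  refine ⟨by simp; omega, fun x y => ?_⟩
  by_cases hy : y = c <;> by_cases hx : x = k <;> simp [hx, hy]
  have : x ≤ k ↔ x < k := by omega
  simp [this]

section

variable {n p : ℕ} {A : StructMatrix n n} {C : StructMatrix p n} {s : Mem}

/-- The results of `Prog.offsets`. -/
structure Mem.HasOffsets (s : Mem) (n p : ℕ) : Prop where
  reg_three : s.reg 3 = n + p
  reg_four : s.reg 4 = n + n + n
  offset_zero : ∀ i < n, s.arr 3 i 0 = n + i
  offset_one : ∀ i < n, s.arr 3 i 1 = n + n + i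

theorem Mem.HasOffsets.of_eq {s' : Mem} (h : s.HasOffsets n p) (h0 : s'.reg 3 = s.reg 3)
    (h1 : s'.reg 4 = s.reg 4) (h2 : s'.arr 3 = s.arr 3) : s'.HasOffsets n p :=
  ⟨h0.trans h.1, h1.trans h.2, fun i hi => by rw [h2]; exact h.3 i hi,
    fun i hi => by rw [h2]; exact h.4 i hi⟩

theorem runs_offsets (hs : s.HasInput A C) :
    Runs Prog.offsets s (28 * n + 10 * p + 24) fun s' => s'.HasOffsets n p := by
  have e0 := hs.reg_zero
  have e1 := hs.reg_one
  refine (Runs.seq (T₂ := 28 * n + 10 * p + 22)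
    (Runs.of_loopFree rfl (Post := fun s' => s'.reg 3 = n) (by simp [Prog.run, Expr.eval, e0]))
    fun s₁ h1 f1 g1 => ?_).mono (by simp [Prog.cost, Expr.steps]; omega) fun _ h => h
  have a0 : s₁.reg 0 = n := by rw [f1 0 (by decide), e0]
  have a1 : s₁.reg 1 = p := by rw [f1 1 (by decide), e1]
  refine (Runs.seq (T₂ := 14 * n + 10 * p + 16) (runs_storeColumn 0 s₁)
    fun s₂ h2 f2 g2 => ?_).mono (by rw [a0]; omega) fun _ h => h
  have b0 : s₂.reg 0 = n := by rw [f2 0 (by decide), a0]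
  have b1 : s₂.reg 1 = p := by rw [f2 1 (by decide), a1]
  refine (Runs.seq (T₂ := 10 * p + 10) (runs_storeColumn 1 s₂)
    fun s₃ h3 f3 g3 => ?_).mono (by rw [b0]; omega) fun _ h => h
  have c0 : s₃.reg 0 = n := by rw [f3 0 (by decide), b0]
  have c1 : s₃.reg 1 = p := by rw [f3 1 (by decide), b1]
  rw [a0, h1] at h2
  rw [b0, h2.1] at h3
  refine (Runs.seq (T₂ := 10 * p + 6) (Runs.of_loopFree rfl
    (Post := fun s' => s'.reg 3 = n ∧ s'.reg 4 = n + n + n)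
    (by simp [Prog.run, Expr.eval, c0, h3.1])) fun s₄ h4 f4 g4 => ?_).mono
    (by simp [Prog.cost, Expr.steps]; omega) fun _ h => h
  have d1 : s₄.reg 1 = p := by rw [f4 1 (by decide), c1]
  have hloop : Runs (Prog.forLoop 5 1 (.assign 3 (.succ (.reg 3)))) s₄ (s₄.reg 1 * (3 + 7) + 6)
      ((fun k s' => s'.reg 3 = n + k ∧ s'.reg 4 = n + n + n ∧ s'.arr 3 = s₄.arr 3) (s₄.reg 1)) := by
    refine Runs.forLoop (fun k s' => s'.reg 3 = n + k ∧ s'.reg 4 = n + n + n ∧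
      s'.arr 3 = s₄.arr 3) (by decide) (by decide) (by decide) (by simp [h4]) ?_
    rintro k - s' hi - - ⟨h5, h6, h7⟩
    exact Runs.of_loopFree rfl (by simp [Prog.run, Expr.eval, h5, h6, h7]; omega)
  refine hloop.mono (by rw [d1]; omega) ?_
  rintro s' ⟨h5, h6, h7⟩
  have g : s₄.arr 3 = s₃.arr 3 := g4 3 (by decide)
  refine ⟨by rw [h5, d1], h6, fun i hi => ?_, fun i hi => ?_⟩
  · rw [h7, g, h3.2, if_neg (by simp), h2.2, if_pos ⟨hi, rfl⟩]
  · rw [h7, g, h3.2, if_pos ⟨hi, rfl⟩]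

/-- `p ≤ n` is needed because the index `n + j` of an output is looked up in the table of `n + i`,
`i < n`. -/
theorem runs_graph (hs : s.HasInput A C) (ho : s.HasOffsets n p) (hpn : p ≤ n)
    (h4 : ∀ x y, s.arr 4 x y = 0) :
    Runs Prog.graph s (n * (n * 20) + n * (p * 20) + 62 * n + 24) fun s' =>
      ∀ x y, s'.arr 4 x y ≠ 0 ↔ NetAdj A C x y := by
  have e0 := hs.reg_zero
  refine (Runs.seq (T₂ := n * (n * 20) + n * (p * 20) + 45 * n + 18)
    (Runs.forMark (s := s) (by decide) (fun _ => True) (fun k => k) (fun k => k) (by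
      intro k hk s' hi _ _ _
      exact ⟨by simp [Cond.eval], hi, hi⟩))
    fun s₁ h1 f1 g1 => ?_).mono (by rw [e0]; simp [Cond.steps, Expr.steps]; omega) fun _ h => h
  have a0 : s₁.reg 0 = n := by rw [f1 0 (by decide), e0]
  have ao : s₁.arr 3 = s.arr 3 := g1 3 (by decide)
  refine (Runs.seq (T₂ := n * (n * 20) + n * (p * 20) + 26 * n + 12)
    (Runs.forMark (s := s₁) (by decide) (fun _ => True) (fun k => n + n + k) (fun k => k) (by
      intro k hk s' hi _ hg _
      rw [a0] at hk
      refine ⟨by simp [Cond.eval], ?_, hi⟩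
      simp only [Expr.eval, hi, hg 3 (by decide), ao]
      exact ho.offset_one k hk))
    fun s₂ h2 f2 g2 => ?_).mono (by rw [a0]; simp [Cond.steps, Expr.steps]; omega) fun _ h => h
  have b0 : s₂.reg 0 = n := by rw [f2 0 (by decide), a0]
  have b1 : s₂.reg 1 = p := by rw [f2 1 (by decide), f1 1 (by decide), hs.reg_one]
  have bo : s₂.arr 3 = s.arr 3 := by rw [g2 3 (by decide), ao]
  have bA : s₂.arr 0 = encodeMatrix A := by rw [g2 0 (by decide), g1 0 (by decide), hs.arr_zero]
  have bC : s₂.arr 1 = encodeMatrix C := by rw [g2 1 (by decide), g1 1 (by decide), hs.arr_one]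
  refine (Runs.seq (T₂ := n * (n * 20) + 13 * n + 6)
    (Runs.forMark₂ (s := s₂) (by decide) (by decide) (by decide) (by decide) (by decide)
      (fun i j => encodeMatrix C j i ≠ 0) (fun i _ => i) (fun _ j => n + j) (by
      intro k hk l hl s' hi hj _ hg _ _
      rw [b0] at hk
      rw [b1] at hl
      refine ⟨?_, hi, ?_⟩
      · simp [Cond.eval_not, Cond.eval_eq, Expr.eval, hi, hj, hg 1 (by decide), bC]
      · simp only [Expr.eval, hj, hg 3 (by decide), bo]
        exact ho.offset_zero l (by omega)))
    fun s₃ h3 f3 g3 => ?_).mono (by rw [b0, b1]; simp [Cond.steps, Expr.steps]; ring_nf; omega)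
    fun _ h => h
  have c0 : s₃.reg 0 = n := by rw [f3 0 (by decide), b0]
  have co : s₃.arr 3 = s.arr 3 := by rw [g3 3 (by decide), bo]
  have cA : s₃.arr 0 = encodeMatrix A := by rw [g3 0 (by decide), bA]
  refine (Runs.forMark₂ (s := s₃) (by decide) (by decide) (by decide) (by decide) (by decide)
    (fun i j => encodeMatrix A j i ≠ 0) (fun i _ => n + i) (fun _ j => j) (by
      intro k hk l hl s' hi hj _ hg _ _
      rw [c0] at hk
      refine ⟨?_, ?_, hj⟩
      · simp [Cond.eval_not, Cond.eval_eq, Expr.eval, hi, hj, hg 0 (by decide), cA]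
      · simp only [Expr.eval, hi, hg 3 (by decide), co]
        exact ho.offset_zero k hk)).mono
    (by rw [c0]; simp [Cond.steps, Expr.steps]; ring_nf; omega) fun s' h => ?_
  intro x y
  rw [h x y, h3 x y, h2 x y, h1 x y, h4 x y, c0, b0, b1, a0, e0]
  constructor
  · rintro ((((h | ⟨k, hk, -, hx, hy⟩) | ⟨k, hk, -, hx, hy⟩) | ⟨k, hk, l, hl, hC, hx, hy⟩) |
      ⟨k, hk, l, hl, hA, hx, hy⟩)
    · exact absurd rfl h
    · exact Or.inl ⟨⟨k, hk⟩, hx, hy⟩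
    · exact Or.inr (Or.inr (Or.inr ⟨⟨k, hk⟩, hx, hy⟩))
    · exact Or.inr (Or.inl ⟨⟨k, hk⟩, ⟨l, hl⟩, ⟨hx, hy⟩,
        (encodeMatrix_ne_zero_iff C ⟨l, hl⟩ ⟨k, hk⟩).1 hC⟩)
    · exact Or.inr (Or.inr (Or.inl ⟨⟨k, hk⟩, ⟨l, hl⟩, ⟨hx, hy⟩,
        (encodeMatrix_ne_zero_iff A ⟨l, hl⟩ ⟨k, hk⟩).1 hA⟩))
  · rintro (⟨i, hx, hy⟩ | ⟨i, j, ⟨hx, hy⟩, hC⟩ | ⟨i, j, ⟨hx, hy⟩, hA⟩ | ⟨i, hx, hy⟩)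
    · exact Or.inl (Or.inl (Or.inl (Or.inr ⟨i, i.2, trivial, hx, hy⟩)))
    · exact Or.inl (Or.inr ⟨i, i.2, j, j.2, (encodeMatrix_ne_zero_iff C j i).2 hC, hx, hy⟩)
    · exact Or.inr ⟨i, i.2, j, j.2, (encodeMatrix_ne_zero_iff A j i).2 hA, hx, hy⟩
    · exact Or.inl (Or.inl (Or.inr ⟨i, i.2, trivial, hx, hy⟩))

end

/-! ## The program: the matching -/

namespace Prog

/-- Visits the right vertex in register `6` from the left vertex in register `11`. -/
def visit : Prog :=
  .ite (.and (.not (.eq (.read 4 (.reg 11) (.reg 6)) (.const 0)))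
      (.eq (.read 6 (.reg 6) (.const 0)) (.const 0)))
    (.seq (.write 6 (.reg 6) (.const 0) (.const 1)) (.seq (.write 7 (.reg 6) (.const 0) (.reg 7))
      (.ite (.eq (.read 5 (.reg 6) (.const 0)) (.const 0))
        (.seq (.assign 9 (.const 1)) (.assign 10 (.reg 6)))
        (.seq (.write 9 (.reg 8) (.const 0) (.reg 6))
          (.seq (.write 8 (.reg 8) (.const 0) (.pred (.read 5 (.reg 6) (.const 0))))
            (.assign 8 (.succ (.reg 8))))))))
    .skip

/-- Breadth-first search from the left vertex in register `5`. The marks, the queue indices of the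
parents, and the two columns of the queue are in the arrays `6`, `7`, `8`, `9`. -/
def search : Prog :=
  .seq (forLoop 6 3 (.write 6 (.reg 6) (.const 0) (.const 0)))
  (.seq (.seq (.assign 7 (.const 0)) (.seq (.assign 8 (.const 1)) (.seq (.assign 9 (.const 0))
    (.write 8 (.const 0) (.const 0) (.reg 5)))))
  (.loop (.and (.lt (.reg 7) (.reg 8)) (.eq (.reg 9) (.const 0)))
    (.seq (.assign 11 (.read 8 (.reg 7) (.const 0))) (.seq (forLoop 6 3 visit)
      (.assign 7 (.succ (.reg 7)))))))

/-- Moves one edge of the matching along the augmenting path. -/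
def shift : Prog :=
  .seq (.assign 12 (.read 9 (.reg 7) (.const 0)))
    (.seq (.write 5 (.reg 6) (.const 0) (.read 5 (.reg 12) (.const 0)))
      (.seq (.assign 6 (.reg 12)) (.assign 7 (.read 7 (.reg 6) (.const 0)))))

/-- Augments the matching if the search was successful. -/
def augment : Prog :=
  .ite (.not (.eq (.reg 9) (.const 0)))
    (.seq (.seq (.assign 6 (.reg 10)) (.assign 7 (.read 7 (.reg 6) (.const 0))))
      (.seq (.loop (.lt (.const 0) (.reg 7)) shift)
        (.write 5 (.reg 6) (.const 0) (.succ (.reg 5)))))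
    .skip

/-- The greedy matching algorithm. -/
def matching : Prog := forLoop 5 4 (.seq search augment)

end Prog

/-- `BfsInv` for the search in memory `s`. -/
def SearchInv (adj : ℕ → ℕ → Prop) (N : ℕ) (m : ℕ → ℕ) (src : ℕ) (s : Mem) (r₀ : ℕ) : Prop :=
  BfsInv adj N m src (fun x => s.arr 6 x 0) (fun x => s.arr 7 x 0) (fun x => s.arr 8 x 0)
    (fun x => s.arr 9 x 0) (s.reg 7) (s.reg 8) (s.reg 9) (s.reg 10) r₀

section

variable {adj : ℕ → ℕ → Prop} {N : ℕ} {src : ℕ} {s : Mem}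

/-- The queue is only written at its tail, so the head entry cached in register `11` stays valid
during the pass. -/
theorem runs_visit {r₀ : ℕ} (hadj : ∀ l r, s.arr 4 l r ≠ 0 ↔ adj l r) (hr : s.reg 6 = r₀) (hrN : r₀ < N)
    (hcur : s.reg 11 = s.arr 8 (s.reg 7) 0) (hlt : s.reg 7 < s.reg 8)
    (H : SearchInv adj N (fun x => s.arr 5 x 0) src s r₀) :
    Runs Prog.visit s 41 fun s' => SearchInv adj N (fun x => s.arr 5 x 0) src s' (r₀ + 1) ∧
      s.reg 8 ≤ s'.reg 8 ∧ s'.arr 8 (s.reg 7) 0 = s.arr 8 (s.reg 7) 0 := by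
  refine (Runs.of_loopFree rfl ?_).mono (Post₁ := fun s' =>
    SearchInv adj N (fun x => s.arr 5 x 0) src s' (r₀ + 1) ∧
      s.reg 8 ≤ s'.reg 8 ∧ s'.arr 8 (s.reg 7) 0 = s.arr 8 (s.reg 7) 0) (by decide) fun _ h => h
  unfold Prog.visit
  rw [Prog.run]
  split_ifs with hc
  · rw [Cond.eval_and, Cond.eval_not, Cond.eval_eq, Cond.eval_eq] at hc
    simp only [Expr.eval, hr, hcur] at hc
    have h1 : adj (s.arr 8 (s.reg 7) 0) r₀ := (hadj _ _).1 hc.1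
    simp only [Prog.run, Expr.eval, Mem.setArr_reg, Mem.setReg_reg, hr]
    by_cases hm : s.arr 5 r₀ 0 = 0
    · rw [if_pos ((Cond.eval_eq _ _ _).2 (by simpa [Expr.eval, hr] using hm))]
      refine ⟨?_, by simp, by simp⟩
      unfold SearchInv
      convert BfsInv.visit_free H hlt hrN h1 hc.2 hm using 1
      all_goals first | (ext x; simp [Function.update_apply]) | simp
    · rw [if_neg (fun h => hm (by simpa [Expr.eval, hr] using (Cond.eval_eq _ _ _).1 h))]
      refine ⟨?_, by simp, by simp; omega⟩
      unfold SearchInv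
      convert BfsInv.visit_matched H hlt hrN h1 hc.2 hm using 1
      all_goals first | (ext x; simp [Function.update_apply]) | simp
  · rw [Cond.eval_and, Cond.eval_not, Cond.eval_eq, Cond.eval_eq] at hc
    simp only [Expr.eval, hr, hcur] at hc
    refine ⟨BfsInv.skip H fun h1 h2 => hc ⟨(hadj _ _).2 h1, h2⟩, le_rfl, rfl⟩

/-- The head advances once per pass and cannot exceed the tail, so there are at most `N + 1` passes,
each with `N` visits of `41 + 7` steps. On exit without a free vertex the queue is exhausted. -/
theorem runs_search (hadj : ∀ l r, s.arr 4 l r ≠ 0 ↔ adj l r) (hN : s.reg 3 = N) :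
    Runs Prog.search s ((N + 1) * (48 * N + 22) + 11 * N + 40) fun s' =>
      SearchInv adj N (fun x => s.arr 5 x 0) (s.reg 5) s' 0 ∧ s'.reg 7 ≤ N + 1 ∧
        (s'.reg 9 = 0 → ¬ s'.reg 7 < s'.reg 8) := by
  refine (Runs.seq (T₂ := (N + 1) * (48 * N + 22) + 30) (Runs.forLoop (T := 4)
    (fun k s' => ∀ x < k, s'.arr 6 x 0 = 0) (by decide) (by decide) (by decide) (by simp) ?_)
    fun s₁ h1 f1 g1 => ?_).mono (by rw [hN]; omega) fun _ h => h
  · rintro k hk s' hi - - h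
    refine Runs.of_loopFree rfl ?_
    intro x hx
    simp only [Prog.run, Expr.eval, Mem.setReg_arr, Mem.setArr_arr, hi]
    split_ifs with hxk
    · rfl
    · exact h x (by simp at hxk; omega)
  rw [hN] at h1
  have a3 : s₁.reg 3 = N := by rw [f1 3 (by decide), hN]
  have a5 : s₁.reg 5 = s.reg 5 := f1 5 (by decide)
  have b4 : s₁.arr 4 = s.arr 4 := g1 4 (by decide)
  have b5 : s₁.arr 5 = s.arr 5 := g1 5 (by decide)
  refine (Runs.seq (T₂ := (N + 1) * (48 * N + 22) + 12) (Runs.of_loopFree rfl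
    (Post := fun s' => SearchInv adj N (fun x => s.arr 5 x 0) (s.reg 5) s' 0 ∧ s'.reg 7 = 0) ?_)
    fun s₂ h2 f2 g2 => ?_).mono (by simp [Prog.cost, Expr.steps]; omega) fun _ h => h
  · simp only [Prog.run, Expr.eval, SearchInv, Mem.setReg_reg, Mem.setReg_arr, Mem.setArr_reg,
      Mem.setArr_arr]
    simp only [Nat.reduceEqDiff, if_true, if_false, false_and, and_true, true_and]
    refine BfsInv.init _ h1 ?_
    simpa using a5
  have c3 : s₂.reg 3 = N := by rw [f2 3 (by decide), a3]
  have c4 : s₂.arr 4 = s.arr 4 := by rw [g2 4 (by decide), b4]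
  have c5 : s₂.arr 5 = s.arr 5 := by rw [g2 5 (by decide), b5]
  refine (Runs.loop (T := 48 * N + 13) (fun k s' =>
    SearchInv adj N (fun x => s.arr 5 x 0) (s.reg 5) s' 0 ∧ k + s'.reg 7 = N + 1 ∧
      s'.reg 3 = N ∧ s'.arr 4 = s.arr 4 ∧ s'.arr 5 = s.arr 5) ?_ (N + 1) s₂
    ⟨h2.1, by rw [h2.2], c3, c4, c5⟩).mono ?_ ?_
  · rintro k s₃ ⟨H, hk, d3, d4, d5⟩ hc
    rw [Cond.eval_and, Cond.eval_lt, Cond.eval_eq] at hc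
    have hlt : s₃.reg 7 < s₃.reg 8 := hc.1
    have htail := BfsInv.tail_le H
    refine ⟨k - 1, by omega, ?_⟩
    refine (Runs.seq (T₂ := 48 * N + 9) (Runs.of_loopFree rfl
      (Post := fun s' => SearchInv adj N (fun x => s.arr 5 x 0) (s.reg 5) s' 0 ∧
        s'.reg 11 = s₃.arr 8 (s₃.reg 7) 0) ?_)
      fun s₄ h4 f4 g4 => ?_).mono (by simp [Prog.cost, Expr.steps]; omega) fun _ h => h
    · simpa [Prog.run, Expr.eval, SearchInv] using H
    have e3 : s₄.reg 3 = N := by rw [f4 3 (by decide), d3]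
    have e7 : s₄.reg 7 = s₃.reg 7 := f4 7 (by decide)
    have e8 : s₄.reg 8 = s₃.reg 8 := f4 8 (by decide)
    have e4 : s₄.arr 4 = s.arr 4 := by rw [g4 4 (by decide), d4]
    have e5 : s₄.arr 5 = s.arr 5 := by rw [g4 5 (by decide), d5]
    have e11 : s₄.reg 11 = s₄.arr 8 (s₄.reg 7) 0 := by rw [h4.2, e7, g4 8 (by decide)]
    refine (Runs.seq (T₂ := 3) (Runs.forLoop (T := 41) (fun k s' =>
      SearchInv adj N (fun x => s.arr 5 x 0) (s.reg 5) s' k ∧ s₄.reg 8 ≤ s'.reg 8 ∧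
        s'.arr 8 (s₄.reg 7) 0 = s₄.arr 8 (s₄.reg 7) 0) (by decide) (by decide) (by decide) ?_ ?_)
      fun s₅ h5 f5 g5 => ?_).mono (by rw [e3]; omega) fun _ h => h
    · exact ⟨by simpa [SearchInv] using h4.1, by simp, by simp⟩
    · rintro r hr s₅ hi f5 g5 ⟨H5, t5, q5⟩
      have k7 : s₅.reg 7 = s₄.reg 7 := f5 7 (by decide) (by decide)
      have k11 : s₅.reg 11 = s₄.reg 11 := f5 11 (by decide) (by decide)
      have l4 : s₅.arr 4 = s.arr 4 := by rw [g5 4 (by decide), e4]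
      have l5 : s₅.arr 5 = s.arr 5 := by rw [g5 5 (by decide), e5]
      refine (runs_visit (adj := adj) (N := N) (src := s.reg 5) (by rw [l4]; exact hadj) hi
        (e3 ▸ hr) (by rw [k11, k7, q5, e11]) (by omega) (by rw [l5]; exact H5)).mono le_rfl ?_
      rintro s₆ ⟨H6, t6, q6⟩
      rw [l5] at H6
      refine ⟨by simpa [SearchInv] using H6, ?_, ?_⟩
      · simp
        omega
      · simp only [Mem.setReg_arr]
        rw [← q5, ← k7, q6]
    · have k7 : s₅.reg 7 = s₄.reg 7 := f5 7 (by decide)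
      rw [e3] at h5
      refine Runs.of_loopFree rfl ⟨?_, ?_, ?_, ?_, ?_⟩
      · have := BfsInv.next h5.1 (by omega)
        simpa [SearchInv, Prog.run, Expr.eval] using this
      · simp only [Prog.run, Expr.eval, Mem.setReg_reg, if_true]
        omega
      · simp [Prog.run, f5 3 (by decide), e3]
      · simp [Prog.run, g5 4 (by decide), e4]
      · simp [Prog.run, g5 5 (by decide), e5]
  · simp only [Cond.steps, Expr.steps]
    have : (N + 1) * (1 + 1 + 1 + (1 + 1 + 1) + 1 + 1 + (48 * N + 13)) = (N + 1) * (48 * N + 21) := by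
      ring
    rw [this]
    have : (N + 1) * (48 * N + 21) ≤ (N + 1) * (48 * N + 22) := Nat.mul_le_mul_left _ (by omega)
    omega
  · rintro s' ⟨hc, k, H, hk, -⟩
    refine ⟨H, by omega, fun h9 hlt => ?_⟩
    have := (Cond.eval_and s' (.lt (.reg 7) (.reg 8)) (.eq (.reg 9) (.const 0))).2
      ⟨(Cond.eval_lt _ _ _).2 hlt, (Cond.eval_eq _ _ _).2 h9⟩
    rw [this] at hc
    cases hc

/-- Register `7` holds the queue index of the parent, which strictly decreases, so there are at most
`N + 1` shifts of `16 + 4` steps. -/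
theorem runs_augment {m : ℕ → ℕ} (hm : m = fun x => s.arr 5 x 0) (hsrc : s.reg 5 = src)
    (hG : IsGreedyMatching adj src N m) (H : SearchInv adj N m src s 0)
    (h9 : s.reg 9 = 0 → ¬ s.reg 7 < s.reg 8) :
    Runs Prog.augment s ((N + 1) * 20 + 24) fun s' =>
      IsGreedyMatching adj (src + 1) N fun x => s'.arr 5 x 0 := by
  refine (Runs.ite (T₁ := (N + 1) * 20 + 18) ?_ ?_).mono
    (by simp [Cond.steps, Expr.steps]; omega) fun _ h => h
  · intro hc
    rw [Cond.eval_not, Cond.eval_eq] at hc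
    have hfd : s.reg 9 ≠ 0 := hc
    have htail := BfsInv.tail_le H
    refine (Runs.seq (T₂ := (N + 1) * 20 + 11) (Runs.of_loopFree rfl (Post := fun s' =>
      s'.reg 6 = s.reg 10 ∧ s'.reg 7 = s.arr 7 (s.reg 10) 0) (by simp [Prog.run, Expr.eval]))
      fun s₁ h1 f1 g1 => ?_).mono (by simp [Prog.cost, Expr.steps]; omega) fun _ h => h
    have hA : ∀ a, s₁.arr a = s.arr a := fun a => g1 a (by simp [Prog.arrs])
    have hI := AugInv.init H hfd hG.toIsMatching
    refine (Runs.seq (T₂ := 6) (Runs.loop (T := 16) (fun k s' => s'.reg 7 ≤ k ∧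
      AugInv adj N m (fun x => s.arr 6 x 0) (fun x => s.arr 7 x 0) (fun x => s.arr 9 x 0)
        (s.reg 8) (fun x => s'.arr 5 x 0) (s'.reg 6) (s'.reg 7) ∧
      s'.arr 7 = s.arr 7 ∧ s'.arr 9 = s.arr 9) ?_ (s₁.reg 7) s₁ ⟨le_rfl, ?_, hA 7, hA 9⟩)
      fun s₂ h2 f2 g2 => ?_).mono ?_ fun _ h => h
    · rintro k s₂ ⟨hk, G, a7, a9⟩ hc
      have h0 : 0 < s₂.reg 7 := (Cond.eval_lt _ _ _).1 hc
      obtain ⟨G', hlt⟩ := G.step H h0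
      refine ⟨k - 1, by omega, ?_⟩
      refine (Runs.of_loopFree rfl ?_).mono (Post₁ := fun s' => s'.reg 7 ≤ k - 1 ∧
        AugInv adj N m (fun x => s.arr 6 x 0) (fun x => s.arr 7 x 0) (fun x => s.arr 9 x 0)
          (s.reg 8) (fun x => s'.arr 5 x 0) (s'.reg 6) (s'.reg 7) ∧
        s'.arr 7 = s.arr 7 ∧ s'.arr 9 = s.arr 9) (by decide) fun _ h => h
      have e9 : s₂.arr 9 (s₂.reg 7) 0 = s.arr 9 (s₂.reg 7) 0 := by rw [a9]
      have e7 : ∀ x, s₂.arr 7 x 0 = s.arr 7 x 0 := fun x => by rw [a7]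
      refine ⟨?_, ?_, ?_, ?_⟩
      · simp [Prog.shift, Prog.run, Expr.eval, e9, e7]
        omega
      · convert G' using 1
        · ext x
          simp [Prog.shift, Prog.run, Expr.eval, e9, Function.update_apply]
        · simp [Prog.shift, Prog.run, Expr.eval, e9]
        · simp [Prog.shift, Prog.run, Expr.eval, e9, e7]
      · rw [← a7]
        ext x y
        simp [Prog.shift, Prog.run]
      · rw [← a9]
        ext x y
        simp [Prog.shift, Prog.run]
    · rw [hA 5, h1.1, h1.2, ← hm]
      exact hI
    · obtain ⟨hc2, k, -, G, -⟩ := h2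
      have h70 : s₂.reg 7 = 0 := by
        by_contra hne
        rw [(Cond.eval_lt s₂ (.const 0) (.reg 7)).2 (Nat.pos_of_ne_zero hne)] at hc2
        cases hc2
      rw [h70] at G
      have h5 : s₂.reg 5 = src := by rw [f2 5 (by decide), f1 5 (by decide), hsrc]
      have := G.greedy H hG
      refine (Runs.of_loopFree rfl ?_).mono (Post₁ := fun s' =>
        IsGreedyMatching adj (src + 1) N fun x => s'.arr 5 x 0) (by decide) fun _ h => h
      simp only [Prog.run, Expr.eval, h5]
      rw [Mem.setArr_column]
      exact this
    · have : s₁.reg 7 ≤ N + 1 := by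
        rw [h1.2]
        have := hI.lt_tail
        omega
      have := Nat.mul_le_mul_right 20 this
      simp only [Cond.steps, Expr.steps]
      omega
  · intro hc
    have h90 : s.reg 9 = 0 := by
      by_contra hne
      have : (Cond.not (.eq (.reg 9) (.const 0))).eval s = true :=
        (Cond.eval_not _ _).2 fun h => hne ((Cond.eval_eq _ _ _).1 h)
      rw [this] at hc
      cases hc
    unfold SearchInv at H
    rw [h90] at H
    have := H.greedy_of_not_found (h9 h90) hG
    rw [hm] at this
    exact (Runs.of_loopFree rfl this).mono (by simp [Prog.cost]) fun _ h => h

theorem runs_matching (hadj : ∀ l r, s.arr 4 l r ≠ 0 ↔ adj l r) (hN : s.reg 3 = N)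
    (h5 : ∀ x, s.arr 5 x 0 = 0) :
    Runs Prog.matching s (s.reg 4 * ((N + 1) * (48 * N + 42) + 11 * N + 71) + 6) fun s' =>
      IsGreedyMatching adj (s.reg 4) N fun x => s'.arr 5 x 0 := by
  refine (Runs.forLoop (T := (N + 1) * (48 * N + 42) + 11 * N + 64) (fun k s' =>
    IsGreedyMatching adj k N fun x => s'.arr 5 x 0) (by decide) (by decide) (by decide) ?_ ?_).mono
    le_rfl fun _ h => h
  · refine ⟨⟨fun r _ l hl => ?_, fun r _ r' _ h _ => ?_⟩, fun r _ => ?_, fun l hl => by omega⟩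
    · rw [Mem.setReg_arr, h5 r] at hl
      omega
    · exact absurd (h5 r) h
    · exact (h5 r).le
  · intro k hk s₁ hi f1 g1 hG
    have a4 : s₁.arr 4 = s.arr 4 := g1 4 (by decide)
    refine (Runs.seq (runs_search (adj := adj) (N := N) (s := s₁) (by rw [a4]; exact hadj)
      (by rw [f1 3 (by decide) (by decide), hN])) (T₂ := (N + 1) * 20 + 24)
      fun s₂ h2 f2 g2 => ?_).mono (by ring_nf; omega) fun _ h => h
    refine (runs_augment (adj := adj) (N := N) (src := k) rfl (by rw [f2 5 (by decide), hi])
      (by rw [g2 5 (by decide)]; exact hG) ?_ h2.2.2).mono le_rfl fun s' h => ?_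
    · rw [g2 5 (by decide), ← hi]
      exact h2.1
    · exact h

end

/-! ## The program: the output -/

namespace Prog

/-- The condition that `x_i` is an input state, for the register `r` that contains `i`. -/
def inputCond (r : ℕ) : Cond :=
  .eq (.read 5 (.reg r) (.const 0)) (.succ (.read 3 (.reg r) (.const 1)))

/-- Enumerates the input states. -/
def columns : Prog :=
  .seq (.assign 2 (.const 0))
  (.seq (forLoop 5 0 (.ite (inputCond 5)
    (.seq (.write 2 (.reg 5) (.reg 2) (.const 1)) (.assign 2 (.succ (.reg 2)))) .skip))
  (.ite (.eq (.reg 2) (.const 0)) (.assign 2 (.const 1)) .skip))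

/-- Marks the left vertices that are matched with one of the vertices `0, …, n - 1`. -/
def marks : Prog :=
  forLoop 5 0 (.ite (.eq (.const 0) (.const 0))
    (.write 10 (.read 5 (.reg 5) (.const 0)) (.const 0) (.const 1)) .skip)

/-- One pass of the transitive closure, for the intermediate vertex in register `7`. -/
def closurePass : Prog :=
  forLoop 5 0 (forLoop 6 0 (.ite (.and (.not (.eq (.read 11 (.reg 5) (.reg 7)) (.const 0)))
    (.not (.eq (.read 11 (.reg 7) (.reg 6)) (.const 0))))
      (.write 11 (.reg 5) (.reg 6) (.const 1)) .skip))

/-- The reachability matrix, in array `11`. -/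
def closure : Prog :=
  .seq (forLoop 5 0 (.ite (.eq (.const 0) (.const 0)) (.write 11 (.reg 5) (.reg 5) (.const 1)) .skip))
  (.seq (forLoop 5 0 (forLoop 6 0 (.ite (.not (.eq (.read 0 (.reg 6) (.reg 5)) (.const 0)))
    (.write 11 (.reg 5) (.reg 6) (.const 1)) .skip)))
  (forLoop 7 0 closurePass))

/-- The condition that `x_i` is a linked state, for the register `r` that contains `i`. -/
def linkedCond (r : ℕ) : Cond :=
  .not (.eq (.read 10 (.succ (.read 3 (.reg r) (.const 0))) (.const 0)) (.const 0))

/-- Chooses the first linked state in each strongly connected component. -/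
def selection : Prog :=
  forLoop 5 0 (.seq (.assign 7 (.const 0)) (.seq
    (forLoop 6 5 (.ite (.and (linkedCond 6) (.and
      (.not (.eq (.read 11 (.reg 6) (.reg 5)) (.const 0)))
      (.not (.eq (.read 11 (.reg 5) (.reg 6)) (.const 0))))) (.assign 7 (.const 1)) .skip))
    (.ite (.and (linkedCond 5) (.eq (.reg 7) (.const 0)))
      (.write 2 (.reg 5) (.const 0) (.const 1)) .skip)))

/-- The whole program. -/
def main : Prog :=
  .seq offsets (.seq graph (.seq matching (.seq columns (.seq marks (.seq closure selection)))))

end Prog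

section

variable {n p : ℕ} {A : StructMatrix n n} {C : StructMatrix p n} {s : Mem}

/-- Register `2` counts the input states met so far and thus also names the next column. It is
raised to `1` if there are none. -/
theorem runs_columns (P : ℕ → Prop) [DecidablePred P] (h0 : s.reg 0 = n)
    (hP : ∀ i < n, P i ↔ s.arr 5 i 0 = s.arr 3 i 1 + 1) (h2 : ∀ x y, s.arr 2 x y = 0) :
    Runs Prog.columns s (23 * n + 14) fun s' => s'.reg 2 = max 1 (Nat.count P n) ∧
      ∀ x y, s'.arr 2 x y ≠ 0 ↔ x < n ∧ P x ∧ y = Nat.count P x := by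
  refine (Runs.seq (T₂ := 23 * n + 12) (Runs.of_loopFree rfl
    (Post := fun s' => s'.reg 2 = 0 ∧ s'.arr 2 = s.arr 2 ∧ s'.reg 0 = n) ?_)
    fun s₁ h1 f1 g1 => ?_).mono (by simp [Prog.cost, Expr.steps]; omega) fun _ h => h
  · simp [Prog.run, Expr.eval, h0]
  obtain ⟨a2, b2, a0⟩ := h1
  refine (Runs.seq (T₂ := 6) (Runs.forLoop (T := 16) (fun k s' => s'.reg 2 = Nat.count P k ∧
      ∀ x y, s'.arr 2 x y ≠ 0 ↔ x < k ∧ P x ∧ y = Nat.count P x) (by decide) (by decide) (by decide)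
    ?_ ?_) fun s₂ h2 f2 g2 => ?_).mono (by rw [a0]; omega) fun _ h => h
  · refine ⟨by simp [a2], fun x y => ?_⟩
    simp [b2, h2]
  · rintro k hk s₂ hi - hg ⟨h3, h4⟩
    rw [a0] at hk
    have hcond : (Prog.inputCond 5).eval s₂ = true ↔ P k := by
      unfold Prog.inputCond
      rw [Cond.eval_eq, hP k hk]
      simp only [Expr.eval, hi, hg 5 (by decide), hg 3 (by decide), g1 5 (by decide),
        g1 3 (by decide)]
    refine (Runs.of_loopFree rfl ?_).mono (Post₁ := fun s'' => (s''.setReg 5 (k + 1)).reg 2 =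
      Nat.count P (k + 1) ∧ ∀ x y, (s''.setReg 5 (k + 1)).arr 2 x y ≠ 0 ↔
        x < k + 1 ∧ P x ∧ y = Nat.count P x) (by decide) fun _ h => h
    rw [Prog.run]
    have hlt : ∀ x, x < k + 1 ↔ x < k ∨ x = k := fun x => by omega
    by_cases hk' : P k
    · rw [if_pos (hcond.2 hk')]
      refine ⟨by simp [Prog.run, Expr.eval, h3, Nat.count_succ, hk'], fun x y => ?_⟩
      simp only [Prog.run, Expr.eval, Mem.setReg_arr, Mem.setArr_arr, hi, h3, hlt]
      split_ifs with hxy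
      · obtain ⟨-, rfl, rfl⟩ := hxy
        simp [hk']
      · rw [h4]
        constructor
        · rintro ⟨h5, h6⟩
          exact ⟨Or.inl h5, h6⟩
        · rintro ⟨h5 | rfl, h6, h7⟩
          · exact ⟨h5, h6, h7⟩
          · exact absurd ⟨trivial, rfl, h7⟩ hxy
    · rw [if_neg (fun h => hk' (hcond.1 h))]
      refine ⟨by simp [Prog.run, h3, Nat.count_succ, hk'], fun x y => ?_⟩
      simp only [Prog.run, Mem.setReg_arr, h4, hlt]
      constructor
      · rintro ⟨h5, h6⟩
        exact ⟨Or.inl h5, h6⟩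
      · rintro ⟨h5 | rfl, h6, h7⟩
        · exact ⟨h5, h6, h7⟩
        · exact absurd h6 hk'
  · rw [a0] at h2
    refine (Runs.of_loopFree rfl ?_).mono (Post₁ := fun s' => s'.reg 2 = max 1 (Nat.count P n) ∧
      ∀ x y, s'.arr 2 x y ≠ 0 ↔ x < n ∧ P x ∧ y = Nat.count P x) (by decide) fun _ h => h
    rw [Prog.run]
    split_ifs with hc
    · rw [Cond.eval_eq] at hc
      have : Nat.count P n = 0 := by rw [← h2.1]; exact hc
      refine ⟨by simp [Prog.run, Expr.eval, this], ?_⟩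
      simpa [Prog.run] using h2.2
    · rw [Cond.eval_eq] at hc
      have : s₂.reg 2 ≠ 0 := hc
      refine ⟨?_, h2.2⟩
      simp only [Prog.run]
      rw [max_eq_right (by omega), h2.1]

theorem runs_marks (h0 : s.reg 0 = n) (h10 : ∀ x y, s.arr 10 x y = 0) :
    Runs Prog.marks s (17 * n + 6) fun s' =>
      ∀ x, s'.arr 10 x 0 ≠ 0 ↔ ∃ r < n, s.arr 5 r 0 = x := by
  refine (Runs.forMark (s := s) (by decide) (fun _ => True) (fun k => s.arr 5 k 0) (fun _ => 0)
    ?_).mono (by rw [h0]; simp [Cond.steps, Expr.steps]; omega) ?_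
  · rintro k hk s' hi - hg -
    exact ⟨by simp [Cond.eval], by simp [Expr.eval, hi, hg 5 (by decide)], rfl⟩
  · intro s' h x
    rw [h x 0, h0, h10]
    simp [eq_comm]

/-- Updating in place is harmless: a mark set during the pass in row or column `k` requires that the
same mark was already there. -/
theorem runs_closurePass {k : ℕ} (h0 : s.reg 0 = n) (h7 : s.reg 7 = k) :
    Runs Prog.closurePass s (n * (n * 25 + 13) + 6) fun s' => ∀ x y, s'.arr 11 x y ≠ 0 ↔
      s.arr 11 x y ≠ 0 ∨ x < n ∧ y < n ∧ s.arr 11 x k ≠ 0 ∧ s.arr 11 k y ≠ 0 := by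
  refine (Runs.forMark₂ (s := s) (by decide) (by decide) (by decide) (by decide) (by decide)
    (fun i j => s.arr 11 i k ≠ 0 ∧ s.arr 11 k j ≠ 0) (fun i _ => i) (fun _ j => j) ?_).mono
    (by rw [h0]; simp [Cond.steps, Expr.steps]) ?_
  · rintro i hi j hj s' e5 e6 hr - hle hge
    refine ⟨?_, e5, e6⟩
    have e7 : s'.reg 7 = k := by rw [hr 7 (by decide) (by decide), h7]
    rw [Cond.eval_and, Cond.eval_not, Cond.eval_not, Cond.eval_eq, Cond.eval_eq]
    simp only [Expr.eval, e5, e6, e7]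
    refine and_congr ⟨fun h => ?_, hle _ _⟩ ⟨fun h => ?_, hle _ _⟩
    · rcases hge _ _ h with h | ⟨i', -, j', -, h, rfl, rfl⟩
      · exact h
      · exact h.1
    · rcases hge _ _ h with h | ⟨i', -, j', -, h, rfl, rfl⟩
      · exact h
      · exact h.2
  · intro s' h x y
    rw [h x y, h0]
    refine or_congr_right ⟨?_, ?_⟩
    · rintro ⟨i, hi, j, hj, h, rfl, rfl⟩
      exact ⟨hi, hj, h⟩
    · rintro ⟨hx, hy, h⟩
      exact ⟨x, hx, y, hy, h, rfl, rfl⟩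

/-- Warshall's algorithm. After `k` passes the relation is closed under composition through every
intermediate vertex below `k`; after all passes it contains every path. -/
theorem runs_closure (hs : s.HasInput A C) (h11 : ∀ x y, s.arr 11 x y = 0) :
    Runs Prog.closure s (n * (n * (n * 25 + 13)) + n * (n * 20) + 43 * n + 24) fun s' =>
      ∀ i j : Fin n, s'.arr 11 i j ≠ 0 ↔ Reachable A i j := by
  have e0 := hs.reg_zero
  refine (Runs.seq (T₂ := n * (n * (n * 25 + 13)) + n * (n * 20) + 26 * n + 18)
    (Runs.forMark (s := s) (by decide) (fun _ => True) (fun k => k) (fun k => k) (by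
      rintro k hk s' hi - - -
      exact ⟨by simp [Cond.eval], hi, hi⟩))
    fun s₁ h1 f1 g1 => ?_).mono (by rw [e0]; simp [Cond.steps, Expr.steps]; omega) fun _ h => h
  have a0 : s₁.reg 0 = n := by rw [f1 0 (by decide), e0]
  have a1 : s₁.arr 0 = encodeMatrix A := by rw [g1 0 (by decide), hs.arr_zero]
  refine (Runs.seq (T₂ := n * (n * (n * 25 + 13)) + 13 * n + 12)
    (Runs.forMark₂ (s := s₁) (by decide) (by decide) (by decide) (by decide) (by decide)
      (fun i j => encodeMatrix A j i ≠ 0) (fun i _ => i) (fun _ j => j) (by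
      rintro k hk l hl s' hi hj - hg - -
      refine ⟨?_, hi, hj⟩
      simp [Cond.eval_not, Cond.eval_eq, Expr.eval, hi, hj, hg 0 (by decide), a1]))
    fun s₂ h2 f2 g2 => ?_).mono (by rw [a0]; simp [Cond.steps, Expr.steps]; ring_nf; omega)
    fun _ h => h
  have b0 : s₂.reg 0 = n := by rw [f2 0 (by decide), a0]
  have hinit : ∀ x y, s₂.arr 11 x y ≠ 0 ↔
      (∃ i : Fin n, x = i ∧ y = i) ∨ ∃ i j : Fin n, x = i ∧ y = j ∧ A j i = true := by
    intro x y
    rw [h2, h1, h11, a0, e0]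
    constructor
    · rintro ((h | ⟨k, hk, -, hx, hy⟩) | ⟨k, hk, l, hl, hA, hx, hy⟩)
      · exact absurd rfl h
      · exact Or.inl ⟨⟨k, hk⟩, hx, hy⟩
      · exact Or.inr ⟨⟨k, hk⟩, ⟨l, hl⟩, hx, hy,
          (encodeMatrix_ne_zero_iff A ⟨l, hl⟩ ⟨k, hk⟩).1 hA⟩
    · rintro (⟨i, hx, hy⟩ | ⟨i, j, hx, hy, hA⟩)
      · exact Or.inl (Or.inr ⟨i, i.2, trivial, hx, hy⟩)
      · exact Or.inr ⟨i, i.2, j, j.2, (encodeMatrix_ne_zero_iff A j i).2 hA, hx, hy⟩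
  refine (Runs.forLoop (T := n * (n * 25 + 13) + 6) (fun k s' =>
    (∀ x y, s₂.arr 11 x y ≠ 0 → s'.arr 11 x y ≠ 0) ∧
    (∀ x y, s'.arr 11 x y ≠ 0 → ∃ i j : Fin n, x = i ∧ y = j ∧ Reachable A i j) ∧
    ∀ l < k, ∀ x y, s'.arr 11 x l ≠ 0 → s'.arr 11 l y ≠ 0 → s'.arr 11 x y ≠ 0)
    (by decide) (by decide) (by decide) ⟨fun _ _ h => h, ?_, fun l hl => by omega⟩ ?_).mono
    (by rw [b0]; ring_nf; omega) ?_
  · intro x y h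
    rcases (hinit x y).1 h with ⟨i, hx, hy⟩ | ⟨i, j, hx, hy, hA⟩
    · exact ⟨i, i, hx, hy, .refl⟩
    · exact ⟨i, j, hx, hy, .single hA⟩
  · rintro k hk s₃ h7 hr - ⟨h3, h4, h5⟩
    refine (runs_closurePass (by rw [hr 0 (by decide) (by decide), b0]) h7).mono le_rfl ?_
    intro s₄ h6
    simp only [Mem.setReg_arr]
    refine ⟨fun x y h => (h6 x y).2 (Or.inl (h3 x y h)), fun x y h => ?_, fun l hl x y hx hy => ?_⟩
    · rcases (h6 x y).1 h with h | ⟨-, -, h, h'⟩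
      · exact h4 x y h
      · obtain ⟨i, l, hx, hl, hil⟩ := h4 _ _ h
        obtain ⟨l', j, hl', hy, hlj⟩ := h4 _ _ h'
        obtain rfl : l = l' := Fin.ext (hl.symm.trans hl')
        exact ⟨i, j, hx, hy, hil.trans hlj⟩
    · have hx' := (h6 x l).1 hx
      have hy' := (h6 l y).1 hy
      have hxn : x < n := by
        rcases hx' with h | h
        · obtain ⟨i, -, hx, -⟩ := h4 _ _ h
          omega
        · exact h.1
      have hyn : y < n := by
        rcases hy' with h | h
        · obtain ⟨-, j, -, hy, -⟩ := h4 _ _ h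
          omega
        · exact h.2.1
      -- For an older vertex `l` each factor is either old or passes through the new vertex;
      -- composing the old pieces through `l` leaves one old mark or one composition through the new
      -- vertex.
      rcases Nat.lt_succ_iff_lt_or_eq.1 hl with hlk | rfl
      · rcases hx' with h | ⟨-, -, h, h'⟩ <;> rcases hy' with g | ⟨-, -, g, g'⟩
        · exact (h6 x y).2 (Or.inl (h5 l hlk _ _ h g))
        · exact (h6 x y).2 (Or.inr ⟨hxn, hyn, h5 l hlk _ _ h g, g'⟩)
        · exact (h6 x y).2 (Or.inr ⟨hxn, hyn, h, h5 l hlk _ _ h' g⟩)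
        · exact (h6 x y).2 (Or.inr ⟨hxn, hyn, h, g'⟩)
      · have hx2 : s₃.arr 11 x l ≠ 0 := hx'.elim id fun h => h.2.2.1
        have hy2 : s₃.arr 11 l y ≠ 0 := hy'.elim id fun h => h.2.2.2
        exact (h6 x y).2 (Or.inr ⟨hxn, hyn, hx2, hy2⟩)
  · rintro s' ⟨h3, h4, h5⟩ i j
    rw [b0] at h5
    constructor
    · intro h
      obtain ⟨i', j', hi, hj, h⟩ := h4 _ _ h
      rwa [Fin.ext hi, Fin.ext hj]
    · intro h
      induction h with
      | refl => exact h3 _ _ ((hinit _ _).2 (Or.inl ⟨i, rfl, rfl⟩))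
      | tail _ hA ih =>
        exact h5 _ (Fin.is_lt _) _ _ ih (h3 _ _ ((hinit _ _).2 (Or.inr ⟨_, _, rfl, rfl, hA⟩)))

/-- A linked state is chosen if no smaller linked state lies in its component; register `7` flags
such a smaller state. The chosen column is always column `0`. -/
theorem runs_selection (L : ℕ → Prop) (R : ℕ → ℕ → Prop) (h0 : s.reg 0 = n)
    (hL : ∀ i < n, L i ↔ s.arr 10 (s.arr 3 i 0 + 1) 0 ≠ 0)
    (hR : ∀ i < n, ∀ j < n, R i j ↔ s.arr 11 i j ≠ 0 ∧ s.arr 11 j i ≠ 0) :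
    Runs Prog.selection s (n * (n * 40 + 40) + 6) fun s' => ∀ x y, s'.arr 2 x y ≠ 0 ↔
      s.arr 2 x y ≠ 0 ∨ x < n ∧ y = 0 ∧ L x ∧ ∀ i < x, L i → ¬ R i x := by
  have hlinked : ∀ r k (s' : Mem), s'.arr 3 = s.arr 3 → s'.arr 10 = s.arr 10 → s'.reg r = k →
      k < n → ((Prog.linkedCond r).eval s' = true ↔ L k) := by
    intro r k s' h3 h10 hr hk
    unfold Prog.linkedCond
    rw [Cond.eval_not, Cond.eval_eq, hL k hk]
    simp [Expr.eval, h3, h10, hr]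
  refine (Runs.forLoop (T := n * 40 + 33) (fun k s' => ∀ x y, s'.arr 2 x y ≠ 0 ↔
      s.arr 2 x y ≠ 0 ∨ x < k ∧ y = 0 ∧ L x ∧ ∀ i < x, L i → ¬ R i x)
    (by decide) (by decide) (by decide) (by simp) ?_).mono (by rw [h0]) fun _ h => by rwa [h0] at h
  rintro k hk s₁ hi hr ha h1
  rw [h0] at hk
  have hA : ∀ a, a ≠ 2 → s₁.arr a = s.arr a := fun a h => ha a (by simpa [Prog.arrs, Prog.forLoop] using h)
  refine (Runs.seq (T₂ := n * 40 + 31) (Runs.of_loopFree rfl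
    (Post := fun s' => s'.reg 7 = 0) (by simp [Prog.run, Expr.eval]))
    fun s₂ h2 f2 g2 => ?_).mono (by simp [Prog.cost, Expr.steps]; omega) fun _ h => h
  have b5 : s₂.reg 5 = k := by rw [f2 5 (by decide), hi]
  have bA : ∀ a, s₂.arr a = s₁.arr a := fun a => g2 a (by simp [Prog.arrs])
  refine (Runs.seq (T₂ := 25) (Runs.forLoop (T := 33) (fun k' s' => s'.reg 7 ≠ 0 ↔
    ∃ i < k', L i ∧ R i k) (by decide) (by decide) (by decide) (by simp [h2]) ?_)
    fun s₃ h3 f3 g3 => ?_).mono ?_ fun _ h => h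
  · rintro i hik s₃ e6 f3 g3 h4
    rw [b5] at hik
    have e5 : s₃.reg 5 = k := by rw [f3 5 (by decide) (by decide), b5]
    have eA : ∀ a, a ≠ 2 → s₃.arr a = s.arr a := fun a h => by
      rw [g3 a (by simp [Prog.arrs]), bA, hA a h]
    refine (Runs.of_loopFree rfl ?_).mono (Post₁ := fun s'' => (s''.setReg 6 (i + 1)).reg 7 ≠ 0 ↔
      ∃ i' < i + 1, L i' ∧ R i' k) (by decide) fun _ h => h
    have hcond : (Cond.and (Prog.linkedCond 6) (.and
        (.not (.eq (.read 11 (.reg 6) (.reg 5)) (.const 0)))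
        (.not (.eq (.read 11 (.reg 5) (.reg 6)) (.const 0))))).eval s₃ = true ↔ L i ∧ R i k := by
      rw [Cond.eval_and, Cond.eval_and, Cond.eval_not, Cond.eval_not, Cond.eval_eq, Cond.eval_eq,
        hlinked 6 i s₃ (eA 3 (by decide)) (eA 10 (by decide)) e6 (by omega), hR i (by omega) k hk]
      simp [Expr.eval, e5, e6, eA 11 (by decide)]
    have hex : (∃ i' < i + 1, L i' ∧ R i' k) ↔ (∃ i' < i, L i' ∧ R i' k) ∨ (L i ∧ R i k) := by
      constructor
      · rintro ⟨i', h5, h6⟩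
        rcases Nat.lt_succ_iff_lt_or_eq.1 h5 with h7 | rfl
        · exact Or.inl ⟨i', h7, h6⟩
        · exact Or.inr h6
      · rintro (⟨i', h5, h6⟩ | h6)
        · exact ⟨i', by omega, h6⟩
        · exact ⟨i, by omega, h6⟩
    rw [hex, ← h4, Prog.run]
    by_cases hc : L i ∧ R i k
    · rw [if_pos (hcond.2 hc)]
      simp [Prog.run, Expr.eval, hc]
    · rw [if_neg (fun h => hc (hcond.1 h))]
      simp only [hc, or_false]
      simp [Prog.run]
  · rw [b5] at h3
    have e5 : s₃.reg 5 = k := by rw [f3 5 (by decide), b5]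
    have eA : ∀ a, s₃.arr a = s₁.arr a := fun a => by rw [g3 a (by simp [Prog.arrs, Prog.forLoop]), bA]
    refine (Runs.of_loopFree rfl ?_).mono (Post₁ := fun s'' => ∀ x y,
      (s''.setReg 5 (k + 1)).arr 2 x y ≠ 0 ↔ s.arr 2 x y ≠ 0 ∨ x < k + 1 ∧ y = 0 ∧ L x ∧
        ∀ i < x, L i → ¬ R i x) (by decide) fun _ h => h
    have hcond : (Cond.and (Prog.linkedCond 5) (.eq (.reg 7) (.const 0))).eval s₃ = true ↔
        L k ∧ ∀ i < k, L i → ¬ R i k := by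
      rw [Cond.eval_and, Cond.eval_eq, hlinked 5 k s₃ (by rw [eA, hA 3 (by decide)])
        (by rw [eA, hA 10 (by decide)]) e5 hk]
      refine and_congr_right fun _ => ?_
      have : s₃.reg 7 = 0 ↔ ¬ ∃ i < k, L i ∧ R i k := by rw [← h3, not_not]
      simp only [Expr.eval]
      rw [this]
      push Not
      rfl
    intro x y
    have hlt : x < k + 1 ↔ x < k ∨ x = k := by omega
    rw [Prog.run, Mem.setReg_arr, hlt]
    by_cases hc : L k ∧ ∀ i < k, L i → ¬ R i k
    · rw [if_pos (hcond.2 hc)]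
      simp only [Prog.run, Expr.eval, Mem.setArr_arr, e5, eA]
      split_ifs with hxy
      · obtain ⟨-, rfl, rfl⟩ := hxy
        simp [hc.1]
        exact Or.inr hc.2
      · rw [h1]
        refine or_congr_right ⟨fun h => ⟨Or.inl h.1, h.2⟩, ?_⟩
        rintro ⟨h5 | rfl, h6, h7⟩
        · exact ⟨h5, h6, h7⟩
        · exact absurd ⟨trivial, rfl, h6⟩ hxy
    · rw [if_neg (fun h => hc (hcond.1 h))]
      simp only [Prog.run, eA]
      rw [h1]
      refine or_congr_right ⟨fun h => ⟨Or.inl h.1, h.2⟩, ?_⟩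
      rintro ⟨h5 | rfl, h6, h7⟩
      · exact ⟨h5, h6, h7⟩
      · exact absurd h7 hc
  · rw [b5]
    have : k * (33 + 7) ≤ n * 40 := Nat.mul_le_mul_right _ hk.le
    omega

end

/-! ## Correctness of the program -/

section

variable {n p : ℕ} {A : StructMatrix n n} {C : StructMatrix p n}

theorem structRank_le_width (C : StructMatrix p n) : structRank C ≤ n := by
  obtain ⟨θ, hθ⟩ := (grank_isGreatest fun θ : Params C => realize C θ).1
  rw [structRank, ← hθ]
  exact Matrix.rank_le_width _

/-- The output that belongs to a greedy matching. -/
def IsOutputOf (A : StructMatrix n n) (m : ℕ → ℕ) (s : Mem) : Prop :=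
  s.reg 2 = max 1 (Nat.count (fun i => m i = n + n + i + 1) n) ∧
  ∀ x y, s.arr 2 x y ≠ 0 ↔
    (x < n ∧ m x = n + n + x + 1 ∧ y = Nat.count (fun i => m i = n + n + i + 1) x) ∨
    (x < n ∧ y = 0 ∧ (∃ r < n, m r = n + x + 1) ∧ ∀ i < x, (∃ r < n, m r = n + i + 1) →
      ¬ ∃ i' x' : Fin n, i = i' ∧ x = x' ∧ Reachable A i' x' ∧ Reachable A x' i')

theorem runs_main (hp : 0 < p) (hpn : p ≤ n) :
    Runs Prog.main (inputMem A C) (10000 * n ^ 3) fun s' =>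
      ∃ m, IsGreedyMatching (NetAdj A C) (n + n + n) (n + p) m ∧ IsOutputOf A m s' := by
  have hs := hasInput_inputMem A C
  have hz : ∀ a, 2 ≤ a → ∀ x y, (inputMem A C).arr a x y = 0 := by
    intro a ha x y
    simp only [inputMem]
    rw [if_neg (by omega), if_neg (by omega)]
  have hz' : ∀ a, 2 ≤ a → ∀ s : Mem, s.arr a = (inputMem A C).arr a → ∀ x y, s.arr a x y = 0 :=
    fun a ha s h x y => by rw [h, hz a ha]
  apply Runs.mono (h := ?run) (hT := ?le) (hP := fun _ h => h)
  case run =>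
    apply Runs.seq (runs_offsets hs)
    intro s₁ o₁ f1 g1
    have hs₁ : s₁.HasInput A C :=
      hs.of_eq (f1 0 (by decide)) (f1 1 (by decide)) (g1 0 (by decide)) (g1 1 (by decide))
    apply Runs.seq (runs_graph hs₁ o₁ hpn (hz' 4 (by decide) _ (g1 4 (by decide))))
    intro s₂ h2 f2 g2
    have hs₂ : s₂.HasInput A C :=
      hs₁.of_eq (f2 0 (by decide)) (f2 1 (by decide)) (g2 0 (by decide)) (g2 1 (by decide))
    have o₂ : s₂.HasOffsets n p := o₁.of_eq (f2 3 (by decide)) (f2 4 (by decide)) (g2 3 (by decide))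
    have hm := runs_matching h2 o₂.reg_three fun x =>
      hz' 5 (by decide) s₂ ((g2 5 (by decide)).trans (g1 5 (by decide))) x 0
    rw [o₂.reg_four] at hm
    apply Runs.seq hm
    intro s₃ h3 f3 g3
    have hs₃ : s₃.HasInput A C :=
      hs₂.of_eq (f3 0 (by decide)) (f3 1 (by decide)) (g3 0 (by decide)) (g3 1 (by decide))
    have o₃ : s₃.HasOffsets n p := o₂.of_eq (f3 3 (by decide)) (f3 4 (by decide)) (g3 3 (by decide))
    have i₃ : ∀ a ∉ Prog.offsets.arrs ++ Prog.graph.arrs ++ Prog.matching.arrs,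
        s₃.arr a = (inputMem A C).arr a := by
      intro a ha
      simp only [List.mem_append, not_or] at ha
      rw [g3 a ha.2, g2 a ha.1.2, g1 a ha.1.1]
    apply Runs.seq (runs_columns (fun i => s₃.arr 5 i 0 = n + n + i + 1) hs₃.reg_zero
      (fun i hi => by rw [o₃.offset_one i hi]) (hz' 2 (by decide) _ (i₃ 2 (by decide))))
    intro s₄ h4 f4 g4
    have hs₄ : s₄.HasInput A C :=
      hs₃.of_eq (f4 0 (by decide)) (f4 1 (by decide)) (g4 0 (by decide)) (g4 1 (by decide))
    apply Runs.seq (runs_marks hs₄.reg_zero (hz' 10 (by decide) _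
      ((g4 10 (by decide)).trans (i₃ 10 (by decide)))))
    intro s₅ h5 f5 g5
    have hs₅ : s₅.HasInput A C :=
      hs₄.of_eq (f5 0 (by decide)) (f5 1 (by decide)) (g5 0 (by decide)) (g5 1 (by decide))
    apply Runs.seq (runs_closure hs₅ (hz' 11 (by decide) _ ((g5 11 (by decide)).trans
      ((g4 11 (by decide)).trans (i₃ 11 (by decide))))))
    intro s₆ h6 f6 g6
    refine (runs_selection (fun i => ∃ r < n, s₃.arr 5 r 0 = n + i + 1)
      (fun i j => ∃ i' j' : Fin n, i = i' ∧ j = j' ∧ Reachable A i' j' ∧ Reachable A j' i')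
      ((f6 0 (by decide)).trans hs₅.reg_zero) ?_ ?_).frame.mono le_rfl fun s₇ h => ?_
    · intro i hi
      rw [g6 3 (by decide), g6 10 (by decide), g5 3 (by decide), g4 3 (by decide),
        o₃.offset_zero i hi, h5, g4 5 (by decide)]
    · intro i hi j hj
      rw [h6 ⟨i, hi⟩ ⟨j, hj⟩, h6 ⟨j, hj⟩ ⟨i, hi⟩]
      constructor
      · rintro ⟨i', j', rfl, rfl, h⟩
        exact h
      · intro h
        exact ⟨⟨i, hi⟩, ⟨j, hj⟩, rfl, rfl, h⟩
    · obtain ⟨h7, f7, g7⟩ := h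
      refine ⟨fun x => s₃.arr 5 x 0, h3, ?_, fun x y => ?_⟩
      · rw [f7 2 (by decide), f6 2 (by decide), f5 2 (by decide), h4.1]
      · rw [h7, g6 2 (by decide), g5 2 (by decide), h4.2]
  case le =>
    -- With `p ≤ n` and `1 ≤ n ≤ n² ≤ n³`, every term of the running time is absorbed by a multiple
    -- of `n³`.
    have h1 : 1 ≤ n := by omega
    have h2 : n ≤ n ^ 2 := Nat.le_self_pow two_ne_zero n
    have h3 : n ^ 2 ≤ n ^ 3 := Nat.pow_le_pow_right h1 (by decide)
    have h4 : n * (p * 20) ≤ n * (n * 20) := by gcongr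
    have h5 : (n + n + n) * ((n + p + 1) * (48 * (n + p) + 42) + 11 * (n + p) + 71) ≤
        (n + n + n) * ((n + n + 1) * (48 * (n + n) + 42) + 11 * (n + n) + 71) := by gcongr
    ring_nf at h4 h5 ⊢
    omega

end

section

variable {n p : ℕ} {A : StructMatrix n n} {C : StructMatrix p n}

/-- The flow is that of the linking of the matching. The enumeration numbers an input state by the
input states below it, and the choice in a component is its least linked state with column `0`. -/
theorem isAlgorithmOutput_of_isOutputOf {m : ℕ → ℕ} {s : Mem}
    (hm : IsGreedyMatching (NetAdj A C) (n + n + n) (n + p) m) (hp : 0 < p)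
    (hC : structRank C = p) (ho : IsOutputOf A m s) :
    IsAlgorithmOutput A C (outputCols s) (outputMatrix n s) := by
  obtain ⟨K, hI, hL, hmax⟩ := hm.exists_linking hp hC
  have hn : 0 < n := hp.trans_le (hC ▸ structRank_le_width C)
  set P : ℕ → Prop := fun i => m i = n + n + i + 1 with hP
  have hcard : (inputStates K.flow).card = Nat.count P n := by
    rw [Nat.count_eq_card_filter_range, ← Finset.card_map Fin.valEmbedding]
    congr 1
    ext x
    simp only [Finset.mem_map, hI, Finset.mem_filter, Finset.mem_range, Fin.valEmbedding_apply]
    constructor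
    · rintro ⟨i, hi, rfl⟩
      exact ⟨i.2, hi⟩
    · rintro ⟨hx, hi⟩
      exact ⟨⟨x, hx⟩, hi, rfl⟩
  let φ : inputStates K.flow → Fin (inputStates K.flow).card := fun j =>
    ⟨Nat.count P j.1, hcard ▸ Nat.count_strict_mono ((hI j.1).1 j.2) j.1.2⟩
  have hφ : Function.Bijective φ := by
    rw [Fintype.bijective_iff_injective_and_card]
    refine ⟨fun i j hij => Subtype.ext (Fin.ext ?_), by simp⟩
    exact Nat.count_injective ((hI i.1).1 i.2) ((hI j.1).1 j.2) (Fin.mk.inj hij)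
  have hcols : outputCols s = max 1 (inputStates K.flow).card := by rw [hcard]; exact ho.1
  have hsel : ∀ S : Set (Fin n), ∃ i : Fin n, (S ∩ linkedStates K.flow).Nonempty →
      i ∈ S ∩ linkedStates K.flow ∧ ∀ j ∈ S ∩ linkedStates K.flow, i ≤ j := by
    intro S
    by_cases h : (S ∩ linkedStates K.flow).Nonempty
    · obtain ⟨i, hi⟩ := (S ∩ linkedStates K.flow).toFinite.exists_minimal h
      exact ⟨i, fun _ => ⟨hi.1, fun j hj => (le_total i j).elim id fun h => hi.2 hj h⟩⟩
    · exact ⟨⟨0, hn⟩, fun h' => absurd h' h⟩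
  choose g₀ hg₀ using hsel
  refine ⟨K.flow, isMinCostMaxFlow_of_stateValue K.isFlow K.flowValue_flow hmax, K.isIntegral, hcols,
    (Equiv.ofBijective φ hφ).symm, fun S => (g₀ S, ⟨0, by rw [hcols]; omega⟩),
    fun S _ hS => (hg₀ S hS).1.1, fun j k => ?_⟩
  have hout : outputMatrix n s j k = true ↔ s.arr 2 j k ≠ 0 := decide_eq_true_iff
  rw [hout, ho.2]
  refine or_congr ⟨?_, ?_⟩ ⟨?_, ?_⟩
  · rintro ⟨-, h1, h2⟩
    have hj := (hI j).2 h1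
    have h3 : (k : ℕ) < (inputStates K.flow).card := by
      rw [h2]
      exact (φ ⟨j, hj⟩).2
    refine ⟨h3, ?_⟩
    have : (⟨k, h3⟩ : Fin (inputStates K.flow).card) = Equiv.ofBijective φ hφ ⟨j, hj⟩ := Fin.ext h2
    rw [this, Equiv.symm_apply_apply]
  · rintro ⟨h3, h4⟩
    obtain ⟨⟨i, hi⟩, hik⟩ := (Equiv.ofBijective φ hφ).surjective ⟨k, h3⟩
    rw [← hik, Equiv.symm_apply_apply] at h4
    obtain rfl : i = j := h4
    exact ⟨i.2, (hI i).1 hi, (congrArg Fin.val hik).symm⟩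
  · rintro ⟨-, h1, h2, h3⟩
    have hj := (hL j).2 h2
    let S : Set (Fin n) := {i | Reachable A j i ∧ Reachable A i j}
    have hS : (S ∩ linkedStates K.flow).Nonempty := ⟨j, ⟨.refl, .refl⟩, hj⟩
    refine ⟨S, ⟨j, rfl⟩, hS, Prod.ext ?_ (Fin.ext h1.symm)⟩
    obtain ⟨h4, h5⟩ := hg₀ S hS
    refine le_antisymm (h5 j ⟨⟨.refl, .refl⟩, hj⟩) (not_lt.1 fun hlt => ?_)
    exact h3 _ hlt ((hL _).1 h4.2) ⟨_, _, rfl, rfl, h4.1.2, h4.1.1⟩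
  · rintro ⟨S, ⟨i₀, rfl⟩, hS, hg⟩
    obtain ⟨h4, h5⟩ := hg₀ _ hS
    obtain ⟨h6, h7⟩ := Prod.ext_iff.1 hg
    simp only at h6 h7
    rw [h6] at h4 h5
    refine ⟨j.2, (congrArg Fin.val h7).symm, (hL j).1 h4.2, ?_⟩
    rintro i hij hli ⟨i', j', rfl, hj', h8, h9⟩
    obtain rfl : j = j' := Fin.ext hj'
    have := h5 i' ⟨⟨h4.1.1.trans h9, h8.trans h4.1.2⟩, (hL i').2 hli⟩
    exact absurd hij (not_lt.2 this)

end

/-! ### Optimality of the algorithm -/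

section

variable {n p : ℕ} {A : StructMatrix n n} {C : StructMatrix p n}

theorem StructurallyOutputControllable.max_le {m : ℕ} {B : StructMatrix n m}
    (h : StructurallyOutputControllable A B C) (hp : 0 < p) :
    max 1 (p - structRankMul C A) ≤ m := by
  obtain ⟨α, β, γ, h⟩ := h
  have h1 := h.le_add_rank
  have h2 : (realize C γ * realize A α).rank ≤ structRankMul C A :=
    (grank_isGreatest fun θ : Params C × Params A => realize C θ.1 * realize A θ.2).2
      ⟨(γ, α), rfl⟩
  have h3 := h.pos_of_pos hp
  omega

/-- The cheapest linkings. -/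
theorem exists_linking_stateValue_max (hp : 0 < p) (hC : structRank C = p) :
    ∃ K : Linking A C p, ∀ g, (flowNetwork A C).IsFlow g → stateValue g ≤ stateValue K.flow := by
  -- The greedy matching whose existence is needed is the one that the program computes.
  obtain ⟨s, -, -, -, m, hm, -⟩ := runs_main (A := A) (C := C) hp (hC ▸ structRank_le_width C)
  obtain ⟨K, -, -, hmax⟩ := hm.exists_linking hp hC
  exact ⟨K, hmax⟩

/-- The number of input states equals the minimum cost and is squeezed: comparison with a flow of
maximal state value bounds it above by `p - grank CA`, and the paths of `f` that start in `x²`, at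
most `grank CA` many, bound it below. The paths of `f` then supply the linking for controllability;
a linked state is reachable because its component contains a chosen state. -/
theorem IsAlgorithmOutput.eq_max_and_structurallyOutputControllable {m : ℕ} {B : StructMatrix n m}
    (h : IsAlgorithmOutput A C m B) (hp : 0 < p) (hA : GenericallyDiagonalizable A)
    (hC : structRank C = p) :
    m = max 1 (p - structRankMul C A) ∧ StructurallyOutputControllable A B C := by
  classical
  obtain ⟨f, ⟨⟨hf, hfmax⟩, hfmin⟩, hint, rfl, e, g, hg, hB⟩ := h
  obtain ⟨K₀, hK₀⟩ := exists_linking_stateValue_max (A := A) hp hC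
  obtain ⟨K₁, hK₁⟩ := exists_linking_of_structRankMul C A
  have hval : (flowNetwork A C).flowValue f = p :=
    le_antisymm hf.flowValue_le.1 (K₀.flowValue_flow ▸ hfmax _ K₀.isFlow)
  have hcost : (inputStates f).card + structRankMul C A ≤ p := by
    have h1 := hfmin K₀.flow ⟨K₀.isFlow, fun g hg => K₀.flowValue_flow ▸ hg.flowValue_le.1⟩
    obtain ⟨-, -, -, -, -, -, h2, h3⟩ := K₀.isFlow.balance
    -- `K₁` need not have full value, but all its paths start in `x²`, so its state value is `grank
    -- CA`.
    have h4 := hK₀ _ K₁.isFlow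
    rw [K₁.stateValue_flow, Finset.filter_true_of_mem fun j _ => hK₁ j, Finset.card_univ,
      Fintype.card_fin] at h4
    rw [K₀.flowValue_flow] at h2
    rw [← hf.card_inputStates hint] at h1
    have : ((inputStates f).card : ℝ) + structRankMul C A ≤ p := by linarith
    exact_mod_cast this
  obtain ⟨K, hdst, hvia, hsrc⟩ := hf.exists_linking hint hval
  have hle : p ≤ (inputStates f).card + structRankMul C A := by
    have h1 := K.card_le_structRankMul
    have h2 : (Finset.univ.filter fun j => K.src j = none).card ≤ (inputStates f).card :=
      Finset.card_le_card_of_injOn K.via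
        (fun j hj => hvia j (Finset.mem_filter.1 (Finset.mem_coe.1 hj)).2) K.via_inj.injOn
    have h3 := Finset.card_filter_add_card_filter_not (s := (Finset.univ : Finset (Fin p)))
      fun j => K.src j = none
    rw [Finset.card_univ, Fintype.card_fin] at h3
    simp only [← ne_eq] at h3
    omega
  refine ⟨by omega, ?_⟩
  have hlt : ∀ k : Fin (inputStates f).card, (k : ℕ) < max 1 (inputStates f).card := fun k =>
    k.2.trans_le (le_max_right _ _)
  refine K.structurallyOutputControllable hA hdst (fun j => if hj : K.src j = none then
    ⟨e.symm ⟨K.via j, hvia j hj⟩, hlt _⟩ else ⟨0, by omega⟩) ?_ ?_ ?_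
  · intro j hj
    rw [dif_pos hj, hB]
    exact Or.inl ⟨(e.symm ⟨K.via j, hvia j hj⟩).2, by simp⟩
  · intro i j hi hj hij
    rw [dif_pos hi, dif_pos hj] at hij
    have := e.symm.injective (Fin.ext (Fin.mk.inj hij))
    exact K.via_inj (Subtype.mk.inj this)
  · intro j k hk
    let S : Set (Fin n) := {i | Reachable A k i ∧ Reachable A i k}
    have hS : (S ∩ linkedStates f).Nonempty := ⟨k, ⟨.refl, .refl⟩, hsrc j k hk⟩
    exact ⟨(g S).1, (g S).2, (hB _ _).2 (Or.inr ⟨S, ⟨k, rfl⟩, hS, rfl⟩), (hg S ⟨k, rfl⟩ hS).2⟩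

theorem exists_exec_isAlgorithmOutput (hp : 0 < p) (hC : structRank C = p) :
    ∃ s t, Exec Prog.main (inputMem A C) s t ∧ t ≤ 10000 * n ^ 3 ∧
      IsAlgorithmOutput A C (outputCols s) (outputMatrix n s) := by
  obtain ⟨s, t, h1, h2, m, hm, ho⟩ :=
    runs_main (A := A) (C := C) hp (hC ▸ structRank_le_width C)
  exact ⟨s, t, h1, h2, isAlgorithmOutput_of_isOutputOf hm hp hC ho⟩

end

end StructuredSystem
theorem mainTheorem6 :
    (∀ (n p : ℕ) (A : StructuredSystem.StructMatrix n n) (C : StructuredSystem.StructMatrix p n),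
      0 < p → StructuredSystem.GenericallyDiagonalizable A → StructuredSystem.structRank C = p →
      IsLeast {m : ℕ | ∃ B : StructuredSystem.StructMatrix n m,
          StructuredSystem.StructurallyOutputControllable A B C}
        (max 1 (p - StructuredSystem.structRankMul C A)) ∧
      ∀ (m : ℕ) (B : StructuredSystem.StructMatrix n m),
        StructuredSystem.IsAlgorithmOutput A C m B →
          m = max 1 (p - StructuredSystem.structRankMul C A) ∧
          StructuredSystem.StructurallyOutputControllable A B C) ∧
    ∃ (P : StructuredSystem.Prog) (K : ℕ),
      ∀ (n p : ℕ) (A : StructuredSystem.StructMatrix n n)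
        (C : StructuredSystem.StructMatrix p n),
        0 < p → StructuredSystem.GenericallyDiagonalizable A → StructuredSystem.structRank C = p →
        ∃ (s : StructuredSystem.Mem) (t : ℕ),
          StructuredSystem.Exec P (StructuredSystem.inputMem A C) s t ∧
          t ≤ K * n ^ 3 ∧
          StructuredSystem.IsAlgorithmOutput A C (StructuredSystem.outputCols s)
            (StructuredSystem.outputMatrix n s) := by
  refine ⟨fun n p A C hp hA hC => ⟨⟨?_, ?_⟩, ?_⟩, StructuredSystem.Prog.main, 10000,
    fun n p A C hp _ hC => StructuredSystem.exists_exec_isAlgorithmOutput hp hC⟩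
  -- The minimum is attained by the output of the program, which also shows that the algorithm has
  -- an output at all.
  · obtain ⟨s, -, -, -, h⟩ := StructuredSystem.exists_exec_isAlgorithmOutput (A := A) hp hC
    obtain ⟨h1, h2⟩ := h.eq_max_and_structurallyOutputControllable hp hA hC
    rw [← h1]
    exact ⟨_, h2⟩
  · rintro m ⟨B, hB⟩
    exact hB.max_le hp
  · intro m B hB
    exact hB.eq_max_and_structurallyOutputControllable hp hA hC
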